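/- **Setting.** Let $l,L>0$ and $\Omega:=(-l,l)\times(-L,\infty)\subset\mathbb R^2$. A set $K\subset\mathbb R^2$ is called $\mathcal H^1$-rectifiable if $\mathcal H^1(K)<\infty$ and $\lim_{r\to0^+}\mathcal H^1(K\cap B_r(x))/(2r)=1$ for $\mathcal H^1$-a.e. $x\in K$. An admissible pair $(h,K)\in \mathrm{AHK}(\Omega)$ consists of an upper semicontinuous function $h:[-l,l]\to[0,L]$ of finite pointwise variation and a closed $\mathcal H^1$-rectifiable set $K\subset\overline\Omega$ with $K\subset\overline{\mathrm{Int}(S_h)}$, where $S_h:=\{(x,y): -l\le x\le l,\ y\le h(x)\}$. Put $S_{h,K}:=(S_h\setminus K)\cap\overline\Omega$. $\mathcal B^1$ is the set of all pairs $(S_{h^1,K^1},S_{h^0,K^0})$ (film composite, substrate) with $(h^i,K^i)\in\mathrm{AHK}(\Omega)$ for $i=0,1$, $h^0\le h^1$ on $[-l,l]$ and $\partial S_{h^1,K^1}\cap\mathrm{Int}(S_{h^0,K^0})=\emptyset$. For $\mathbf m=(m_1,m_0)\in\mathbb N^2$, $\mathcal B^1_{\mathbf m}$ is the set of those pairs in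 $\mathcal B^1$ for which $\partial S_{h^i,K^i}$ has at most $m_i$ connected components for $i=0,1$. The signed distance is $\mathrm{sdist}(x,\partial E):=\mathrm{dist}(x,E)$ if $x\notin E$ and $-\mathrm{dist}(x,\mathbb R^2\setminus E)$ if $x\in E$. A sequence $(S^1_k,S^0_k)\in\mathcal B^1$ $\tau_{\mathcal B^1}$-converges to $(S^1,S^0)\in\mathcal B^1$ if, for $i=0,1$, $\sup_k\mathcal H^1(\partial S^i_k)<\infty$ and $\mathrm{sdist}(\cdot,\partial S^i_k)\to\mathrm{sdist}(\cdot,\partial S^i)$ locally uniformly in $\mathbb R^2$. **Surface energy.** Let $\varphi_0,\varphi_1,\varphi_{01}:\overline\Omega\times\mathbb R^2\to\mathbb R$, $\varphi^1:=\min\{\varphi_0,\varphi_1+\varphi_{01}\}$ and $\varphi^2:=\min\{\varphi_1,\varphi_0\}$. Assume that $\varphi_1,\varphi_{01},\varphi^1,\varphi^2$ are Finsler norms (continuous on $\overline\Omega\times\mathbb R^2$ and a norm in the second variable), that there are $c_2\ge c_1>0$ with $c_1|\xi|\le\varphi_1(x,\xi),\varphi^1(x,\xi),\varphi_{01}(x,\xi)\le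 c_2|\xi|$, and that $\varphi^1(x,\xi)\ge|\varphi_{01}(x,\xi)-\varphi_1(x,\xi)|$, for all $x\in\overline\Omega$, $\xi\in\mathbb R^2$. For $(S_1,S_0)\in\mathcal B^1$ let $$\mathcal S^1(S_1,S_0):=\int_{\partial S_0\cup\partial S_1}\psi\,d\mathcal H^1,$$ where, writing $\partial^*E$ for the reduced boundary, $E^{(\theta)}$ for the points of density $\theta$ and $\nu_i$ for the unit normal of $\partial S_i$ (the outer normal on $\partial^*S_i$, and a normal to the approximate tangent line elsewhere), $\psi(x)$ equals - $\varphi_1(x,\nu_1)$ on $\Omega\cap(\partial^*S_1\setminus\partial^*S_0)$; - $\varphi^1(x,\nu_1)$ on $\Omega\cap\partial^*S_0\cap\partial^*S_1$; - $\varphi_{01}(x,\nu_0)$ on $\Omega\cap(\partial^*S_0\setminus\partial S_1)$; - $(\varphi_1+\varphi^1)(x,\nu_1)$ on $\Omega\cap\partial^*S_0\cap\partial S_1\cap S_1^{(1)}$; - $2\varphi_1(x,\nu_1)$ on $\Omega\cap\partial S_1\cap S_1^{(1)}\cap S_0^{(0)}$; - $2\varphi^2(x,\nu_1)$ on $\Omega\cap\partial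 S_1\cap S_1^{(0)}$; - $2\varphi_{01}(x,\nu_0)$ on $\Omega\cap(\partial S_0\setminus\partial S_1)\cap(S_0^{(1)}\cup S_0^{(0)})\cap S_1^{(1)}$; - $\varphi^1(x,\nu_1)$ on $\Omega\cap\partial S_0\cap\partial S_1\cap S_0^{(1)}$; and $\psi=0$ elsewhere. **Proposition.** Let $\mathbf m\in\mathbb N^2$ and let $(S_{h^1_k,K^1_k},S_{h^0_k,K^0_k})_{k\in\mathbb N}\subset\mathcal B^1_{\mathbf m}$ satisfy $$\sup_{k\in\mathbb N}\Big(\mathcal S^1(S_{h^1_k,K^1_k},S_{h^0_k,K^0_k})+\mathcal L^2(S_{h^1_k,K^1_k})\Big)<\infty .$$ Then there are a subsequence and a pair $(S_{h^1,K^1},S_{h^0,K^0})\in\mathcal B^1_{\mathbf m}$ (in particular $h^0\le h^1$) such that the subsequence $\tau_{\mathcal B^1}$-converges to $(S_{h^1,K^1},S_{h^0,K^0})$. -/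

import Mathlib

open MeasureTheory Set Filter Topology
open scoped ENNReal ContDiff

namespace FilmLayers

noncomputable section

/-- The Euclidean plane. -/
abbrev Plane : Type := EuclideanSpace ℝ (Fin 2)

/-- The one-dimensional Hausdorff measure on the plane. -/
abbrev H1 : Measure Plane := Measure.hausdorffMeasure 1

/-- The container `Ω = (-l, l) × (-L, ∞)`. -/
def Omega (l L : ℝ) : Set Plane := {p | p 0 ∈ Ioo (-l) l ∧ -L < p 1}

/-! ### Geometric measure theory -/

/-- The set of points of density `θ` of `E`. -/
def densityPoints (E : Set Plane) (θ : ℝ≥0∞) : Set Plane :=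
  {x | Tendsto (fun r : ℝ => volume (E ∩ Metric.ball x r) / volume (Metric.ball x r))
    (𝓝[>] 0) (𝓝 θ)}

/-- `K` has finite `H1`-measure, and one-dimensional density one at `H1`-almost each of its
points. Sets of measure zero (in particular the empty crack) are included. -/
def IsH1Rectifiable (K : Set Plane) : Prop :=
  H1 K < ⊤ ∧
    ∀ᵐ x ∂(H1.restrict K),
      Tendsto (fun r : ℝ => H1 (K ∩ Metric.ball x r) / ENNReal.ofReal (2 * r)) (𝓝[>] 0) (𝓝 1)

/-- The divergence of a vector field on the plane. -/
def divergence (X : Plane → Plane) (x : Plane) : ℝ :=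
  ∑ i : Fin 2, fderiv ℝ X x (EuclideanSpace.single i 1) i

/-- `E` has finite perimeter and `-σ P` is the polar decomposition of the distributional
derivative `D 1_E`, that is, `P = |D 1_E|` and `D 1_E = -σ P`. -/
structure IsPolarOfDeriv (E : Set Plane) (P : Measure Plane) (σ : Plane → Plane) : Prop where
  finite : IsFiniteMeasure P
  measurable : Measurable σ
  norm_eq_one : ∀ᵐ x ∂P, ‖σ x‖ = 1
  integral_div : ∀ X : Plane → Plane, ContDiff ℝ ∞ X → HasCompactSupport X →
    ∫ x in E, divergence X x = ∫ x, inner ℝ (X x) (σ x) ∂P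

/-- `ν` is the measure-theoretic outer unit normal of `E` at `x`:
`ν = - lim D 1_E (B_r x) / |D 1_E| (B_r x)` as `r → 0`, and `|ν| = 1`. -/
def IsOuterNormal (E : Set Plane) (x ν : Plane) : Prop :=
  ‖ν‖ = 1 ∧ ∃ (P : Measure Plane) (σ : Plane → Plane), IsPolarOfDeriv E P σ ∧
    (∀ r : ℝ, 0 < r → 0 < P (Metric.ball x r)) ∧
    Tendsto (fun r : ℝ => ⨍ y in Metric.ball x r, σ y ∂P) (𝓝[>] 0) (𝓝 ν)

/-- The reduced boundary. -/
def reducedBoundary (E : Set Plane) : Set Plane := {x | ∃ ν, IsOuterNormal E x ν}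

/-- `ν` is a unit vector orthogonal to the approximate tangent line of `Γ` at `x`: the set `Γ` has
positive upper density at `x`, and its part outside every cone around the line `x + ν^⊥` has
density zero at `x`. -/
def IsApproxNormal (Γ : Set Plane) (x ν : Plane) : Prop :=
  ‖ν‖ = 1 ∧
    0 < limsup (fun r : ℝ => H1 (Γ ∩ Metric.ball x r) / ENNReal.ofReal (2 * r)) (𝓝[>] 0) ∧
    ∀ s : ℝ, 0 < s →
      Tendsto (fun r : ℝ =>
        H1 {y ∈ Γ ∩ Metric.ball x r | s * ‖y - x‖ < |inner ℝ ν (y - x)|} / ENNReal.ofReal (2 * r))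
        (𝓝[>] 0) (𝓝 0)

open Classical in
/-- The unit normal `ν_E` on the boundary of `E`: the outer normal on the reduced boundary, and
elsewhere a unit normal (determined up to sign) to the rectifiable set `∂E`. If `∂E` is
rectifiable, the remaining points of `∂E` are `H1`-negligible, and a fixed unit vector is used
there. -/
def unitNormal (E : Set Plane) (x : Plane) : Plane :=
  if h : ∃ ν, IsOuterNormal E x ν then h.choose
  else if h : ∃ ν, IsApproxNormal (frontier E) x ν then h.choose
  else EuclideanSpace.single 1 1

open Classical in
/-- The signed distance from `∂E`, negative inside `E`. -/
def sdist (E : Set Plane) (x : Plane) : ℝ :=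
  if x ∈ E then -Metric.infDist x Eᶜ else Metric.infDist x E

/-! ### Admissible heights, cracks and layers -/

/-- Admissible heights `h : [-l, l] → [0, L]`: upper semicontinuous with finite pointwise
variation. Only the values on `[-l, l]` matter. -/
structure IsAdmissibleHeight (l L : ℝ) (h : ℝ → ℝ) : Prop where
  mapsTo : MapsTo h (Icc (-l) l) (Icc 0 L)
  usc : UpperSemicontinuousOn h (Icc (-l) l)
  variation : BoundedVariationOn h (Icc (-l) l)

/-- The closed subgraph `S_h`. -/
def subgraph (l : ℝ) (h : ℝ → ℝ) : Set Plane := {p | p 0 ∈ Icc (-l) l ∧ p 1 ≤ h (p 0)}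

/-- Admissible cracks. -/
structure IsAdmissibleCrack (l L : ℝ) (K : Set Plane) : Prop where
  subset : K ⊆ closure (Omega l L)
  closed : IsClosed K
  rectifiable : IsH1Rectifiable K

/-- Admissible pairs of a height and a crack set. -/
structure IsAdmissiblePair (l L : ℝ) (h : ℝ → ℝ) (K : Set Plane) : Prop where
  height : IsAdmissibleHeight l L h
  crack : IsAdmissibleCrack l L K
  subset : K ⊆ closure (interior (subgraph l h))

/-- The subgraph `S_{h,K}` with height `h` and cracks `K`. -/
def region (l L : ℝ) (h : ℝ → ℝ) (K : Set Plane) : Set Plane :=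
  (subgraph l h \ K) ∩ closure (Omega l L)

/-- The family `B^1` of pairs (film composite, substrate). -/
def B1 (l L : ℝ) : Set (Set Plane × Set Plane) :=
  {A | ∃ (h₁ h₀ : ℝ → ℝ) (K₁ K₀ : Set Plane),
    IsAdmissiblePair l L h₁ K₁ ∧ IsAdmissiblePair l L h₀ K₀ ∧
    A = (region l L h₁ K₁, region l L h₀ K₀) ∧
    (∀ x ∈ Icc (-l) l, h₀ x ≤ h₁ x) ∧
    frontier (region l L h₁ K₁) ∩ interior (region l L h₀ K₀) = ∅}

/-- The family `B^1_m`: the boundary of the film composite has at most `m₁` connected components,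
and that of the substrate at most `m₀`. -/
def B1m (l L : ℝ) (m₁ m₀ : ℕ) : Set (Set Plane × Set Plane) :=
  {A ∈ B1 l L | ENat.card (ConnectedComponents (frontier A.1)) ≤ m₁ ∧
    ENat.card (ConnectedComponents (frontier A.2)) ≤ m₀}

/-- Convergence in `τ_{B^1}`. -/
structure TauConverges (l L : ℝ) (A : ℕ → Set Plane × Set Plane) (B : Set Plane × Set Plane) :
    Prop where
  mem : ∀ k, A k ∈ B1 l L
  mem_limit : B ∈ B1 l L
  length_film : (⨆ k, H1 (frontier (A k).1)) < ⊤
  length_substrate : (⨆ k, H1 (frontier (A k).2)) < ⊤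
  sdist_film : TendstoLocallyUniformly (fun k => sdist (A k).1) (sdist B.1) atTop
  sdist_substrate : TendstoLocallyUniformly (fun k => sdist (A k).2) (sdist B.2) atTop

/-! ### Surface tensions and the surface energy -/

/-- The regime tension `φ^1_{01} = min {φ_0, φ_1 + φ_{01}}`. -/
def regimeOne (φ₀ φ₁ φ₀₁ : Plane → Plane → ℝ) (x ξ : Plane) : ℝ :=
  min (φ₀ x ξ) (φ₁ x ξ + φ₀₁ x ξ)

/-- The regime tension `φ^2_{01} = min {φ_1, φ_0}`. -/
def regimeTwo (φ₀ φ₁ : Plane → Plane → ℝ) (x ξ : Plane) : ℝ := min (φ₁ x ξ) (φ₀ x ξ)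

/-- Continuous Finsler norms on `closure Ω`. -/
structure IsFinslerNorm (l L : ℝ) (φ : Plane → Plane → ℝ) : Prop where
  continuousOn : ContinuousOn (Function.uncurry φ) (closure (Omega l L) ×ˢ univ)
  homogeneous : ∀ x ∈ closure (Omega l L), ∀ (t : ℝ) (ξ : Plane), φ x (t • ξ) = |t| * φ x ξ
  subadditive : ∀ x ∈ closure (Omega l L), ∀ ξ η : Plane, φ x (ξ + η) ≤ φ x ξ + φ x η
  pos : ∀ x ∈ closure (Omega l L), ∀ ξ : Plane, ξ ≠ 0 → 0 < φ x ξ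

/-- `c₁ |ξ| ≤ φ(x, ξ) ≤ c₂ |ξ|` on `closure Ω`. -/
def IsComparable (l L c₁ c₂ : ℝ) (φ : Plane → Plane → ℝ) : Prop :=
  ∀ x ∈ closure (Omega l L), ∀ ξ : Plane, c₁ * ‖ξ‖ ≤ φ x ξ ∧ φ x ξ ≤ c₂ * ‖ξ‖

/-- The standing assumptions on the surface tensions: Finsler norms with uniform two-sided bounds,
and `φ^1_{01} ≥ |φ_{01} - φ_1|`. -/
structure AdmissibleTensions (l L : ℝ) (φ₀ φ₁ φ₀₁ : Plane → Plane → ℝ) : Prop where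
  finsler_film : IsFinslerNorm l L φ₁
  finsler_interface : IsFinslerNorm l L φ₀₁
  finsler_regimeOne : IsFinslerNorm l L (regimeOne φ₀ φ₁ φ₀₁)
  finsler_regimeTwo : IsFinslerNorm l L (regimeTwo φ₀ φ₁)
  bounds : ∃ c₁ c₂ : ℝ, 0 < c₁ ∧ c₁ ≤ c₂ ∧ IsComparable l L c₁ c₂ φ₁ ∧
    IsComparable l L c₁ c₂ (regimeOne φ₀ φ₁ φ₀₁) ∧ IsComparable l L c₁ c₂ φ₀₁
  triangle : ∀ x ∈ closure (Omega l L), ∀ ξ : Plane,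
    |φ₀₁ x ξ - φ₁ x ξ| ≤ regimeOne φ₀ φ₁ φ₀₁ x ξ

open Classical in
/-- The density `ψ_{0,1}` for the film composite `S₁` and the substrate `S₀`. For admissible pairs
the eight portions are disjoint and exhaust `Ω ∩ (∂S₀ ∪ ∂S₁)` up to an `H1`-negligible set; the
parts of the boundaries on `∂Ω` carry no energy. -/
def density (l L : ℝ) (φ₀ φ₁ φ₀₁ : Plane → Plane → ℝ) (S₁ S₀ : Set Plane) (x : Plane) : ℝ :=
  if x ∈ Omega l L ∩ (reducedBoundary S₁ \ reducedBoundary S₀) then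
    φ₁ x (unitNormal S₁ x)
  else if x ∈ Omega l L ∩ reducedBoundary S₀ ∩ reducedBoundary S₁ then
    regimeOne φ₀ φ₁ φ₀₁ x (unitNormal S₁ x)
  else if x ∈ Omega l L ∩ (reducedBoundary S₀ \ frontier S₁) then
    φ₀₁ x (unitNormal S₀ x)
  else if x ∈ Omega l L ∩ reducedBoundary S₀ ∩ frontier S₁ ∩ densityPoints S₁ 1 then
    φ₁ x (unitNormal S₁ x) + regimeOne φ₀ φ₁ φ₀₁ x (unitNormal S₁ x)
  else if x ∈ Omega l L ∩ frontier S₁ ∩ densityPoints S₁ 1 ∩ densityPoints S₀ 0 then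
    2 * φ₁ x (unitNormal S₁ x)
  else if x ∈ Omega l L ∩ frontier S₁ ∩ densityPoints S₁ 0 then
    2 * regimeTwo φ₀ φ₁ x (unitNormal S₁ x)
  else if x ∈ Omega l L ∩ (frontier S₀ \ frontier S₁) ∩ (densityPoints S₀ 1 ∪ densityPoints S₀ 0)
      ∩ densityPoints S₁ 1 then
    2 * φ₀₁ x (unitNormal S₀ x)
  else if x ∈ Omega l L ∩ frontier S₀ ∩ frontier S₁ ∩ densityPoints S₀ 1 then
    regimeOne φ₀ φ₁ φ₀₁ x (unitNormal S₁ x)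
  else 0

/-- The surface energy `S^1 = S^{(0,1)}`, with values in `[0, ∞]`. -/
def surfaceEnergy (l L : ℝ) (φ₀ φ₁ φ₀₁ : Plane → Plane → ℝ) (A : Set Plane × Set Plane) : ℝ≥0∞ :=
  ∫⁻ x in frontier A.2 ∪ frontier A.1, ENNReal.ofReal (density l L φ₀ φ₁ φ₀₁ A.1 A.2 x) ∂H1

end

end FilmLayers

/-!
All tensions are bounded below by a positive constant, so the energy controls the `H1`-measure of
`∂S₀ ∪ ∂S₁` inside `Ω` as soon as the eight portions in the surface density exhaust the two
boundaries up to an `H1`-null set. An admissible region has finite perimeter, because its height has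
bounded variation, and the exhaustion is then Federer's theorem: off an `H1`-null set, points
outside the reduced boundary have density zero or one, by the relative isoperimetric inequality and
a covering argument. The part of the boundaries on `∂Ω` lies on three segments.

With the lengths bounded, Blaschke's selection theorem gives Hausdorff limits of the films and of
the boundaries, and Gołąb's theorem, applied to the boundedly many connected components, bounds the
length of the limit boundaries. The limit of the films is again a film, whose height has bounded
variation because its boundary has finite length; the limit crack is the part of the limit boundary
in the closure of the interior of the subgraph. Hausdorff convergence of the closed regions and of
their boundaries gives convergence of the signed distances, through which the ordering of the
heights and the disjointness condition pass to the limit.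
-/

namespace FilmLayers

section HausdorffMeasure

theorem hausdorffMeasure_one_le_of_ae_covers {X : Type*} [EMetricSpace X] [MeasurableSpace X]
    [BorelSpace X] {s : Set X} {c : ℝ≥0∞}
    (h : ∀ δ : ℝ, 0 < δ → ∃ (ι : Type _) (_ : Countable ι) (t : ι → Set X),
      μH[1] (s \ ⋃ i, t i) = 0 ∧ (∀ i, Metric.ediam (t i) ≤ ENNReal.ofReal δ) ∧
        ∑' i, Metric.ediam (t i) ≤ c) :
    μH[1] s ≤ c := by
  choose ι hι t hnull hdiam hsum using fun n : ℕ => h _ (Nat.one_div_pos_of_nat (n := n))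
  set N : Set X := ⋃ n, s \ ⋃ i, t n i
  have hN : μH[1] N = 0 := measure_iUnion_null hnull
  have hmesh : Tendsto (fun n : ℕ => ENNReal.ofReal (1 / ((n : ℝ) + 1))) atTop (𝓝 0) := by
    simpa using ENNReal.tendsto_ofReal tendsto_one_div_add_atTop_nhds_zero_nat
  have hliminf := Measure.hausdorffMeasure_le_liminf_tsum 1 (s \ N) _ hmesh t
    (Eventually.of_forall hdiam) (Eventually.of_forall fun n x hx => by
      by_contra hxt
      exact hx.2 (mem_iUnion.2 ⟨n, hx.1, hxt⟩))
  simp only [ENNReal.rpow_one] at hliminf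
  rw [← measure_sdiff_null hN]
  exact hliminf.trans ((liminf_le_liminf (Eventually.of_forall hsum)).trans (by simp))

theorem addHaar_eq_zero_of_hausdorffMeasure_lt_top {E : Type*} [NormedAddCommGroup E]
    [NormedSpace ℝ E] [FiniteDimensional ℝ E] [MeasurableSpace E] [BorelSpace E]
    (μ : Measure E) [μ.IsAddHaarMeasure] {d : ℝ} (hd : d < Module.finrank ℝ E) {s : Set E}
    (hs : μH[d] s < ⊤) : μ s = 0 :=
  Measure.absolutelyContinuous_isAddHaarMeasure μ μH[Module.finrank ℝ E]
    ((Measure.hausdorffMeasure_zero_or_top hd s).resolve_right hs.ne)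

theorem ediam_closedBall_le_ofReal {X : Type*} [PseudoMetricSpace X] (x : X) (r : ℝ) :
    Metric.ediam (Metric.closedBall x r) ≤ ENNReal.ofReal (2 * r) := by
  rcases lt_or_ge r 0 with hr | hr
  · simp [Metric.closedBall_eq_empty.2 hr]
  · rw [← Metric.closedEBall_ofReal hr, ENNReal.ofReal_mul zero_le_two, ENNReal.ofReal_ofNat]
    exact Metric.ediam_closedEBall_le

end HausdorffMeasure

section DensityComparison

theorem exists_closedBall_subset_of_frequently {X : Type*} [PseudoMetricSpace X] {x : X}
    {U : Set X} {p : ℝ → Prop} (hp : ∃ᶠ r in 𝓝[>] (0 : ℝ), p r) (hU : IsOpen U) (hx : x ∈ U)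
    {δ : ℝ} (hδ : 0 < δ) : ∃ r ∈ Ioo 0 δ, p r ∧ Metric.closedBall x r ⊆ U := by
  obtain ⟨ε, hε, hball⟩ := Metric.isOpen_iff.1 hU x hx
  obtain ⟨r, hpr, hr⟩ := (hp.and_eventually (Ioo_mem_nhdsGT (lt_min hδ hε))).exists
  exact ⟨r, ⟨hr.1, hr.2.trans_le (min_le_left _ _)⟩, hpr,
    (Metric.closedBall_subset_ball (hr.2.trans_le (min_le_right _ _))).trans hball⟩

theorem le_mul_measure_of_forall_isOpen {X : Type*} [TopologicalSpace X] [MeasurableSpace X]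
    {μ : Measure X} [μ.OuterRegular] {s : Set X} {a c : ℝ≥0∞} (hc : c ≠ ⊤)
    (h : ∀ U, s ⊆ U → IsOpen U → a ≤ c * μ U) : a ≤ c * μ s := by
  rcases eq_or_ne c 0 with rfl | hc0
  · simpa using h univ (subset_univ s) isOpen_univ
  · simpa only [s.measure_eq_iInf_isOpen μ, ENNReal.mul_iInf_of_ne hc0 hc, le_iInf_iff] using h

variable {X : Type*} [MetricSpace X] [MeasurableSpace X]

theorem exists_disjoint_closedBall_cover_of_frequently [TopologicalSpace.SeparableSpace X]
    {μ : Measure X} {s U : Set X} {t δ : ℝ}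
    (hs : ∀ x ∈ s, ∃ᶠ r in 𝓝[>] (0 : ℝ), ENNReal.ofReal (t * r) < μ (Metric.closedBall x r))
    (hU : IsOpen U) (hsU : s ⊆ U) (hδ : 0 < δ) :
    ∃ u : Set (X × ℝ), u.Countable ∧ (∀ p ∈ u, p.2 ∈ Ioo 0 δ ∧
        ENNReal.ofReal (t * p.2) < μ (Metric.closedBall p.1 p.2) ∧
        Metric.closedBall p.1 p.2 ⊆ U) ∧
      u.PairwiseDisjoint (fun p => Metric.closedBall p.1 p.2) ∧
      s ⊆ ⋃ p ∈ u, Metric.closedBall p.1 (4 * p.2) := by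
  obtain ⟨u, huT, hdisj, hcover⟩ :=
    Vitali.exists_disjoint_subfamily_covering_enlargement_closedBall
      {p : X × ℝ | p.2 ∈ Ioo 0 δ ∧ ENNReal.ofReal (t * p.2) < μ (Metric.closedBall p.1 p.2) ∧
        Metric.closedBall p.1 p.2 ⊆ U} Prod.fst Prod.snd δ (fun p hp => hp.1.2.le) 4 (by norm_num)
  have hcount : u.Countable := hdisj.countable_of_nonempty_interior fun p hp =>
    ⟨p.1, Metric.ball_subset_interior_closedBall (Metric.mem_ball_self (huT hp).1.1)⟩
  refine ⟨u, hcount, huT, hdisj, fun x hx => ?_⟩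
  obtain ⟨r, hr, hlt, hsub⟩ := exists_closedBall_subset_of_frequently (hs x hx) hU (hsU hx) hδ
  obtain ⟨b, hb, hxb⟩ := hcover (x, r) ⟨hr, hlt, hsub⟩
  exact mem_iUnion₂.2 ⟨b, hb, hxb (Metric.mem_closedBall_self hr.1.le)⟩

theorem ae_forall_gt_eventually_measure_closedBall_le {μ ν : Measure X} {a : ℝ}
    (h : ∀ t, a < t → ∀ᵐ x ∂ν, ∀ᶠ r in 𝓝[>] (0 : ℝ),
      μ (Metric.closedBall x r) ≤ ENNReal.ofReal (t * r)) :
    ∀ᵐ x ∂ν, ∀ t, a < t → ∀ᶠ r in 𝓝[>] (0 : ℝ),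
      μ (Metric.closedBall x r) ≤ ENNReal.ofReal (t * r) := by
  obtain ⟨u, -, hu, hlim⟩ := exists_seq_strictAnti_tendsto a
  filter_upwards [ae_all_iff.2 fun n => h (u n) (hu n)] with x hx t ht
  obtain ⟨n, hn⟩ := (hlim.eventually_lt_const ht).exists
  filter_upwards [hx n, self_mem_nhdsWithin] with r hr hr0
  exact hr.trans (ENNReal.ofReal_le_ofReal (mul_le_mul_of_nonneg_right hn.le (le_of_lt hr0)))

variable [BorelSpace X]

theorem tsum_ediam_closedBall_le {ι : Type*} [Countable ι] {μ : Measure X} {U : Set X}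
    {x : ι → X} {r : ι → ℝ} {a t : ℝ} (ht : 0 < t) (hr : ∀ i, 0 ≤ r i)
    (hdisj : Pairwise (Function.onFun Disjoint fun i => Metric.closedBall (x i) (r i)))
    (hU : ∀ i, Metric.closedBall (x i) (r i) ⊆ U)
    (hμ : ∀ i, ENNReal.ofReal (t * r i) ≤ μ (Metric.closedBall (x i) (r i))) :
    ∑' i, Metric.ediam (Metric.closedBall (x i) (a * r i)) ≤ ENNReal.ofReal (2 * a / t) * μ U :=
  calc ∑' i, Metric.ediam (Metric.closedBall (x i) (a * r i))
      ≤ ∑' i, ENNReal.ofReal (2 * a / t) * μ (Metric.closedBall (x i) (r i)) := by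
        refine ENNReal.tsum_le_tsum fun i => (ediam_closedBall_le_ofReal _ _).trans ?_
        have : 2 * (a * r i) = 2 * a / t * (t * r i) := by field_simp
        rw [this, ENNReal.ofReal_mul' (mul_nonneg ht.le (hr i))]
        gcongr
        exact hμ i
    _ = ENNReal.ofReal (2 * a / t) * ∑' i, μ (Metric.closedBall (x i) (r i)) :=
        ENNReal.tsum_mul_left
    _ = ENNReal.ofReal (2 * a / t) * μ (⋃ i, Metric.closedBall (x i) (r i)) := by
        rw [measure_iUnion hdisj fun i => Metric.isClosed_closedBall.measurableSet]
    _ ≤ ENNReal.ofReal (2 * a / t) * μ U := by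
        gcongr
        exact iUnion_subset hU

theorem hausdorffMeasure_one_le_of_frequently_lt [TopologicalSpace.SeparableSpace X]
    {μ : Measure X} [μ.OuterRegular] {s : Set X} {t : ℝ} (ht : 0 < t)
    (hs : ∀ x ∈ s, ∃ᶠ r in 𝓝[>] (0 : ℝ), ENNReal.ofReal (t * r) < μ (Metric.closedBall x r)) :
    μH[1] s ≤ ENNReal.ofReal (2 * 4 / t) * μ s := by
  refine le_mul_measure_of_forall_isOpen ENNReal.ofReal_ne_top fun U hsU hU =>
    hausdorffMeasure_one_le_of_ae_covers fun δ hδ => ?_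
  obtain ⟨u, hcount, hu, hdisj, hcover⟩ :=
    exists_disjoint_closedBall_cover_of_frequently hs hU hsU (δ := δ / 8) (by positivity)
  rw [biUnion_eq_iUnion] at hcover
  have := hcount.to_subtype
  refine ⟨u, this, fun p => Metric.closedBall p.1.1 (4 * p.1.2), ?_, fun p => ?_, ?_⟩
  · rw [sdiff_eq_empty.2 hcover, measure_empty]
  · refine (ediam_closedBall_le_ofReal _ _).trans (ENNReal.ofReal_le_ofReal ?_)
    linarith [(hu p p.2).1.2]
  · exact tsum_ediam_closedBall_le ht (fun p => (hu p p.2).1.1.le)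
      (fun p q hpq => hdisj p.2 q.2 (Subtype.coe_injective.ne hpq))
      (fun p => (hu p p.2).2.2) (fun p => (hu p p.2).2.1.le)

-- Besicovitch covers only almost all of `s`; the cruder Vitali bound takes care of the rest.
theorem hausdorffMeasure_one_le_of_frequently_lt_sharp [SecondCountableTopology X]
    [HasBesicovitchCovering X] {μ : Measure X} [SFinite μ] [μ.OuterRegular] {s : Set X} {t : ℝ}
    (ht : 0 < t)
    (hs : ∀ x ∈ s, ∃ᶠ r in 𝓝[>] (0 : ℝ), ENNReal.ofReal (t * r) < μ (Metric.closedBall x r)) :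
    μH[1] s ≤ ENNReal.ofReal (2 / t) * μ s := by
  refine le_mul_measure_of_forall_isOpen ENNReal.ofReal_ne_top fun U hsU hU =>
    hausdorffMeasure_one_le_of_ae_covers fun δ hδ => ?_
  have hfine : ∀ x ∈ s, ∀ ε > 0, ({r | ENNReal.ofReal (t * r) < μ (Metric.closedBall x r) ∧
      Metric.closedBall x r ⊆ U} ∩ Ioo 0 ε).Nonempty := fun x hx ε hε =>
    let ⟨r, hr, h⟩ := exists_closedBall_subset_of_frequently (hs x hx) hU (hsU hx) hε
    ⟨r, h, hr⟩
  obtain ⟨u, r, hcount, -, hr, hnull, hdisj⟩ :=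
    Besicovitch.exists_disjoint_closedBall_covering_ae μ _ s hfine (fun _ => δ / 2)
      (fun _ _ => by positivity)
  rw [biUnion_eq_iUnion] at hnull
  have := hcount.to_subtype
  refine ⟨u, this, fun x : u => Metric.closedBall x.1 (r x.1), ?_, fun x => ?_, ?_⟩
  · refine le_antisymm ?_ zero_le
    have := hausdorffMeasure_one_le_of_frequently_lt ht
      fun x (hx : x ∈ s \ ⋃ x : u, Metric.closedBall x.1 (r x.1)) => hs x hx.1
    rwa [hnull, mul_zero] at this
  · refine (ediam_closedBall_le_ofReal _ _).trans (ENNReal.ofReal_le_ofReal ?_)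
    linarith [(hr x x.2).2.2]
  · simpa using tsum_ediam_closedBall_le (ι := u) (a := 1) ht (fun x => (hr x x.2).2.1.le)
      (fun x y hxy => hdisj x.2 y.2 (Subtype.coe_injective.ne hxy))
      (fun x => (hr x x.2).1.2) (fun x => (hr x x.2).1.1.le)

theorem ae_upper_density_le_one [SecondCountableTopology X] [HasBesicovitchCovering X]
    {A : Set X} (hA : MeasurableSet A) (hfin : μH[1] A < ⊤) :
    ∀ᵐ x ∂(μH[1].restrict A), ∀ t, 2 < t → ∀ᶠ r in 𝓝[>] (0 : ℝ),
      μH[1].restrict A (Metric.closedBall x r) ≤ ENNReal.ofReal (t * r) := by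
  have : IsFiniteMeasure (μH[1].restrict A) := ⟨by simpa using hfin⟩
  refine ae_forall_gt_eventually_measure_closedBall_le fun t ht => ?_
  have ht0 : 0 < t := two_pos.trans ht
  set s : Set X := {x | ¬ ∀ᶠ r in 𝓝[>] (0 : ℝ),
    μH[1].restrict A (Metric.closedBall x r) ≤ ENNReal.ofReal (t * r)} ∩ A
  have hle : μH[1] s ≤ ENNReal.ofReal (2 / t) * μH[1] s :=
    (hausdorffMeasure_one_le_of_frequently_lt_sharp ht0 fun x hx => by
      simpa only [mem_ofPred_eq, not_eventually, not_le] using hx.1).trans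
        (mul_le_mul_right (Measure.restrict_apply_le _ _) _)
  have hlt : ENNReal.ofReal (2 / t) < 1 := by
    rw [ENNReal.ofReal_lt_one, div_lt_one ht0]
    exact ht
  rw [ae_iff, Measure.restrict_apply' hA]
  by_contra hne
  have hs : μH[1] s ≠ ⊤ := ((measure_mono inter_subset_right).trans_lt hfin).ne
  exact hle.not_gt ((ENNReal.mul_lt_mul_left hne hs hlt).trans_eq (one_mul _))

theorem ae_density_eq_zero_of_null [TopologicalSpace.SeparableSpace X] {μ : Measure X}
    [μ.OuterRegular] {N : Set X} (hN : μ N = 0) :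
    ∀ᵐ x ∂μH[1], x ∈ N → ∀ t, 0 < t → ∀ᶠ r in 𝓝[>] (0 : ℝ),
      μ (Metric.closedBall x r) ≤ ENNReal.ofReal (t * r) := by
  refine ((ae_restrict_iff' (measurableSet_toMeasurable μ N)).1
    (ae_forall_gt_eventually_measure_closedBall_le fun t ht => ?_)).mono
      fun x hx hxN => hx (subset_toMeasurable μ N hxN)
  rw [ae_iff, Measure.restrict_apply' (measurableSet_toMeasurable μ N)]
  refine le_antisymm ((hausdorffMeasure_one_le_of_frequently_lt ht fun x hx => by
    simpa only [mem_ofPred_eq, not_eventually, not_le] using hx.1).trans_eq ?_) zero_le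
  rw [measure_mono_null inter_subset_right ((measure_toMeasurable N).trans hN), mul_zero]

end DensityComparison

section Connected

variable {Y : Type*} [TopologicalSpace Y] {C E U : Set Y}

theorem inter_frontier_nonempty (hC : IsPreconnected C) (h₁ : (C ∩ E).Nonempty)
    (h₂ : (C ∩ Eᶜ).Nonempty) : (C ∩ frontier E).Nonempty := by
  by_contra hempty
  have hcover : ∀ z ∈ C, z ∈ interior E ∨ z ∈ (closure E)ᶜ := fun z hz => by
    by_contra! h
    exact hempty ⟨z, hz, not_not.1 h.2, h.1⟩
  obtain ⟨a, haC, haE⟩ := h₁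
  obtain ⟨b, hbC, hbE⟩ := h₂
  obtain ⟨z, -, hzint, hzcl⟩ := hC (interior E) (closure E)ᶜ isOpen_interior
    isClosed_closure.isOpen_compl hcover
    ⟨a, haC, (hcover a haC).resolve_right fun h => h (subset_closure haE)⟩
    ⟨b, hbC, (hcover b hbC).resolve_left fun h => hbE (interior_subset h)⟩
  exact hzcl (subset_closure (interior_subset hzint))

/- The set `U` is collapsed to the only point of its boundary in `C`, which is a retraction. -/
theorem isPreconnected_sdiff_of_subsingleton_frontier (hC : IsPreconnected C) (hU : IsOpen U)
    (hs : (C ∩ frontier U).Subsingleton) : IsPreconnected (C \ U) := by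
  classical
  rcases (C ∩ U).eq_empty_or_nonempty with hdisj | hmeet
  · rwa [sdiff_eq_left.2 (disjoint_iff_inter_eq_empty.2 hdisj)]
  rcases (C \ U).eq_empty_or_nonempty with hsub | hout
  · simpa only [hsub] using isPreconnected_empty
  obtain ⟨y, hyC, hyU⟩ := inter_frontier_nonempty hC hmeet hout
  have hcont : ContinuousOn (U.piecewise (fun _ => y) id) C :=
    ContinuousOn.piecewise (fun a ha => hs ⟨hyC, hyU⟩ ha) continuousOn_const continuousOn_id
  have himage : U.piecewise (fun _ => y) id '' C = C \ U := by
    refine Subset.antisymm (image_subset_iff.2 fun z hz => ?_) fun z hz =>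
      ⟨z, hz.1, piecewise_eq_of_notMem _ _ _ hz.2⟩
    by_cases hzU : z ∈ U
    · rw [mem_preimage, piecewise_eq_of_mem _ _ _ hzU]
      exact ⟨hyC, (hU.frontier_eq ▸ hyU).2⟩
    · rw [mem_preimage, piecewise_eq_of_notMem _ _ _ hzU]
      exact ⟨hz, hzU⟩
  exact himage ▸ hC.image _ hcont

theorem isPreconnected_sdiff_biUnion_finset {ι : Type*} (hC : IsPreconnected C) {V : ι → Set Y}
    (s : Finset ι) (hV : ∀ i ∈ s, IsOpen (V i))
    (hs : ∀ i ∈ s, (C ∩ frontier (V i)).Subsingleton) :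
    IsPreconnected (C \ ⋃ i ∈ s, V i) := by
  classical
  induction s using Finset.induction_on with
  | empty => simpa using hC
  | insert a s _ ih =>
    have ih := ih (fun i hi => hV i (Finset.mem_insert_of_mem hi))
      fun i hi => hs i (Finset.mem_insert_of_mem hi)
    rw [Finset.set_biUnion_insert, union_comm, ← sdiff_sdiff]
    exact isPreconnected_sdiff_of_subsingleton_frontier ih (hV a (Finset.mem_insert_self a s))
      ((hs a (Finset.mem_insert_self a s)).anti (inter_subset_inter_left _ sdiff_subset))

end Connected

theorem frontier_ball_subset_sphere {X : Type*} [PseudoMetricSpace X] (x : X) (r : ℝ) :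
    frontier (Metric.ball x r) ⊆ Metric.sphere x r := fun _ hy =>
  le_antisymm (Metric.closure_ball_subset_closedBall hy.1)
    (not_lt.1 (Metric.isOpen_ball.frontier_eq (s := Metric.ball x r) ▸ hy).2)

theorem two_le_sum_indicator_image {ι : Type*} [Fintype ι] {X : Type*} {S : Set X} {f : X → ℝ}
    {c : X → ι} {p q : X}
    (hp : p ∈ S) (hq : q ∈ S) (hfpq : f p = f q) (hc : c p ≠ c q) :
    2 ≤ ∑ i, (toMeasurable volume (f '' (S ∩ c ⁻¹' {i}))).indicator (1 : ℝ → ℝ≥0∞) (f p) := by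
  classical
  have hmem : ∀ z ∈ S, f z ∈ toMeasurable volume (f '' (S ∩ c ⁻¹' {c z})) := fun z hz =>
    subset_toMeasurable _ _ (mem_image_of_mem f ⟨hz, rfl⟩)
  refine le_trans (le_of_eq ?_) (Finset.sum_le_sum_of_subset (Finset.subset_univ {c p, c q}))
  rw [Finset.sum_pair hc, indicator_of_mem (hmem p hp), hfpq, indicator_of_mem (hmem q hq),
    Pi.one_apply, one_add_one_eq_two]

theorem exists_mem_sdiff_iUnion_ball_dist_le {X : Type*} [PseudoMetricSpace X] {C T : Set X}
    {ρ : X → ℝ} {δ : ℝ} (hC : IsPreconnected C) (hδ : 0 ≤ δ) (hρ : ∀ x ∈ T, ρ x ≤ δ)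
    (hT : T.PairwiseDisjoint fun x => Metric.closedBall x (ρ x)) {p q : X} (hp : p ∈ C)
    (hq : q ∈ C) (hpq : 2 * δ ≤ dist p q) {z : X} (hz : z ∈ C) :
    ∃ z' ∈ C \ ⋃ x ∈ T, Metric.ball x (ρ x), dist z' z ≤ 2 * δ := by
  by_cases hzT : z ∈ ⋃ x ∈ T, Metric.ball x (ρ x)
  · obtain ⟨x, hx, hzx⟩ := mem_iUnion₂.1 hzT
    have hout : (C ∩ (Metric.ball x (ρ x))ᶜ).Nonempty := by
      by_contra hempty
      have hin : ∀ w ∈ C, dist w x < ρ x := fun w hw => by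
        by_contra hwx
        exact hempty ⟨w, hw, hwx⟩
      linarith [hin p hp, hin q hq, dist_triangle_right p q x, hρ x hx]
    obtain ⟨y, hyC, hy⟩ := inter_frontier_nonempty hC ⟨z, hz, hzx⟩ hout
    have hyx : dist y x = ρ x := frontier_ball_subset_sphere x _ hy
    refine ⟨y, ⟨hyC, fun hyT => ?_⟩, ?_⟩
    · obtain ⟨x', hx', hyx'⟩ := mem_iUnion₂.1 hyT
      have hne : x ≠ x' := by
        rintro rfl
        exact (Metric.mem_ball.1 hyx').ne hyx
      exact disjoint_left.1 (hT hx hx' hne) hyx.le (Metric.ball_subset_closedBall hyx')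
    · linarith [dist_triangle_right y z x, Metric.mem_ball.1 hzx, hρ x hx]
  · exact ⟨z, ⟨hz, hzT⟩, by simpa only [dist_self] using by positivity⟩

section Length

variable {X : Type*} [MetricSpace X] [MeasurableSpace X] [BorelSpace X] {C S Z : Set X}

theorem volume_image_le_hausdorffMeasure_one {f : X → ℝ} (hf : LipschitzWith 1 f) (A : Set X) :
    volume (f '' A) ≤ μH[1] A := by
  rw [← hausdorffMeasure_real]
  simpa using hf.hausdorffMeasure_image_le (d := 1) zero_le_one A

theorem ofReal_sub_le_hausdorffMeasure_one_inter_ball (hC : IsPreconnected C) {x p q : X}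
    {a b : ℝ} (hp : p ∈ C) (hpa : dist p x ≤ a) (hq : q ∈ C) (hqb : b ≤ dist q x) :
    ENNReal.ofReal (b - a) ≤ μH[1] (C ∩ Metric.ball x b) := by
  refine le_trans ?_ (volume_image_le_hausdorffMeasure_one (LipschitzWith.dist_left x) _)
  rw [← Real.volume_Ico]
  refine measure_mono fun ρ hρ => ?_
  obtain ⟨y, hy, hyρ⟩ := (hC.image (fun p => dist p x) (by fun_prop)).ordConnected.out
    (mem_image_of_mem _ hp) (mem_image_of_mem _ hq)
    (⟨hpa.trans hρ.1, hρ.2.le.trans hqb⟩ : ρ ∈ Icc _ _)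
  exact ⟨y, ⟨hy, hyρ.trans_lt hρ.2⟩, hyρ⟩

/- The sum of indicators counts the cells of the partition that meet the fibre over `t`. -/
theorem lintegral_sum_indicator_image_le {ι : Type*} [Fintype ι] [MeasurableSpace ι]
    [MeasurableSingletonClass ι] {f : X → ℝ} (hf : LipschitzWith 1 f) (hS : MeasurableSet S)
    {c : X → ι} (hc : Measurable c) :
    ∫⁻ t, ∑ i, (toMeasurable volume (f '' (S ∩ c ⁻¹' {i}))).indicator 1 t ≤ μH[1] S := by
  have hcell : ∀ i, MeasurableSet (S ∩ c ⁻¹' {i}) := fun i =>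
    hS.inter (hc (measurableSet_singleton i))
  rw [lintegral_finsetSum _ fun i _ => measurable_one.indicator (measurableSet_toMeasurable _ _)]
  calc ∑ i, ∫⁻ t, (toMeasurable volume (f '' (S ∩ c ⁻¹' {i}))).indicator 1 t
      = ∑ i, volume (f '' (S ∩ c ⁻¹' {i})) := Finset.sum_congr rfl fun i _ => by
        rw [lintegral_indicator_one (measurableSet_toMeasurable _ _), measure_toMeasurable]
    _ ≤ ∑ i, μH[1] (S ∩ c ⁻¹' {i}) :=
        Finset.sum_le_sum fun i _ => volume_image_le_hausdorffMeasure_one hf _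
    _ = μH[1] (⋃ i ∈ Finset.univ, S ∩ c ⁻¹' {i}) :=
        (measure_biUnion_finset (fun i _ j _ hij => disjoint_left.2 fun p hp hq =>
          hij (hp.2.symm.trans hq.2)) fun i _ => hcell i).symm
    _ ≤ μH[1] S := measure_mono (iUnion₂_subset fun i _ => inter_subset_left)

theorem two_mul_volume_le_hausdorffMeasure_one [SecondCountableTopology X] {f : X → ℝ}
    (hf : LipschitzWith 1 f) (hS : MeasurableSet S) {I : Set ℝ} (hI : MeasurableSet I)
    (hfibre : ∀ t ∈ I, (S ∩ f ⁻¹' {t}).Nontrivial) : 2 * volume I ≤ μH[1] S := by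
  -- Ever finer finite partitions, which separate any two given points in the end.
  let c : (n : ℕ) → X → Fin n → Bool := fun n p i => MeasurableSpace.mapNatBool X p i
  have hc : ∀ n, Measurable (c n) := fun n => measurable_pi_iff.2 fun i =>
    (measurable_pi_apply _).comp (MeasurableSpace.measurable_mapNatBool X)
  let g : ℕ → ℝ → ℝ≥0∞ := fun n t =>
    ∑ i, (toMeasurable volume (f '' (S ∩ c n ⁻¹' {i}))).indicator 1 t
  have hg : ∀ n, Measurable (g n) := fun n => Finset.measurable_sum _ fun i _ =>
    measurable_one.indicator (measurableSet_toMeasurable _ _)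
  have hsep : ∀ p q : X, p ≠ q → ∀ᶠ n in atTop, c n p ≠ c n q := fun p q hpq => by
    obtain ⟨i, hi⟩ := Function.ne_iff.1 ((MeasurableSpace.injective_mapNatBool X).ne hpq)
    filter_upwards [eventually_gt_atTop i] with n hn heq
    exact hi (congrFun heq ⟨i, hn⟩)
  have htwo : ∀ t ∈ I, 2 ≤ liminf (fun n => g n t) atTop := fun t ht => by
    obtain ⟨p, ⟨hp, rfl⟩, q, ⟨hq, hqp⟩, hpq⟩ := hfibre t ht
    exact le_liminf_of_le (by isBoundedDefault) ((hsep p q hpq).mono fun n hn =>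
      two_le_sum_indicator_image hp hq (Eq.symm hqp) hn)
  calc 2 * volume I = ∫⁻ _ in I, 2 := (setLIntegral_const I 2).symm
    _ ≤ ∫⁻ t in I, liminf (fun n => g n t) atTop := setLIntegral_mono' hI htwo
    _ ≤ ∫⁻ t, liminf (fun n => g n t) atTop := setLIntegral_le_lintegral _ _
    _ ≤ liminf (fun n => ∫⁻ t, g n t) atTop := lintegral_liminf_le hg
    _ ≤ μH[1] S := (liminf_le_liminf (Eventually.of_forall fun n =>
        lintegral_sum_indicator_image_le hf hS (hc n))).trans (by simp)

theorem ofReal_sub_le_hausdorffMeasure_one_sdiff_biUnion_ball {s : Finset X} {ρ : X → ℝ} {δ r : ℝ}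
    (hC : IsPreconnected C) (hδ : 0 ≤ δ) (hρ : ∀ x ∈ s, ρ x ≤ δ)
    (hdisj : (s : Set X).PairwiseDisjoint fun x => Metric.closedBall x (ρ x))
    (hs : ∀ x ∈ s, (C ∩ Metric.sphere x (ρ x)).Subsingleton) {x₀ q : X} (hx₀ : x₀ ∈ C)
    (hq : q ∈ C) (hr : 0 ≤ r) (hqr : r + 2 * δ ≤ dist q x₀) :
    ENNReal.ofReal (r - 2 * δ) ≤
      μH[1] ((C \ ⋃ x ∈ s, Metric.ball x (ρ x)) ∩ Metric.ball x₀ r) := by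
  have hconn := isPreconnected_sdiff_biUnion_finset hC s
    (fun x _ => Metric.isOpen_ball (x := x) (ε := ρ x)) fun x hx =>
      (hs x hx).anti (inter_subset_inter_right C (frontier_ball_subset_sphere x (ρ x)))
  have hdense := fun z (hz : z ∈ C) => exists_mem_sdiff_iUnion_ball_dist_le hC hδ hρ hdisj hq hx₀
    (by linarith) hz
  obtain ⟨p', hp', hpd⟩ := hdense x₀ hx₀
  obtain ⟨q', hq', hqd⟩ := hdense q hq
  exact ofReal_sub_le_hausdorffMeasure_one_inter_ball hconn hp' hpd hq'
    (by linarith [dist_triangle_left q x₀ q'])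

theorem exists_finset_measure_sdiff_biUnion_lt {α ι : Type*} [MeasurableSpace α] {μ : Measure α}
    [IsFiniteMeasure μ] {T : Set ι} (hT : T.Countable) {V : ι → Set α}
    (hV : ∀ i ∈ T, MeasurableSet (V i)) {ε : ℝ≥0∞} (hε : 0 < ε) :
    ∃ s : Finset ι, ↑s ⊆ T ∧ μ ((⋃ i ∈ T, V i) \ ⋃ i ∈ s, V i) < ε := by
  have := hT.to_subtype
  let W : Finset T → Set α := fun s => (⋃ i ∈ T, V i) \ ⋃ i ∈ s, V i
  have hempty : ⋂ s, W s = ∅ := by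
    refine eq_empty_of_forall_notMem fun z hz => ?_
    obtain ⟨i, hi, hzi⟩ := mem_iUnion₂.1 (mem_iInter.1 hz ∅).1
    exact (mem_iInter.1 hz {⟨i, hi⟩}).2 (mem_iUnion₂.2 ⟨⟨i, hi⟩, Finset.mem_singleton_self _, hzi⟩)
  have hlim : Tendsto (fun s => μ (W s)) atTop (𝓝 0) := by
    rw [← measure_empty (μ := μ), ← hempty]
    refine tendsto_measure_iInter_atTop (fun s => ?_) (fun s t hst => ?_) ⟨∅, measure_ne_top _ _⟩
    · exact (MeasurableSet.diff (.biUnion hT hV)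
        (s.measurableSet_biUnion fun i _ => hV i i.2)).nullMeasurableSet
    · exact sdiff_subset_sdiff_right (biUnion_subset_biUnion_left hst)
  classical
  obtain ⟨s, hs⟩ := (hlim.eventually (gt_mem_nhds hε)).exists
  refine ⟨s.image (↑), by simp, ?_⟩
  simpa only [W, Finset.set_biUnion_finset_image] using hs

theorem ae_forall_measure_closedBall_sdiff_le [TopologicalSpace.SeparableSpace X] (μ : Measure X)
    [IsFiniteMeasure μ] (Z : Set X) :
    ∀ᵐ x ∂μH[1], x ∈ Z → ∀ ε, 0 < ε → ∀ᶠ r in 𝓝[>] (0 : ℝ), ∀ W, MeasurableSet W →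
      μ (Z \ W) = 0 → μ (Metric.closedBall x r \ W) ≤ ENNReal.ofReal (ε * r) := by
  set Z' := toMeasurable μ Z
  have hnull : μ.restrict Z'ᶜ Z = 0 := measure_mono_null (subset_toMeasurable μ Z) (by
    rw [Measure.restrict_apply (measurableSet_toMeasurable μ Z), inter_compl_self, measure_empty])
  filter_upwards [ae_density_eq_zero_of_null hnull] with x hx hxZ ε hε
  filter_upwards [hx hxZ ε hε] with r hr W hW hZW
  have hZ'W : μ (Z' \ W) = 0 := by
    rw [sdiff_eq, Measure.measure_toMeasurable_inter hW.compl (measure_ne_top μ Z), ← sdiff_eq, hZW]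
  calc μ (Metric.closedBall x r \ W)
      ≤ μ ((Metric.closedBall x r ∩ Z'ᶜ) ∪ (Z' \ W)) := measure_mono fun z hz => by
        by_cases hz' : z ∈ Z'
        · exact Or.inr ⟨hz', hz.2⟩
        · exact Or.inl ⟨hz.1, hz'⟩
    _ ≤ μ (Metric.closedBall x r ∩ Z'ᶜ) + μ (Z' \ W) := measure_union_le _ _
    _ ≤ ENNReal.ofReal (ε * r) := by
        rwa [hZ'W, add_zero, ← Measure.restrict_apply Metric.isClosed_closedBall.measurableSet]

theorem exists_disjoint_closedBall_cover_of_sphere_null [SecondCountableTopology X]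
    [HasBesicovitchCovering X] (μ : Measure X) [SFinite μ] {P : X → ℝ → Prop}
    (hP : ∀ x ∈ Z, ∃ᶠ r in 𝓝[>] (0 : ℝ), P x r) (hnull : ∀ x r, P x r → μ (Metric.sphere x r) = 0)
    {δ : ℝ} (hδ : 0 < δ) :
    ∃ (T : Set X) (ρ : X → ℝ), T.Countable ∧ (∀ x ∈ T, P x (ρ x) ∧ ρ x < δ) ∧
      T.PairwiseDisjoint (fun x => Metric.closedBall x (ρ x)) ∧
      μ (Z \ ⋃ x ∈ T, Metric.ball x (ρ x)) = 0 := by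
  obtain ⟨T, ρ, hT, -, hρ, hcover, hdisj⟩ := Besicovitch.exists_disjoint_closedBall_covering_ae μ
    (fun x => {r | P x r}) Z (fun x hx η hη =>
      ((hP x hx).and_eventually (Ioo_mem_nhdsGT hη)).exists) (fun _ => δ) fun _ _ => hδ
  refine ⟨T, ρ, hT, fun x hx => ⟨(hρ x hx).1, (hρ x hx).2.2⟩, hdisj, ?_⟩
  refine measure_mono_null (t := (Z \ ⋃ x ∈ T, Metric.closedBall x (ρ x)) ∪
    ⋃ x ∈ T, Metric.sphere x (ρ x)) (fun z hz => ?_) (measure_union_null hcover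
      ((measure_biUnion_null_iff hT).2 fun x hx => hnull x _ (hρ x hx).1))
  by_cases hzT : z ∈ ⋃ x ∈ T, Metric.closedBall x (ρ x)
  · obtain ⟨x, hx, hzx⟩ := mem_iUnion₂.1 hzT
    exact Or.inr (mem_iUnion₂.2 ⟨x, hx, le_antisymm hzx
      (not_lt.1 fun hlt => hz.2 (mem_iUnion₂.2 ⟨x, hx, hlt⟩))⟩)
  · exact Or.inl ⟨hz.1, hzT⟩

variable [SecondCountableTopology X] [HasBesicovitchCovering X]

/- If almost all of `C` near a point could be covered by tiny disjoint balls whose spheres meet `C`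
at most once, then removing finitely many of them would leave a connected set that still crosses an
annulus around the point, but with too little length. -/
theorem hausdorffMeasure_one_subsingleton_sphere_eq_zero (hC : IsPreconnected C)
    (hCm : MeasurableSet C) (hfin : μH[1] C < ⊤) :
    μH[1] {x ∈ C | ∃ᶠ ρ in 𝓝[>] (0 : ℝ), (C ∩ Metric.sphere x ρ).Subsingleton} = 0 := by
  set Z : Set X := {x ∈ C | ∃ᶠ ρ in 𝓝[>] (0 : ℝ), (C ∩ Metric.sphere x ρ).Subsingleton}
  have hatom : NullSingletonClass (μH[1] : Measure X) :=
    Measure.nullSingletonClass_hausdorff X one_pos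
  rcases C.subsingleton_or_nontrivial with hsub | hnontriv
  · exact (hsub.anti (sep_subset _ _)).measure_zero _
  set μ := μH[1].restrict C with hμ
  have : IsFiniteMeasure μ := ⟨by simpa only [hμ, Measure.restrict_apply_univ] using hfin⟩
  refine measure_mono_null (fun x₀ hx₀ => ?_)
    (ae_iff.1 (ae_forall_measure_closedBall_sdiff_le μ Z))
  intro hthin
  obtain ⟨q, hq, hqx₀⟩ := hnontriv.exists_ne x₀
  obtain ⟨r, hthin, hr, hrq⟩ := ((hthin hx₀ (1 / 4) (by norm_num)).and
    (Ioo_mem_nhdsGT (half_pos (dist_pos.2 hqx₀)))).exists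
  obtain ⟨T, ρ, hT, hTρ, hdisj, hcover⟩ := exists_disjoint_closedBall_cover_of_sphere_null μ
    (P := fun x r => (C ∩ Metric.sphere x r).Subsingleton) (fun x (hx : x ∈ Z) => hx.2)
    (fun x r hxr => by
      rw [hμ, Measure.restrict_apply' hCm, inter_comm]
      exact hxr.measure_zero _) (show 0 < r / 8 by positivity)
  obtain ⟨s, hsT, hs⟩ := exists_finset_measure_sdiff_biUnion_lt (μ := μ) hT
    (fun x _ => measurableSet_ball (x := x) (ε := ρ x))
    (ENNReal.ofReal_pos.2 (show 0 < 1 / 4 * r by positivity))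
  have hlower := ofReal_sub_le_hausdorffMeasure_one_sdiff_biUnion_ball hC
    (show 0 ≤ r / 8 by positivity) (fun x hx => (hTρ x (hsT hx)).2.le) (hdisj.subset hsT)
    (fun x hx => (hTρ x (hsT hx)).1) hx₀.1 hq hr.le (by linarith)
  have hupper : μH[1] ((C \ ⋃ x ∈ s, Metric.ball x (ρ x)) ∩ Metric.ball x₀ r) ≤
      ENNReal.ofReal (1 / 4 * r) + ENNReal.ofReal (1 / 4 * r) := by
    calc μH[1] ((C \ ⋃ x ∈ s, Metric.ball x (ρ x)) ∩ Metric.ball x₀ r)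
        ≤ μ (Metric.closedBall x₀ r \ ⋃ x ∈ s, Metric.ball x (ρ x)) := by
          rw [hμ, Measure.restrict_apply' hCm]
          exact measure_mono fun z hz => ⟨⟨Metric.ball_subset_closedBall hz.2, hz.1.2⟩, hz.1.1⟩
      _ ≤ _ := (measure_mono (sdiff_triangle _ (⋃ x ∈ T, Metric.ball x (ρ x)) _)).trans
          (measure_union_le _ _)
      _ ≤ _ := add_le_add (hthin _ (MeasurableSet.biUnion hT fun _ _ => measurableSet_ball)
          hcover) hs.le
  rw [← ENNReal.ofReal_add (by positivity) (by positivity)] at hupper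
  linarith [(ENNReal.ofReal_le_ofReal_iff (by positivity)).1 (hlower.trans hupper)]

theorem ae_lower_density_ge_one (hC : IsPreconnected C) (hCm : MeasurableSet C)
    (hfin : μH[1] C < ⊤) :
    ∀ᵐ x ∂(μH[1].restrict C), ∀ᶠ r in 𝓝[>] (0 : ℝ),
      ENNReal.ofReal (2 * r) ≤ μH[1] (C ∩ Metric.ball x r) := by
  rw [ae_iff, Measure.restrict_apply' hCm]
  refine measure_mono_null ?_ (hausdorffMeasure_one_subsingleton_sphere_eq_zero hC hCm hfin)
  rintro x ⟨hx, hxC⟩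
  refine ⟨hxC, fun hev => hx ?_⟩
  obtain ⟨ε, hε, hsub⟩ := mem_nhdsGT_iff_exists_Ioo_subset.1 hev
  filter_upwards [Ioo_mem_nhdsGT hε] with r hr
  calc ENNReal.ofReal (2 * r) = 2 * volume (Ioo 0 r) := by
        rw [Real.volume_Ioo, sub_zero, ENNReal.ofReal_mul zero_le_two, ENNReal.ofReal_ofNat]
    _ ≤ μH[1] (C ∩ Metric.ball x r) := two_mul_volume_le_hausdorffMeasure_one
        (LipschitzWith.dist_left x) (hCm.inter measurableSet_ball) measurableSet_Ioo
        fun ρ hρ => ?_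
  obtain ⟨p, ⟨hp, hpρ⟩, q, ⟨hq, hqρ⟩, hpq⟩ :=
    Set.not_subsingleton_iff.1 (hsub (⟨hρ.1, hρ.2.trans hr.2⟩ : ρ ∈ Ioo 0 ε))
  have hball : ∀ z, dist z x = ρ → z ∈ Metric.ball x r := fun z hz => hz.trans_lt hρ.2
  exact ⟨p, ⟨⟨hp, hball p hpρ⟩, hpρ⟩, q, ⟨⟨hq, hball q hqρ⟩, hqρ⟩, hpq⟩

end Length

section Density

variable {X : Type*} [MetricSpace X] [MeasurableSpace X] [BorelSpace X] {C K : Set X}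

theorem ae_lower_density_ge_one_of_subset [SecondCountableTopology X] [HasBesicovitchCovering X]
    (hC : IsPreconnected C) (hCm : MeasurableSet C) (hfin : μH[1] C < ⊤) (hK : MeasurableSet K) :
    ∀ᵐ x ∂μH[1], x ∈ K ∩ C → ∀ t, t < 2 → ∀ᶠ r in 𝓝[>] (0 : ℝ),
      ENNReal.ofReal (t * r) ≤ μH[1] (K ∩ Metric.ball x r) := by
  have : IsFiniteMeasure (μH[1].restrict (C \ K)) :=
    ⟨by simpa only [Measure.restrict_apply_univ] using (measure_mono sdiff_subset).trans_lt hfin⟩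
  have hnull : μH[1].restrict (C \ K) K = 0 := by
    rw [Measure.restrict_apply hK, inter_sdiff_self, measure_empty]
  filter_upwards [(ae_restrict_iff' hCm).1 (ae_lower_density_ge_one hC hCm hfin),
    ae_density_eq_zero_of_null hnull] with x hlower hthin hx t ht
  filter_upwards [hlower hx.2, hthin hx.1 (2 - t) (sub_pos.2 ht), self_mem_nhdsWithin]
    with r hr hr' hr0
  rw [Measure.restrict_apply Metric.isClosed_closedBall.measurableSet] at hr'
  have hsplit : ENNReal.ofReal (2 * r) ≤
      μH[1] (K ∩ Metric.ball x r) + ENNReal.ofReal ((2 - t) * r) :=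
    calc ENNReal.ofReal (2 * r) ≤ μH[1] (C ∩ Metric.ball x r) := hr
      _ ≤ μH[1] (K ∩ Metric.ball x r ∪ Metric.closedBall x r ∩ (C \ K)) :=
          measure_mono fun z hz => by
            by_cases hzK : z ∈ K
            · exact Or.inl ⟨hzK, hz.2⟩
            · exact Or.inr ⟨Metric.ball_subset_closedBall hz.2, hz.1, hzK⟩
      _ ≤ μH[1] (K ∩ Metric.ball x r) + ENNReal.ofReal ((2 - t) * r) :=
          (measure_union_le _ _).trans (by gcongr)
  calc ENNReal.ofReal (t * r)
      = ENNReal.ofReal (2 * r) - ENNReal.ofReal ((2 - t) * r) := by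
        rw [← ENNReal.ofReal_sub _ (mul_nonneg (sub_pos.2 ht).le (le_of_lt hr0))]
        ring_nf
    _ ≤ μH[1] (K ∩ Metric.ball x r) := tsub_le_iff_right.2 hsplit

theorem tendsto_div_ofReal_two_mul_of_bounds {m : ℝ → ℝ≥0∞}
    (hlower : ∀ t, t < 2 → ∀ᶠ r in 𝓝[>] (0 : ℝ), ENNReal.ofReal (t * r) ≤ m r)
    (hupper : ∀ t, 2 < t → ∀ᶠ r in 𝓝[>] (0 : ℝ), m r ≤ ENNReal.ofReal (t * r)) :
    Tendsto (fun r => m r / ENNReal.ofReal (2 * r)) (𝓝[>] 0) (𝓝 1) := by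
  have hquot : ∀ t r : ℝ, 0 < r →
      ENNReal.ofReal (t * r) / ENNReal.ofReal (2 * r) = ENNReal.ofReal (t / 2) := fun t r hr => by
    rw [← ENNReal.ofReal_div_of_pos (by positivity), mul_div_mul_right _ _ hr.ne']
  refine tendsto_order.2 ⟨fun a ha => ?_, fun b hb => ?_⟩
  · obtain ⟨t, hat, ht⟩ := ENNReal.lt_iff_exists_real_btwn.1 ha |>.imp fun t h => h.2
    have ht : t < 1 := by rwa [ENNReal.ofReal_lt_one] at ht
    filter_upwards [hlower (2 * t) (by linarith), self_mem_nhdsWithin] with r hr hr0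
    calc a < ENNReal.ofReal t := hat
      _ = ENNReal.ofReal (2 * t * r) / ENNReal.ofReal (2 * r) := by
          rw [hquot _ _ hr0, mul_div_cancel_left₀ _ two_ne_zero]
      _ ≤ m r / ENNReal.ofReal (2 * r) := by gcongr
  · obtain ⟨t, ht, htb⟩ := ENNReal.lt_iff_exists_real_btwn.1 hb |>.imp fun t h => h.2
    have ht : 1 < t := by rwa [ENNReal.one_lt_ofReal] at ht
    filter_upwards [hupper (2 * t) (by linarith), self_mem_nhdsWithin] with r hr hr0
    calc m r / ENNReal.ofReal (2 * r) ≤ ENNReal.ofReal (2 * t * r) / ENNReal.ofReal (2 * r) := by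
          gcongr
      _ = ENNReal.ofReal t := by rw [hquot _ _ hr0, mul_div_cancel_left₀ _ two_ne_zero]
      _ < b := htb

theorem isH1Rectifiable_of_subset_iUnion {ι : Type*} [Countable ι] {C : ι → Set Plane}
    (hC : ∀ i, IsPreconnected (C i)) (hCm : ∀ i, MeasurableSet (C i)) (hfin : ∀ i, H1 (C i) < ⊤)
    {K : Set Plane} (hK : MeasurableSet K) (hKfin : H1 K < ⊤) (hKC : K ⊆ ⋃ i, C i) :
    IsH1Rectifiable K := by
  refine ⟨hKfin, (ae_restrict_iff' hK).2 ?_⟩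
  filter_upwards [(ae_restrict_iff' hK).1 (ae_upper_density_le_one hK hKfin), ae_all_iff.2 fun i =>
    ae_lower_density_ge_one_of_subset (hC i) (hCm i) (hfin i) hK] with x hupper hlower hxK
  obtain ⟨i, hi⟩ := mem_iUnion.1 (hKC hxK)
  refine tendsto_div_ofReal_two_mul_of_bounds (hlower i ⟨hxK, hi⟩) fun t ht =>
    (hupper hxK t ht).mono fun r hr => ?_
  rw [Measure.restrict_apply Metric.isClosed_closedBall.measurableSet, inter_comm] at hr
  exact (measure_mono (inter_subset_inter_right K Metric.ball_subset_closedBall)).trans hr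

theorem ediam_closedBall_le_hausdorffMeasure_one (hC : IsPreconnected C) {x p q : X} {ε : ℝ}
    (hp : p ∈ C) (hpx : dist p x ≤ ε / 2) (hq : q ∈ C) (hqx : ε ≤ dist q x) :
    Metric.ediam (Metric.closedBall x (4 * ε)) ≤ 16 * μH[1] (C ∩ Metric.ball x ε) :=
  calc Metric.ediam (Metric.closedBall x (4 * ε)) ≤ ENNReal.ofReal (2 * (4 * ε)) :=
        ediam_closedBall_le_ofReal _ _
    _ = 16 * ENNReal.ofReal (ε - ε / 2) := by
        rw [show 2 * (4 * ε) = 16 * (ε - ε / 2) by ring, ENNReal.ofReal_mul (by norm_num),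
          ENNReal.ofReal_ofNat]
    _ ≤ 16 * μH[1] (C ∩ Metric.ball x ε) := by
        gcongr
        exact ofReal_sub_le_hausdorffMeasure_one_inter_ball hC hp hpx hq hqx

theorem sum_ediam_closedBall_le_hausdorffMeasure_one (hC : IsPreconnected C) {ε : ℝ}
    {s : Finset X} (hdisj : (s : Set X).PairwiseDisjoint fun x => Metric.closedBall x ε)
    (hnear : ∀ x ∈ s, ∃ z ∈ C, dist z x ≤ ε / 2) {p q : X} (hp : p ∈ C) (hq : q ∈ C)
    (hpq : 2 * ε ≤ dist p q) :
    ∑ x ∈ s, Metric.ediam (Metric.closedBall x (4 * ε)) ≤ 16 * μH[1] C :=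
  calc ∑ x ∈ s, Metric.ediam (Metric.closedBall x (4 * ε))
      ≤ ∑ x ∈ s, 16 * μH[1].restrict C (Metric.ball x ε) := Finset.sum_le_sum fun x hx => by
        obtain ⟨z, hz, hzx⟩ := hnear x hx
        obtain ⟨w, hw, hwx⟩ : ∃ w ∈ C, ε ≤ dist w x := by
          by_contra! hclose
          linarith [hclose p hp, hclose q hq, dist_triangle_right p q x]
        rw [Measure.restrict_apply measurableSet_ball, inter_comm]
        exact ediam_closedBall_le_hausdorffMeasure_one hC hz hzx hw hwx
    _ = 16 * μH[1].restrict C (⋃ x ∈ s, Metric.ball x ε) := by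
        rw [← Finset.mul_sum, measure_biUnion_finset (hdisj.mono fun x =>
          Metric.ball_subset_closedBall) fun _ _ => measurableSet_ball]
    _ ≤ 16 * μH[1] C := mul_le_mul_right
        ((measure_mono (subset_univ _)).trans_eq (Measure.restrict_apply_univ _)) 16

theorem hausdorffMeasure_one_le_of_connected_approx [TopologicalSpace.SeparableSpace X]
    {D : ℕ → Set X} {M : ℝ≥0∞} (hconn : ∀ k, IsPreconnected (D k)) (hM : ∀ k, μH[1] (D k) ≤ M)
    (happ : ∀ z ∈ C, ∀ ε : ℝ, 0 < ε → ∀ᶠ k in atTop, ∃ z' ∈ D k, dist z' z ≤ ε) :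
    μH[1] C ≤ 16 * M := by
  have : NullSingletonClass (μH[1] : Measure X) :=
    Measure.nullSingletonClass_hausdorff X one_pos
  rcases C.subsingleton_or_nontrivial with hsub | ⟨p, hp, q, hq, hpq⟩
  · simp only [hsub.measure_zero, zero_le]
  refine hausdorffMeasure_one_le_of_ae_covers fun δ hδ => ?_
  set ε := min (δ / 8) (dist p q / 4)
  have hε : 0 < ε := lt_min (by positivity) (by have := dist_pos.2 hpq; positivity)
  have hεδ : ε ≤ δ / 8 := min_le_left _ _
  have hεpq : ε ≤ dist p q / 4 := min_le_right _ _
  obtain ⟨u, huC, hdisj, hcover⟩ := Vitali.exists_disjoint_subfamily_covering_enlargement_closedBall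
    C id (fun _ => ε) ε (fun _ _ => le_rfl) 4 (by norm_num)
  have hu : u.Countable := hdisj.countable_of_nonempty_interior fun x _ =>
    ⟨x, Metric.ball_subset_interior_closedBall (Metric.mem_ball_self hε)⟩
  refine ⟨u, hu.to_subtype, fun x => Metric.closedBall x.1 (4 * ε), ?_, fun x => ?_, ?_⟩
  · rw [sdiff_eq_empty.2, measure_empty]
    intro z hz
    obtain ⟨b, hb, hsub⟩ := hcover z hz
    exact mem_iUnion.2 ⟨⟨b, hb⟩, hsub (Metric.mem_closedBall_self hε.le)⟩
  · exact (ediam_closedBall_le_ofReal _ _).trans (ENNReal.ofReal_le_ofReal (by linarith))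
  rw [ENNReal.tsum_eq_iSup_sum]
  refine iSup_le fun s => ?_
  obtain ⟨k, hk, ⟨p', hp', hpd⟩, q', hq', hqd⟩ := (((eventually_all_finset s).2 fun x _ =>
    happ x.1 (huC x.2) (ε / 2) (by positivity)).and
      ((happ p hp ε hε).and (happ q hq ε hε))).exists
  have hsum := sum_ediam_closedBall_le_hausdorffMeasure_one (hconn k)
    (s := s.map (Function.Embedding.subtype _))
    (hdisj.subset (by simp)) (by simpa using fun x hx hxs => hk ⟨x, hx⟩ hxs) hp' hq'
    (by linarith [dist_triangle4 p p' q' q, dist_comm p p'])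
  rw [Finset.sum_map] at hsum
  exact hsum.trans (by gcongr; exact hM k)

end Density

section SignedDistance

section Frontier

variable {V : Type*} [NormedAddCommGroup V] [NormedSpace ℝ V] {E : Set V} {x y : V}

theorem exists_mem_frontier_dist_le (hx : x ∉ E) (hy : y ∈ E) :
    ∃ z ∈ frontier E, dist x z ≤ dist x y := by
  obtain ⟨z, hz, hzf⟩ := inter_frontier_nonempty (convex_segment (𝕜 := ℝ) x y).isPreconnected
    ⟨y, right_mem_segment ℝ x y, hy⟩ ⟨x, left_mem_segment ℝ x y, hx⟩
  exact ⟨z, hzf, by linarith [dist_add_dist_of_mem_segment hz, dist_nonneg (x := z) (y := y)]⟩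

theorem infDist_frontier_of_notMem (hx : x ∉ E) (hE : E.Nonempty) :
    Metric.infDist x (frontier E) = Metric.infDist x E := by
  refine le_antisymm ((Metric.le_infDist hE).2 fun y hy => ?_) ?_
  · obtain ⟨z, hz, hzy⟩ := exists_mem_frontier_dist_le hx hy
    exact (Metric.infDist_le_dist_of_mem hz).trans hzy
  · obtain ⟨y, hy⟩ := hE
    obtain ⟨z, hz, -⟩ := exists_mem_frontier_dist_le hx hy
    rw [← Metric.infDist_closure (s := E)]
    exact Metric.infDist_le_infDist_of_subset frontier_subset_closure ⟨z, hz⟩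

theorem infDist_frontier_of_mem (hx : x ∈ E) (hE : Eᶜ.Nonempty) :
    Metric.infDist x (frontier E) = Metric.infDist x Eᶜ := by
  rw [← frontier_compl]
  exact infDist_frontier_of_notMem (notMem_compl_iff.2 hx) hE

end Frontier

variable {E : Set Plane}

theorem abs_sdist (hE : E.Nonempty) (hE' : Eᶜ.Nonempty) (x : Plane) :
    |sdist E x| = Metric.infDist x (frontier E) := by
  unfold sdist
  split_ifs with hx
  · rw [abs_neg, abs_of_nonneg Metric.infDist_nonneg, infDist_frontier_of_mem hx hE']
  · rw [abs_of_nonneg Metric.infDist_nonneg, infDist_frontier_of_notMem hx hE]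

theorem max_sdist_zero (E : Set Plane) (x : Plane) :
    max (sdist E x) 0 = Metric.infDist x E := by
  unfold sdist
  split_ifs with hx
  · rw [Metric.infDist_zero_of_mem hx]
    exact max_eq_right (neg_nonpos.2 Metric.infDist_nonneg)
  · exact max_eq_left Metric.infDist_nonneg

theorem sdist_eq (hE : E.Nonempty) (hE' : Eᶜ.Nonempty) (x : Plane) :
    sdist E x = 2 * Metric.infDist x (closure E) - Metric.infDist x (frontier E) := by
  have h := max_zero_add_max_neg_zero_eq_abs_self (sdist E x)
  have h' := max_zero_sub_eq_self (sdist E x)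
  rw [max_sdist_zero] at h h'
  rw [Metric.infDist_closure, ← abs_sdist hE hE']
  linarith

end SignedDistance

section Subgraphs

variable {l L : ℝ} {h : ℝ → ℝ} {K : Set Plane}

theorem isOpen_Omega (l L : ℝ) : IsOpen (Omega l L) :=
  (isOpen_Ioo.preimage (f := fun p : Plane => p 0) (by fun_prop)).inter
    (isOpen_lt (f := fun _ : Plane => -L) (g := fun p : Plane => p 1) (by fun_prop) (by fun_prop))

theorem closure_Omega (hl : 0 < l) :
    closure (Omega l L) = {p : Plane | p 0 ∈ Icc (-l) l ∧ -L ≤ p 1} := by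
  refine Subset.antisymm (closure_minimal ?_ ?_) ?_
  · exact fun p hp => ⟨Ioo_subset_Icc_self hp.1, hp.2.le⟩
  · exact (isClosed_Icc.preimage (f := fun p : Plane => p 0) (by fun_prop)).inter
      (isClosed_le (f := fun _ : Plane => -L) (g := fun p : Plane => p 1) (by fun_prop)
        (by fun_prop))
  · rintro p ⟨⟨hleft, hright⟩, hbot⟩
    have hcont : Continuous fun t : ℝ => p + t • (!₂[-p 0, 1] : Plane) := by fun_prop
    have hlim := hcont.tendsto 0
    rw [zero_smul, add_zero] at hlim
    refine mem_closure_of_tendsto (hlim.mono_left (nhdsWithin_le_nhds (s := Ioi 0))) ?_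
    filter_upwards [Ioo_mem_nhdsGT (one_pos : (0 : ℝ) < 1)] with t ht
    refine ⟨⟨?_, ?_⟩, ?_⟩ <;>
      simp only [PiLp.add_apply, PiLp.smul_apply, smul_eq_mul, Matrix.cons_val_zero,
        Matrix.cons_val_one] <;>
      nlinarith [ht.1, ht.2]

/-- The part of the closed subgraph `S_h` in the closure of the container: the uncracked layer of
height `h`. -/
def film (l L : ℝ) (h : ℝ → ℝ) : Set Plane := subgraph l h ∩ closure (Omega l L)

theorem mem_film (hl : 0 < l) {p : Plane} :
    p ∈ film l L h ↔ p 0 ∈ Icc (-l) l ∧ -L ≤ p 1 ∧ p 1 ≤ h (p 0) := by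
  rw [film, closure_Omega hl]
  exact ⟨fun ⟨⟨h0, htop⟩, _, hbot⟩ => ⟨h0, hbot, htop⟩,
    fun ⟨h0, hbot, htop⟩ => ⟨⟨h0, htop⟩, h0, hbot⟩⟩

theorem isClosed_film (hu : UpperSemicontinuousOn h (Icc (-l) l)) : IsClosed (film l L h) :=
  (((upperSemicontinuousOn_iff_isClosed_hypograph isClosed_Icc).1 hu).preimage
    (f := fun p : Plane => (p 0, p 1)) (by fun_prop)).inter isClosed_closure

theorem film_subset_box (hl : 0 < l) (hm : MapsTo h (Icc (-l) l) (Icc 0 L)) :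
    film l L h ⊆ {p : Plane | p 0 ∈ Icc (-l) l ∧ p 1 ∈ Icc (-L) L} := fun p hp => by
  obtain ⟨h0, hbot, htop⟩ := (mem_film hl).1 hp
  exact ⟨h0, hbot, htop.trans (hm h0).2⟩

theorem plane_eta (p : Plane) : !₂[p 0, p 1] = p := by
  ext i
  fin_cases i <;> rfl

theorem isCompact_box (l L : ℝ) :
    IsCompact {p : Plane | p 0 ∈ Icc (-l) l ∧ p 1 ∈ Icc (-L) L} := by
  have himage : {p : Plane | p 0 ∈ Icc (-l) l ∧ p 1 ∈ Icc (-L) L} =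
      (fun q : ℝ × ℝ => !₂[q.1, q.2]) '' (Icc (-l) l ×ˢ Icc (-L) L) := by
    ext p
    refine ⟨fun hp => ⟨(p 0, p 1), hp, plane_eta p⟩, ?_⟩
    rintro ⟨q, hq, rfl⟩
    exact hq
  rw [himage]
  exact (isCompact_Icc.prod isCompact_Icc).image (by fun_prop)

theorem region_eq_film_sdiff (l L : ℝ) (h : ℝ → ℝ) (K : Set Plane) :
    region l L h K = film l L h \ K :=
  inter_right_comm _ _ _

theorem closure_interior_subgraph_inter (hl : 0 < l) (hL : 0 < L)
    (hm : MapsTo h (Icc (-l) l) (Icc 0 L)) :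
    closure (interior (subgraph l h)) ∩ closure (Omega l L) ⊆ closure (interior (film l L h)) := by
  rintro p ⟨hp, hpΩ⟩
  rcases lt_or_ge (p 1) 0 with hneg | hnonneg
  · have hopen : IsOpen {q : Plane | q 1 < 0} := isOpen_lt (by fun_prop) (by fun_prop)
    refine closure_mono (interior_maximal ?_ (hopen.inter (isOpen_Omega l L)))
      (hopen.inter_closure ⟨hneg, hpΩ⟩)
    rintro q ⟨hq : q 1 < 0, hq0, hq1⟩
    have hq0 := Ioo_subset_Icc_self hq0
    exact (mem_film hl).2 ⟨hq0, hq1.le, hq.le.trans (hm hq0).1⟩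
  · have hopen : IsOpen {q : Plane | -L < q 1} := isOpen_lt (by fun_prop) (by fun_prop)
    refine closure_mono (interior_maximal ?_ (hopen.inter isOpen_interior))
      (hopen.inter_closure ⟨show -L < p 1 by linarith, hp⟩)
    rintro q ⟨hq : -L < q 1, hqS⟩
    obtain ⟨hq0, hq1⟩ := interior_subset hqS
    exact (mem_film hl).2 ⟨hq0, hq.le, hq1⟩

namespace IsAdmissiblePair

theorem closure_region (hl : 0 < l) (hL : 0 < L) (hp : IsAdmissiblePair l L h K) :
    closure (region l L h K) = film l L h := by
  rw [region_eq_film_sdiff]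
  refine Subset.antisymm (closure_minimal sdiff_subset (isClosed_film hp.height.usc))
    fun p hpF => ?_
  by_cases hpK : p ∈ K
  · have hnull : volume K = 0 := addHaar_eq_zero_of_hausdorffMeasure_lt_top volume
      (by rw [finrank_euclideanSpace_fin]; norm_num) hp.crack.rectifiable.1
    have hdense : Dense Kᶜ := Measure.dense_of_ae (measure_eq_zero_iff_ae_notMem.1 hnull)
    have hcl := closure_minimal (hdense.open_subset_closure_inter isOpen_interior)
      isClosed_closure (closure_interior_subgraph_inter hl hL hp.height.mapsTo
        ⟨hp.subset hpK, hpF.2⟩)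
    exact closure_mono (inter_subset_inter_left _ interior_subset) hcl
  · exact subset_closure ⟨hpF, hpK⟩

theorem frontier_region (hl : 0 < l) (hL : 0 < L) (hp : IsAdmissiblePair l L h K) :
    frontier (region l L h K) = frontier (film l L h) ∪ K := by
  have hclosed := isClosed_film (L := L) hp.height.usc
  have hKF : K ⊆ film l L h := fun p hpK => closure_minimal interior_subset hclosed
    (closure_interior_subgraph_inter hl hL hp.height.mapsTo ⟨hp.subset hpK, hp.crack.subset hpK⟩)
  rw [frontier_eq_closure_inter_closure, hp.closure_region hl hL, region_eq_film_sdiff,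
    compl_sdiff, closure_union, hp.crack.closed.closure_eq, inter_union_distrib_left,
    inter_eq_right.2 hKF, frontier_eq_closure_inter_closure, hclosed.closure_eq, union_comm]

end IsAdmissiblePair

theorem origin_mem_film (hl : 0 < l) (hL : 0 < L) (hm : MapsTo h (Icc (-l) l) (Icc 0 L)) :
    (0 : Plane) ∈ film l L h := by
  have h0 : (0 : ℝ) ∈ Icc (-l) l := ⟨neg_nonpos.2 hl.le, hl.le⟩
  exact (mem_film hl).2 ⟨h0, neg_nonpos.2 hL.le, (hm h0).1⟩

theorem IsAdmissiblePair.region_nonempty (hl : 0 < l) (hL : 0 < L)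
    (hp : IsAdmissiblePair l L h K) : (region l L h K).Nonempty := by
  rw [← closure_nonempty_iff, hp.closure_region hl hL]
  exact ⟨0, origin_mem_film hl hL hp.height.mapsTo⟩

theorem region_compl_nonempty (l L : ℝ) (h : ℝ → ℝ) (K : Set Plane) :
    (region l L h K)ᶜ.Nonempty :=
  ⟨!₂[l + 1, 0], fun hp => (lt_add_one l).not_ge hp.1.1.1.2⟩

end Subgraphs

section HeightVariation

variable {l L : ℝ} {h : ℝ → ℝ}

theorem horizontal_segment_inter_frontier_film_nonempty (hl : 0 < l) {a b y : ℝ}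
    (ha : a ∈ Icc (-l) l) (hb : b ∈ Icc (-l) l) (hyL : -L ≤ y)
    (hy : y ∈ Ioc (min (h a) (h b)) (max (h a) (h b))) :
    ∃ t ∈ uIcc a b, (!₂[t, y] : Plane) ∈ frontier (film l L h) := by
  have hmem (t : ℝ) (ht : t ∈ Icc (-l) l) : (!₂[t, y] : Plane) ∈ film l L h ↔ y ≤ h t :=
    (mem_film hl).trans ⟨fun h => h.2.2, fun h => ⟨ht, hyL, h⟩⟩
  have hconn : IsPreconnected ((fun t : ℝ => (!₂[t, y] : Plane)) '' uIcc a b) :=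
    isPreconnected_uIcc.image _ (by fun_prop)
  have hmin : h a < y ∨ h b < y := min_lt_iff.1 hy.1
  have hmax : y ≤ h a ∨ y ≤ h b := le_max_iff.1 hy.2
  obtain ⟨_, ⟨t, ht, rfl⟩, hfr⟩ := inter_frontier_nonempty (E := film l L h) hconn
    (hmax.elim (fun hle => ⟨_, ⟨a, left_mem_uIcc, rfl⟩, (hmem a ha).2 hle⟩)
      fun hle => ⟨_, ⟨b, right_mem_uIcc, rfl⟩, (hmem b hb).2 hle⟩)
    (hmin.elim (fun hlt => ⟨_, ⟨a, left_mem_uIcc, rfl⟩, fun hc => hlt.not_ge ((hmem a ha).1 hc)⟩)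
      fun hlt => ⟨_, ⟨b, right_mem_uIcc, rfl⟩, fun hc => hlt.not_ge ((hmem b hb).1 hc)⟩)
  exact ⟨t, ht, hfr⟩

theorem edist_height_le (hl : 0 < l) (hL : 0 < L) (hm : MapsTo h (Icc (-l) l) (Icc 0 L))
    {a b : ℝ} (ha : a ∈ Icc (-l) l) (hb : b ∈ Icc (-l) l) (hab : a ≤ b) :
    edist (h b) (h a) ≤ H1 (frontier (film l L h) ∩ {p | p 0 ∈ Icc a b}) := by
  have hcoord : LipschitzWith 1 fun p : Plane => p 1 :=
    LipschitzWith.of_dist_le_mul fun p q => by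
      simpa only [NNReal.coe_one, one_mul] using PiLp.dist_apply_le p q 1
  calc edist (h b) (h a) = volume (Ioc (min (h a) (h b)) (max (h a) (h b))) := by
        rw [Real.volume_Ioc, edist_dist, dist_comm, Real.dist_eq, max_sub_min_eq_abs,
          abs_sub_comm]
    _ ≤ volume ((fun p : Plane => p 1) '' (frontier (film l L h) ∩ {p | p 0 ∈ Icc a b})) := by
        refine measure_mono fun y hy => ?_
        have hyL : -L ≤ y := by linarith [le_min (hm ha).1 (hm hb).1, hy.1]
        obtain ⟨t, ht, hfr⟩ := horizontal_segment_inter_frontier_film_nonempty hl ha hb hyL hy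
        rw [uIcc_of_le hab] at ht
        exact ⟨_, ⟨hfr, ht⟩, rfl⟩
    _ ≤ H1 (frontier (film l L h) ∩ {p | p 0 ∈ Icc a b}) :=
        volume_image_le_hausdorffMeasure_one hcoord _

theorem eVariationOn_le_two_mul_measure {E : Type*} [PseudoEMetricSpace E] {f : ℝ → E}
    {s : Set ℝ} {ν : Measure ℝ}
    (hf : ∀ a ∈ s, ∀ b ∈ s, a < b → edist (f b) (f a) ≤ ν (Icc a b)) :
    eVariationOn f s ≤ 2 * ν univ := by
  refine iSup_le fun ⟨n, u, hu, hus⟩ => ?_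
  have hterm (i : ℕ) : edist (f (u (i + 1))) (f (u i)) ≤
      ν (Ico (u i) (u (i + 1))) + ν (Ioc (u i) (u (i + 1))) := by
    rcases (hu (Nat.le_succ i)).eq_or_lt with heq | hlt
    · rw [Nat.succ_eq_add_one] at heq
      rw [heq, edist_self]
      exact zero_le
    · refine (hf _ (hus i) _ (hus (i + 1)) hlt).trans ((measure_mono ?_).trans
        (measure_union_le _ _))
      rintro x ⟨hleft, hright⟩
      exact hright.lt_or_eq.imp (And.intro hleft) fun heq => ⟨hlt.trans_eq heq.symm, hright⟩
  calc ∑ i ∈ Finset.range n, edist (f (u (i + 1))) (f (u i))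
      ≤ ∑ i ∈ Finset.range n, (ν (Ico (u i) (u (i + 1))) + ν (Ioc (u i) (u (i + 1)))) :=
        Finset.sum_le_sum fun i _ => hterm i
    _ = ν (⋃ i ∈ Finset.range n, Ico (u i) (u (i + 1))) +
        ν (⋃ i ∈ Finset.range n, Ioc (u i) (u (i + 1))) := by
        rw [Finset.sum_add_distrib, measure_biUnion_finset, measure_biUnion_finset]
        · exact hu.pairwise_disjoint_on_Ioc_succ.set_pairwise _
        · exact fun _ _ => measurableSet_Ioc
        · exact hu.pairwise_disjoint_on_Ico_succ.set_pairwise _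
        · exact fun _ _ => measurableSet_Ico
    _ ≤ 2 * ν univ := by
        rw [two_mul]
        exact add_le_add (measure_mono (subset_univ _)) (measure_mono (subset_univ _))

theorem boundedVariationOn_of_hausdorffMeasure_frontier_lt_top (hl : 0 < l) (hL : 0 < L)
    (hm : MapsTo h (Icc (-l) l) (Icc 0 L)) (hfin : H1 (frontier (film l L h)) < ⊤) :
    BoundedVariationOn h (Icc (-l) l) := by
  have hcoord : Measurable fun p : Plane => p 0 := by fun_prop
  set ν : Measure ℝ := (H1.restrict (frontier (film l L h))).map fun p => p 0 with hν
  have hvar : eVariationOn h (Icc (-l) l) ≤ 2 * ν univ :=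
    eVariationOn_le_two_mul_measure fun a ha b hb hab => by
      rw [hν, Measure.map_apply hcoord measurableSet_Icc,
        Measure.restrict_apply (hcoord measurableSet_Icc), inter_comm]
      exact edist_height_le hl hL hm ha hb hab.le
  rw [hν, Measure.map_apply hcoord .univ, preimage_univ, Measure.restrict_apply_univ] at hvar
  exact (hvar.trans_lt (ENNReal.mul_lt_top ENNReal.ofNat_lt_top hfin)).ne

end HeightVariation

section HausdorffConvergence

/-- Convergence of a sequence of sets in the Hausdorff sense, expressed as uniform convergence of
the distance functions; for nonempty compact sets this is convergence of the Hausdorff distance to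
zero. -/
def HausdorffConverges {X : Type*} [PseudoMetricSpace X] (S : ℕ → Set X) (T : Set X) : Prop :=
  TendstoUniformly (fun k x => Metric.infDist x (S k)) (fun x => Metric.infDist x T) atTop

variable {X : Type*} [MetricSpace X]

theorem exists_pos_forall_le_infDist_or {A B : Set X} (hA : IsCompact A) (hB : IsClosed B)
    (hdisj : Disjoint A B) (hAne : A.Nonempty) (hBne : B.Nonempty) :
    ∃ ε : ℝ, 0 < ε ∧ ∀ x, ε ≤ Metric.infDist x A ∨ ε ≤ Metric.infDist x B := by
  obtain ⟨r, hr, hsep⟩ := Metric.exists_pos_forall_lt_edist hA hB hdisj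
  refine ⟨r / 2, by positivity, fun x => ?_⟩
  by_contra! hx
  obtain ⟨a, ha, hxa⟩ := (Metric.infDist_lt_iff hAne).1 hx.1
  obtain ⟨b, hb, hxb⟩ := (Metric.infDist_lt_iff hBne).1 hx.2
  have hab := hsep a ha b hb
  rw [edist_nndist, ENNReal.coe_lt_coe, ← NNReal.coe_lt_coe, coe_nndist] at hab
  linarith [dist_triangle_left a b x]

theorem infDist_iUnion_le_add {ι : Type*} {C D : ι → Set X} (hC : (⋃ i, C i).Nonempty)
    (hD : ∀ i, (D i).Nonempty) {x : X} {ε : ℝ}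
    (h : ∀ i, Metric.infDist x (D i) ≤ Metric.infDist x (C i) + ε) :
    Metric.infDist x (⋃ i, D i) ≤ Metric.infDist x (⋃ i, C i) + ε := by
  refine sub_le_iff_le_add.1 ((Metric.le_infDist hC).2 fun y hy => ?_)
  obtain ⟨i, hi⟩ := mem_iUnion.1 hy
  linarith [Metric.infDist_le_infDist_of_subset (x := x) (subset_iUnion D i) (hD i), h i,
    Metric.infDist_le_dist_of_mem (x := x) hi]

namespace HausdorffConverges

variable {S S' : ℕ → Set X} {T T' : Set X}

theorem tendsto_infDist_of_mem (hST : HausdorffConverges S T) {z : X} (hz : z ∈ T) :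
    Tendsto (fun k => Metric.infDist z (S k)) atTop (𝓝 0) := by
  simpa only [Metric.infDist_zero_of_mem hz] using hST.tendsto_at z

theorem mem_of_tendsto_infDist (hST : HausdorffConverges S T) (hT : IsClosed T)
    (hne : T.Nonempty) {z : X} (hz : Tendsto (fun k => Metric.infDist z (S k)) atTop (𝓝 0)) :
    z ∈ T := by
  rw [hT.mem_iff_infDist_zero hne]
  exact tendsto_nhds_unique (hST.tendsto_at z) hz

theorem eventually_exists_dist_lt (hST : HausdorffConverges S T) (hne : ∀ k, (S k).Nonempty)
    {z : X} (hz : z ∈ T) {ε : ℝ} (hε : 0 < ε) : ∀ᶠ k in atTop, ∃ w ∈ S k, dist z w < ε :=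
  ((hST.tendsto_infDist_of_mem hz).eventually (gt_mem_nhds hε)).mono fun k =>
    (Metric.infDist_lt_iff (hne k)).1

theorem eventually_forall_exists_dist_lt (hST : HausdorffConverges S T) (hne : T.Nonempty)
    {ε : ℝ} (hε : 0 < ε) : ∀ᶠ k in atTop, ∀ x ∈ S k, ∃ z ∈ T, dist x z < ε := by
  filter_upwards [Metric.tendstoUniformly_iff.1 hST ε hε] with k hk x hx
  have hxk := hk x
  rw [Metric.infDist_zero_of_mem hx, Real.dist_0_eq_abs, abs_of_nonneg Metric.infDist_nonneg]
    at hxk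
  exact (Metric.infDist_lt_iff hne).1 hxk

theorem subset (hST : HausdorffConverges S T) (hST' : HausdorffConverges S' T')
    (hT' : IsClosed T') (hne' : T'.Nonempty) (hne : ∀ k, (S k).Nonempty)
    (hsub : ∀ k, S k ⊆ S' k) : T ⊆ T' := fun _ hz =>
  hST'.mem_of_tendsto_infDist hT' hne' (squeeze_zero (fun _ => Metric.infDist_nonneg)
    (fun k => Metric.infDist_le_infDist_of_subset (hsub k) (hne k))
    (hST.tendsto_infDist_of_mem hz))

theorem const (T : Set X) : HausdorffConverges (fun _ => T) T :=
  fun _ hu => Eventually.of_forall fun _ _ => refl_mem_uniformity hu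

theorem comp_strictMono (hST : HausdorffConverges S T) {n : ℕ → ℕ} (hn : StrictMono n) :
    HausdorffConverges (fun k => S (n k)) T := fun u hu => hn.tendsto_atTop.eventually (hST u hu)

theorem iUnion {ι : Type*} [Finite ι] [Nonempty ι] {C : ℕ → ι → Set X} {D : ι → Set X}
    (hC : ∀ k i, (C k i).Nonempty) (hD : ∀ i, (D i).Nonempty)
    (hCD : ∀ i, HausdorffConverges (fun k => C k i) (D i)) :
    HausdorffConverges (fun k => ⋃ i, C k i) (⋃ i, D i) := by
  refine Metric.tendstoUniformly_iff.2 fun ε hε => ?_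
  filter_upwards [eventually_all.2 fun i =>
    Metric.tendstoUniformly_iff.1 (hCD i) (ε / 2) (half_pos hε)] with k hk x
  have hk (i : ι) := abs_lt.1 (Real.dist_eq _ _ ▸ hk i x)
  have hle := infDist_iUnion_le_add (nonempty_iUnion.2 ⟨Classical.arbitrary ι, hC k _⟩) hD
    (x := x) (ε := ε / 2) fun i => by linarith [(hk i).2]
  have hge := infDist_iUnion_le_add (nonempty_iUnion.2 ⟨Classical.arbitrary ι, hD _⟩) (hC k)
    (x := x) (ε := ε / 2) fun i => by linarith [(hk i).1]
  rw [Real.dist_eq, abs_lt]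
  constructor <;> linarith

/-- A separation `T = A ∪ B` would be seen by the connected sets `S k` close to `T`: on them the
difference of the distances to `A` and to `B` changes sign, but it does not vanish near `T`. -/
theorem isPreconnected (hST : HausdorffConverges S T) (hT : IsCompact T)
    (hconn : ∀ k, IsPreconnected (S k)) (hne : ∀ k, (S k).Nonempty) : IsPreconnected T := by
  refine isPreconnected_closed_iff.2 fun t t' ht ht' hcover hA hB => ?_
  by_contra hempty
  have hdisj : Disjoint (T ∩ t) (T ∩ t') := by
    rw [disjoint_iff_inter_eq_empty, ← inter_inter_distrib_left]
    exact not_nonempty_iff_eq_empty.1 hempty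
  obtain ⟨ε, hε, hsep⟩ := exists_pos_forall_le_infDist_or (hT.inter_right ht)
    (hT.isClosed.inter ht') hdisj hA hB
  have hexcl {x z : X} {A B : Set X} (hx : ε ≤ Metric.infDist x A ∨ ε ≤ Metric.infDist x B)
      (hz : z ∈ A) (hxz : dist x z < ε) : Metric.infDist x A < Metric.infDist x B := by
    have hlt := (Metric.infDist_le_dist_of_mem hz).trans_lt hxz
    exact hlt.trans_le (hx.resolve_left hlt.not_ge)
  obtain ⟨a, ha⟩ := hA
  obtain ⟨b, hb⟩ := hB
  obtain ⟨k, hclose, ⟨a', ha', haa'⟩, b', hb', hbb'⟩ :=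
    ((hST.eventually_forall_exists_dist_lt ⟨a, ha.1⟩ hε).and
      ((hST.eventually_exists_dist_lt hne ha.1 hε).and
        (hST.eventually_exists_dist_lt hne hb.1 hε))).exists
  rw [dist_comm] at haa' hbb'
  obtain ⟨x, hx, heq⟩ := (hconn k).intermediate_value₂ ha' hb'
    (Metric.continuous_infDist_pt (T ∩ t)).continuousOn
    (Metric.continuous_infDist_pt (T ∩ t')).continuousOn
    (hexcl (hsep a') ha haa').le (hexcl (hsep b').symm hb hbb').le
  obtain ⟨z, hz, hxz⟩ := hclose x hx
  rcases hcover hz with hzt | hzt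
  · exact (hexcl (hsep x) ⟨hz, hzt⟩ hxz).ne heq
  · exact (hexcl (hsep x).symm ⟨hz, hzt⟩ hxz).ne heq.symm

end HausdorffConverges

theorem exists_subseq_hausdorffConverges {ι : Type*} [Finite ι] {Q : Set X} (hQ : IsCompact Q)
    {S : ℕ → ι → Set X} (hc : ∀ k i, IsCompact (S k i)) (hne : ∀ k i, (S k i).Nonempty)
    (hSQ : ∀ k i, S k i ⊆ Q) :
    ∃ n : ℕ → ℕ, StrictMono n ∧ ∃ T : ι → Set X, (∀ i, IsCompact (T i)) ∧
      (∀ i, (T i).Nonempty) ∧ ∀ i, HausdorffConverges (fun k => S (n k) i) (T i) := by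
  set A : ℕ → ι → TopologicalSpace.NonemptyCompacts X := fun k i => ⟨⟨S k i, hc k i⟩, hne k i⟩
  have hcomp : IsCompact (univ.pi fun _ : ι =>
      {A : TopologicalSpace.NonemptyCompacts X | (A : Set X) ⊆ Q}) :=
    isCompact_univ_pi fun _ =>
      TopologicalSpace.NonemptyCompacts.isCompact_subsets_of_isCompact hQ
  obtain ⟨B, -, n, hn, hlim⟩ := hcomp.tendsto_subseq (x := A) fun k i _ => hSQ k i
  refine ⟨n, hn, fun i => B i, fun i => (B i).isCompact, fun i => (B i).nonempty, fun i => ?_⟩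
  refine Metric.tendstoUniformly_iff.2 fun ε hε => ?_
  filter_upwards [Metric.tendsto_nhds.1 (tendsto_pi_nhds.1 hlim i) ε hε] with k hk x
  have hlip := (Metric.lipschitz_infDist_set x).dist_le_mul (A (n k) i) (B i)
  rw [NNReal.coe_one, one_mul, dist_comm] at hlip
  exact hlip.trans_lt hk

end HausdorffConvergence

section ConnectedComponents

variable {X : Type*} [TopologicalSpace X] {Γ : Set X} {m : ℕ}

theorem exists_surjective_fin_of_card_le {α : Type*} [Nonempty α] (hm : ENat.card α ≤ m) :
    ∃ g : Fin m → α, Function.Surjective g := by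
  have hfin : Finite α := ENat.card_lt_top.1 (hm.trans_lt (ENat.natCast_lt_top m))
  have := Fintype.ofFinite α
  rw [ENat.card_eq_coe_fintype_card, Nat.cast_le] at hm
  obtain ⟨e⟩ := Function.Embedding.nonempty_of_card_le (hm.trans_eq (Fintype.card_fin m).symm)
  exact ⟨Function.invFun e, Function.invFun_surjective e.injective⟩

theorem exists_isPreconnected_cover_of_card_connectedComponents_le (hΓ : IsCompact Γ)
    (hne : Γ.Nonempty) (hm : ENat.card (ConnectedComponents Γ) ≤ m) :
    ∃ C : Fin m → Set X, (∀ j, IsCompact (C j)) ∧ (∀ j, (C j).Nonempty) ∧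
      (∀ j, IsPreconnected (C j)) ∧ ⋃ j, C j = Γ := by
  have : Nonempty (ConnectedComponents Γ) := ⟨ConnectedComponents.mk ⟨_, hne.some_mem⟩⟩
  have : CompactSpace Γ := isCompact_iff_compactSpace.1 hΓ
  obtain ⟨g, hg⟩ := exists_surjective_fin_of_card_le hm
  choose x hx using fun j => ConnectedComponents.surjective_coe (g j)
  refine ⟨fun j => Subtype.val '' connectedComponent (x j),
    fun j => isClosed_connectedComponent.isCompact.image continuous_subtype_val,
    fun j => ⟨_, mem_image_of_mem _ mem_connectedComponent⟩,
    fun j => isPreconnected_connectedComponent.image _ continuous_subtype_val.continuousOn,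
    Subset.antisymm (iUnion_subset fun j => Subtype.coe_image_subset Γ _) fun z hz => ?_⟩
  obtain ⟨j, hj⟩ := hg (ConnectedComponents.mk ⟨z, hz⟩)
  rw [← hx j] at hj
  exact mem_iUnion.2 ⟨j, ⟨z, hz⟩, ConnectedComponents.coe_eq_coe'.1 hj.symm, rfl⟩

theorem card_connectedComponents_le {C : Fin m → Set X} (hne : ∀ j, (C j).Nonempty)
    (hC : ∀ j, IsPreconnected (C j)) :
    ENat.card (ConnectedComponents (⋃ j, C j : Set X)) ≤ m := by
  choose x hx using hne
  have hg : Function.Surjective fun j : Fin m => (ConnectedComponents.mk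
      ⟨x j, mem_iUnion_of_mem j (hx j)⟩ : ConnectedComponents (⋃ j, C j : Set X)) := by
    intro c
    obtain ⟨⟨z, hz⟩, rfl⟩ := ConnectedComponents.surjective_coe c
    obtain ⟨j, hj⟩ := mem_iUnion.1 hz
    have hpre : IsPreconnected (Subtype.val ⁻¹' C j : Set (⋃ j, C j : Set X)) := by
      rw [← Topology.IsInducing.subtypeVal.isPreconnected_image, Subtype.image_preimage_coe,
        inter_eq_right.2 (subset_iUnion C j)]
      exact hC j
    exact ⟨j, ConnectedComponents.coe_eq_coe'.2 (hpre.subset_connectedComponent hj (hx j))⟩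
  simpa only [ENat.card_eq_coe_fintype_card, Fintype.card_fin] using
    ENat.card_le_card_of_injective (Function.injective_surjInv hg)

end ConnectedComponents

section GolabCompactness

variable {X : Type*} [MetricSpace X] [MeasurableSpace X] [BorelSpace X]
  [TopologicalSpace.SeparableSpace X]

theorem exists_subseq_hausdorffConverges_iUnion {Q : Set X} (hQ : IsCompact Q) {m : ℕ}
    {M : ℝ≥0∞} {Γ : ℕ → Set X} (hΓ : ∀ k, IsCompact (Γ k)) (hne : ∀ k, (Γ k).Nonempty)
    (hΓQ : ∀ k, Γ k ⊆ Q) (hcard : ∀ k, ENat.card (ConnectedComponents (Γ k)) ≤ m)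
    (hlen : ∀ k, μH[1] (Γ k) ≤ M) :
    ∃ n : ℕ → ℕ, StrictMono n ∧ ∃ D : Fin m → Set X, (∀ j, IsCompact (D j)) ∧
      (∀ j, (D j).Nonempty) ∧ (∀ j, IsPreconnected (D j)) ∧ (∀ j, μH[1] (D j) ≤ 16 * M) ∧
      (⋃ j, D j).Nonempty ∧ HausdorffConverges (fun k => Γ (n k)) (⋃ j, D j) := by
  choose C hC hCne hCconn hCΓ using fun k =>
    exists_isPreconnected_cover_of_card_connectedComponents_le (hΓ k) (hne k) (hcard k)
  have hCsub (k : ℕ) (j : Fin m) : C k j ⊆ Γ k := hCΓ k ▸ subset_iUnion (C k) j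
  obtain ⟨n, hn, D, hD, hDne, hlim⟩ := exists_subseq_hausdorffConverges hQ hC hCne
    fun k j => (hCsub k j).trans (hΓQ k)
  have : Nonempty (Fin m) := by
    obtain ⟨j, -⟩ := nonempty_iUnion.1 ((hCΓ 0).symm ▸ hne 0)
    exact ⟨j⟩
  refine ⟨n, hn, D, hD, hDne, fun j => (hlim j).isPreconnected (hD j) (fun k => hCconn (n k) j)
    fun k => hCne (n k) j, fun j => ?_,
    nonempty_iUnion.2 ⟨Classical.arbitrary _, hDne _⟩, ?_⟩
  · refine hausdorffMeasure_one_le_of_connected_approx (fun k => hCconn (n k) j)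
      (fun k => (measure_mono (hCsub (n k) j)).trans (hlen (n k))) fun z hz ε hε => ?_
    filter_upwards [(hlim j).eventually_exists_dist_lt (fun k => hCne (n k) j) hz hε]
      with k ⟨w, hw, hzw⟩
    exact ⟨w, hw, dist_comm z w ▸ hzw.le⟩
  · simpa only [hCΓ] using HausdorffConverges.iUnion (fun k => hCne (n k)) hDne hlim

end GolabCompactness

section FilmLimits

variable {l L : ℝ}

theorem dist_le_dist_of_abs_coord_le {p q p' q' : Plane} (h0 : |p 0 - q 0| ≤ |p' 0 - q' 0|)
    (h1 : |p 1 - q 1| ≤ |p' 1 - q' 1|) : dist p q ≤ dist p' q' := by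
  simp only [EuclideanSpace.dist_eq, Fin.sum_univ_two, Real.dist_eq]
  gcongr

theorem infDist_film_le_of_le {h : ℝ → ℝ} (hl : 0 < l) (hL : 0 < L)
    (hm : MapsTo h (Icc (-l) l) (Icc 0 L)) (z : Plane) {y : ℝ} (hy : -L ≤ y) (hyz : y ≤ z 1) :
    Metric.infDist (!₂[z 0, y] : Plane) (film l L h) ≤ Metric.infDist z (film l L h) := by
  refine (Metric.le_infDist ⟨0, origin_mem_film hl hL hm⟩).2 fun {w} hw => ?_
  obtain ⟨hw0, hbot, htop⟩ := (mem_film hl).1 hw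
  have hlowered : (!₂[w 0, max (-L) (w 1 - (z 1 - y))] : Plane) ∈ film l L h :=
    (mem_film hl).2 ⟨hw0, le_max_left _ _,
      max_le (hbot.trans htop) ((sub_le_self _ (sub_nonneg.2 hyz)).trans htop)⟩
  refine (Metric.infDist_le_dist_of_mem hlowered).trans
    (dist_le_dist_of_abs_coord_le le_rfl ?_)
  change |y - max (-L) (w 1 - (z 1 - y))| ≤ |z 1 - w 1|
  rcases max_cases (-L) (w 1 - (z 1 - y)) with ⟨hmax, hle⟩ | ⟨hmax, -⟩ <;> rw [hmax, abs_le]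
  · constructor <;> linarith [abs_nonneg (z 1 - w 1), le_abs_self (z 1 - w 1)]
  · constructor <;> linarith [neg_abs_le (z 1 - w 1), le_abs_self (z 1 - w 1)]

theorem upperSemicontinuousOn_of_isClosed_film {g : ℝ → ℝ} (hl : 0 < l) (hL : 0 < L)
    (hg : ∀ x ∈ Icc (-l) l, 0 ≤ g x) (hF : IsClosed (film l L g)) :
    UpperSemicontinuousOn g (Icc (-l) l) := by
  rw [upperSemicontinuousOn_iff_isClosed_hypograph isClosed_Icc]
  convert hF.preimage (f := fun p : ℝ × ℝ => (!₂[p.1, max (-L) p.2] : Plane)) (by fun_prop)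
    using 1
  ext p
  refine ⟨fun ⟨hp, hle⟩ => (mem_film hl).2 ⟨hp, le_max_left _ _, max_le ?_ hle⟩, fun hp => ?_⟩
  · exact (neg_nonpos.2 hL.le).trans (hg _ hp)
  · obtain ⟨hp0, -, hle⟩ := (mem_film hl).1 hp
    exact ⟨hp0, (le_max_right _ _).trans hle⟩

theorem exists_film_eq {F : Set Plane} (hl : 0 < l) (hF : IsClosed F)
    (hbox : F ⊆ {p : Plane | p 0 ∈ Icc (-l) l ∧ p 1 ∈ Icc (-L) L})
    (hbase : ∀ x ∈ Icc (-l) l, (!₂[x, 0] : Plane) ∈ F)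
    (hdown : ∀ z ∈ F, ∀ y, -L ≤ y → y ≤ z 1 → (!₂[z 0, y] : Plane) ∈ F) :
    ∃ g : ℝ → ℝ, MapsTo g (Icc (-l) l) (Icc 0 L) ∧ film l L g = F := by
  set column : ℝ → Set ℝ := fun x => {y | (!₂[x, y] : Plane) ∈ F}
  have hclosed (x : ℝ) : IsClosed (column x) :=
    hF.preimage (f := fun y : ℝ => (!₂[x, y] : Plane)) (by fun_prop)
  have hbdd (x : ℝ) : BddAbove (column x) := ⟨L, fun y hy => (hbox hy).2.2⟩
  have htop (x : ℝ) (hx : x ∈ Icc (-l) l) : (!₂[x, sSup (column x)] : Plane) ∈ F :=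
    (hclosed x).csSup_mem ⟨0, hbase x hx⟩ (hbdd x)
  refine ⟨fun x => sSup (column x),
    fun x hx => ⟨le_csSup (hbdd x) (hbase x hx), (hbox (htop x hx)).2.2⟩, ?_⟩
  ext z
  rw [mem_film hl]
  constructor
  · rintro ⟨hz0, hbot, hle⟩
    exact plane_eta z ▸ hdown _ (htop _ hz0) (z 1) hbot hle
  · intro hz
    refine ⟨(hbox hz).1, (hbox hz).2.1, le_csSup (hbdd _) ?_⟩
    rwa [mem_ofPred_eq, plane_eta]

theorem exists_film_limit (hl : 0 < l) (hL : 0 < L) {h : ℕ → ℝ → ℝ}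
    (hm : ∀ k, MapsTo (h k) (Icc (-l) l) (Icc 0 L)) {F : Set Plane} (hF : IsClosed F)
    (hFne : F.Nonempty) (hlim : HausdorffConverges (fun k => film l L (h k)) F) :
    ∃ g : ℝ → ℝ, MapsTo g (Icc (-l) l) (Icc 0 L) ∧ UpperSemicontinuousOn g (Icc (-l) l) ∧
      film l L g = F := by
  have hne (k : ℕ) : (film l L (h k)).Nonempty := ⟨0, origin_mem_film hl hL (hm k)⟩
  have hbox : F ⊆ {p : Plane | p 0 ∈ Icc (-l) l ∧ p 1 ∈ Icc (-L) L} :=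
    hlim.subset (.const _) (isCompact_box l L).isClosed
      ((hne 0).mono (film_subset_box hl (hm 0))) hne fun k => film_subset_box hl (hm k)
  have hbase (x : ℝ) (hx : x ∈ Icc (-l) l) : (!₂[x, 0] : Plane) ∈ F :=
    hlim.mem_of_tendsto_infDist hF hFne <| tendsto_const_nhds.congr fun k =>
      (Metric.infDist_zero_of_mem ((mem_film hl).2 ⟨hx, neg_nonpos.2 hL.le, (hm k hx).1⟩)).symm
  obtain ⟨g, hg, rfl⟩ := exists_film_eq hl hF hbox hbase fun z hz y hy hyz =>
    hlim.mem_of_tendsto_infDist hF hFne (squeeze_zero (fun _ => Metric.infDist_nonneg)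
      (fun k => infDist_film_le_of_le hl hL (hm k) z hy hyz) (hlim.tendsto_infDist_of_mem hz))
  exact ⟨g, hg, upperSemicontinuousOn_of_isClosed_film hl hL (fun x hx => (hg hx).1) hF, rfl⟩

theorem film_subset_film_iff {g h : ℝ → ℝ} (hl : 0 < l) (hL : 0 < L)
    (hm : MapsTo h (Icc (-l) l) (Icc 0 L)) :
    film l L h ⊆ film l L g ↔ ∀ x ∈ Icc (-l) l, h x ≤ g x := by
  refine ⟨fun hsub x hx => ?_, fun hle p hp => ?_⟩
  · exact ((mem_film hl).1 (hsub ((mem_film (p := !₂[x, h x]) hl).2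
      ⟨hx, (neg_nonpos.2 hL.le).trans (hm hx).1, le_rfl⟩))).2.2
  · obtain ⟨hp0, hbot, htop⟩ := (mem_film hl).1 hp
    exact (mem_film hl).2 ⟨hp0, hbot, htop.trans (hle _ hp0)⟩

end FilmLimits

section BoundaryLimits

variable {V : Type*} [NormedAddCommGroup V] [NormedSpace ℝ V] {E : ℕ → Set V} {F Γ : Set V}

theorem infDist_eq_of_hausdorffConverges_frontier (hE : ∀ k, (E k).Nonempty) (hF : IsClosed F)
    (hFne : F.Nonempty) (hEF : HausdorffConverges E F)
    (hEΓ : HausdorffConverges (fun k => frontier (E k)) Γ) {z : V} (hz : z ∉ F) :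
    Metric.infDist z Γ = Metric.infDist z F := by
  refine tendsto_nhds_unique (hEΓ.tendsto_at z) ((hEF.tendsto_at z).congr' ?_)
  filter_upwards [(hEF.tendsto_at z).eventually
    (lt_mem_nhds ((hF.notMem_iff_infDist_pos hFne).1 hz))] with k hk
  exact (infDist_frontier_of_notMem (fun hzE => hk.ne' (Metric.infDist_zero_of_mem hzE))
    (hE k)).symm

theorem frontier_subset_of_hausdorffConverges (hE : ∀ k, (E k).Nonempty) (hF : IsClosed F)
    (hΓ : IsClosed Γ) (hΓne : Γ.Nonempty) (hEF : HausdorffConverges E F)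
    (hEΓ : HausdorffConverges (fun k => frontier (E k)) Γ) : frontier F ⊆ Γ := by
  intro x hx
  have hxF : x ∈ F := hF.frontier_subset hx
  have hxc : x ∈ closure Fᶜ := (frontier_compl F ▸ hx).1
  rw [hΓ.mem_iff_infDist_zero hΓne]
  refine le_antisymm (le_of_forall_pos_le_add fun ε hε => ?_) Metric.infDist_nonneg
  obtain ⟨z, hz, hxz⟩ := Metric.mem_closure_iff.1 hxc (ε / 2) (half_pos hε)
  have hzF := Metric.infDist_le_dist_of_mem (x := z) hxF
  rw [dist_comm, ← infDist_eq_of_hausdorffConverges_frontier hE hF ⟨x, hxF⟩ hEF hEΓ hz] at hzF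
  linarith [Metric.infDist_le_infDist_add_dist (s := Γ) (x := x) (y := z)]

theorem HausdorffConverges.of_closure {X : Type*} [PseudoMetricSpace X] {S : ℕ → Set X}
    {T : Set X} (h : HausdorffConverges (fun k => closure (S k)) (closure T)) :
    HausdorffConverges S T := by
  simpa only [HausdorffConverges, Metric.infDist_closure] using h

theorem tendstoUniformly_sdist {E : ℕ → Set Plane} {E' : Set Plane} (hE : ∀ k, (E k).Nonempty)
    (hEc : ∀ k, (E k)ᶜ.Nonempty) (hE' : E'.Nonempty) (hEc' : E'ᶜ.Nonempty)
    (hlim : HausdorffConverges E E')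
    (hfr : HausdorffConverges (fun k => frontier (E k)) (frontier E')) :
    TendstoUniformly (fun k => sdist (E k)) (sdist E') atTop := by
  rw [Metric.tendstoUniformly_iff]
  intro ε hε
  filter_upwards [Metric.tendstoUniformly_iff.1 hlim (ε / 4) (by positivity),
    Metric.tendstoUniformly_iff.1 hfr (ε / 4) (by positivity)] with k hk hk' x
  have hx := abs_lt.1 (Real.dist_eq _ _ ▸ hk x)
  have hx' := abs_lt.1 (Real.dist_eq _ _ ▸ hk' x)
  rw [sdist_eq hE' hEc', sdist_eq (hE k) (hEc k), Metric.infDist_closure, Metric.infDist_closure,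
    Real.dist_eq, abs_lt]
  constructor <;> linarith [hx.1, hx.2, hx'.1, hx'.2]

end BoundaryLimits

section LayerCompactness

variable {l L : ℝ}

theorem exists_isAdmissiblePair_frontier_region_eq (hl : 0 < l) (hL : 0 < L) {g : ℝ → ℝ}
    (hg : MapsTo g (Icc (-l) l) (Icc 0 L)) (husc : UpperSemicontinuousOn g (Icc (-l) l))
    {ι : Type*} [Finite ι] {D : ι → Set Plane} (hD : ∀ j, IsClosed (D j))
    (hconn : ∀ j, IsPreconnected (D j)) (hfin : ∀ j, H1 (D j) < ⊤)
    (hfr : frontier (film l L g) ⊆ ⋃ j, D j) (hsub : ⋃ j, D j ⊆ film l L g) :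
    ∃ K, IsAdmissiblePair l L g K ∧ frontier (region l L g K) = ⋃ j, D j := by
  have hΓfin : H1 (⋃ j, D j) < ⊤ := by
    have := Fintype.ofFinite ι
    exact (measure_iUnion_fintype_le _ _).trans_lt (ENNReal.sum_lt_top.2 fun j _ => hfin j)
  have hclosed : IsClosed ((⋃ j, D j) ∩ closure (interior (subgraph l g))) :=
    (isClosed_iUnion_of_finite hD).inter isClosed_closure
  have hrect := isH1Rectifiable_of_subset_iUnion hconn (fun j => (hD j).measurableSet) hfin
    hclosed.measurableSet ((measure_mono inter_subset_left).trans_lt hΓfin) inter_subset_left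
  have hpair : IsAdmissiblePair l L g ((⋃ j, D j) ∩ closure (interior (subgraph l g))) :=
    { height := ⟨hg, husc, boundedVariationOn_of_hausdorffMeasure_frontier_lt_top hl hL hg
        ((measure_mono hfr).trans_lt hΓfin)⟩
      crack := ⟨fun z hz => (hsub hz.1).2, hclosed, hrect⟩
      subset := inter_subset_right }
  refine ⟨_, hpair, ?_⟩
  rw [hpair.frontier_region hl hL]
  refine Subset.antisymm (union_subset hfr inter_subset_left) fun z hz => ?_
  by_cases hint : z ∈ interior (film l L g)
  · exact Or.inr ⟨hz, subset_closure (interior_mono inter_subset_left hint)⟩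
  · exact Or.inl ⟨subset_closure (hsub hz), hint⟩

theorem isCompact_film (hl : 0 < l) {h : ℝ → ℝ} (hh : IsAdmissibleHeight l L h) :
    IsCompact (film l L h) :=
  (isCompact_box l L).of_isClosed_subset (isClosed_film hh.usc) (film_subset_box hl hh.mapsTo)

theorem IsAdmissiblePair.frontier_region_subset_film (hl : 0 < l) (hL : 0 < L) {h : ℝ → ℝ}
    {K : Set Plane} (hp : IsAdmissiblePair l L h K) :
    frontier (region l L h K) ⊆ film l L h :=
  frontier_subset_closure.trans (hp.closure_region hl hL).subset

theorem exists_subseq_film_frontier_hausdorffConverges (hl : 0 < l) (hL : 0 < L) {m : ℕ}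
    {M : ℝ≥0∞} {h : ℕ → ℝ → ℝ} {K : ℕ → Set Plane} (hadm : ∀ k, IsAdmissiblePair l L (h k) (K k))
    (hcard : ∀ k, ENat.card (ConnectedComponents (frontier (region l L (h k) (K k)))) ≤ m)
    (hlen : ∀ k, H1 (frontier (region l L (h k) (K k))) ≤ M) :
    ∃ n : ℕ → ℕ, StrictMono n ∧ ∃ (F : Set Plane) (D : Fin m → Set Plane),
      IsCompact F ∧ F.Nonempty ∧ (∀ j, IsCompact (D j)) ∧ (∀ j, (D j).Nonempty) ∧
      (∀ j, IsPreconnected (D j)) ∧ (∀ j, H1 (D j) ≤ 16 * M) ∧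
      (⋃ j, D j).Nonempty ∧ HausdorffConverges (fun k => film l L (h (n k))) F ∧
      HausdorffConverges (fun k => frontier (region l L (h (n k)) (K (n k)))) (⋃ j, D j) := by
  have hfrF (k : ℕ) := (hadm k).frontier_region_subset_film hl hL
  have hbox (k : ℕ) := film_subset_box hl (hadm k).height.mapsTo
  have hcomp (k : ℕ) := isCompact_film hl (hadm k).height
  obtain ⟨n, hn, D, hD, hDne, hDconn, hDM, hΓne, hDlim⟩ :=
    exists_subseq_hausdorffConverges_iUnion
    (isCompact_box l L) (fun k => (hcomp k).of_isClosed_subset isClosed_frontier (hfrF k))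
    (fun k => nonempty_frontier_iff.2 ⟨(hadm k).region_nonempty hl hL,
      nonempty_compl.1 (region_compl_nonempty l L _ _)⟩) (fun k => (hfrF k).trans (hbox k))
    hcard hlen
  obtain ⟨n', hn', F, hF, hFne, hFlim⟩ := exists_subseq_hausdorffConverges (ι := Unit)
    (isCompact_box l L) (fun k _ => hcomp (n k))
    (fun k _ => ⟨0, origin_mem_film hl hL (hadm (n k)).height.mapsTo⟩) fun k _ => hbox (n k)
  exact ⟨n ∘ n', hn.comp hn', F (), D, hF (), hFne (), hD, hDne, hDconn, hDM, hΓne,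
    hFlim (), hDlim.comp_strictMono hn'⟩

theorem exists_layer_limit (hl : 0 < l) (hL : 0 < L) {m : ℕ} {M : ℝ≥0∞} (hM : M < ⊤)
    {h : ℕ → ℝ → ℝ} {K : ℕ → Set Plane} (hadm : ∀ k, IsAdmissiblePair l L (h k) (K k))
    (hcard : ∀ k, ENat.card (ConnectedComponents (frontier (region l L (h k) (K k)))) ≤ m)
    (hlen : ∀ k, H1 (frontier (region l L (h k) (K k))) ≤ M) :
    ∃ n : ℕ → ℕ, StrictMono n ∧ ∃ (g : ℝ → ℝ) (K' : Set Plane), IsAdmissiblePair l L g K' ∧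
      ENat.card (ConnectedComponents (frontier (region l L g K'))) ≤ m ∧
      TendstoUniformly (fun k => sdist (region l L (h (n k)) (K (n k))))
        (sdist (region l L g K')) atTop := by
  obtain ⟨n, hn, F, D, hF, hFne, hD, hDne, hDconn, hDM, hΓne, hFlim, hDlim⟩ :=
    exists_subseq_film_frontier_hausdorffConverges hl hL hadm hcard hlen
  have hne (k : ℕ) := (hadm (n k)).region_nonempty hl hL
  have hfrne (k : ℕ) : (frontier (region l L (h (n k)) (K (n k)))).Nonempty :=
    nonempty_frontier_iff.2 ⟨hne k, nonempty_compl.1 (region_compl_nonempty l L _ _)⟩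
  have hΓ : IsClosed (⋃ j, D j) := isClosed_iUnion_of_finite fun j => (hD j).isClosed
  have hΓF : ⋃ j, D j ⊆ F := hDlim.subset hFlim hF.isClosed hFne hfrne
    fun k => (hadm (n k)).frontier_region_subset_film hl hL
  obtain ⟨g, hg, husc, rfl⟩ := exists_film_limit hl hL (fun k => (hadm (n k)).height.mapsTo)
    hF.isClosed hFne hFlim
  have hEF : HausdorffConverges (fun k => region l L (h (n k)) (K (n k))) (film l L g) :=
    .of_closure (by
      simpa only [fun k => (hadm (n k)).closure_region hl hL, hF.isClosed.closure_eq] using hFlim)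
  have hfr := frontier_subset_of_hausdorffConverges hne hF.isClosed hΓ hΓne hEF hDlim
  obtain ⟨K', hpair, hfrK⟩ := exists_isAdmissiblePair_frontier_region_eq hl hL hg husc
    (fun j => (hD j).isClosed) hDconn
    (fun j => (hDM j).trans_lt (ENNReal.mul_lt_top ENNReal.ofNat_lt_top hM)) hfr hΓF
  have hlim : HausdorffConverges (fun k => region l L (h (n k)) (K (n k))) (region l L g K') :=
    .of_closure (by
      simpa only [fun k => (hadm (n k)).closure_region hl hL, hpair.closure_region hl hL]
        using hFlim)
  exact ⟨n, hn, g, K', hpair, hfrK ▸ card_connectedComponents_le hDne hDconn,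
    tendstoUniformly_sdist hne (fun k => region_compl_nonempty l L _ _)
      (hpair.region_nonempty hl hL) (region_compl_nonempty l L _ _) hlim (hfrK.symm ▸ hDlim)⟩

end LayerCompactness

section PairCompactness

variable {E F : ℕ → Set Plane} {E' F' : Set Plane}

theorem sdist_neg_of_mem_interior {S : Set Plane} (hSc : Sᶜ.Nonempty) {x : Plane}
    (hx : x ∈ interior S) : sdist S x < 0 := by
  rw [sdist, if_pos (interior_subset hx), neg_lt_zero,
    ← Metric.infDist_pos_iff_notMem_closure hSc, closure_compl, notMem_compl_iff]
  exact hx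

theorem ball_subset_of_sdist_le_neg {S : Set Plane} {x : Plane} {r : ℝ} (hr : 0 < r)
    (hx : sdist S x ≤ -r) : Metric.ball x r ⊆ S := by
  have hxS : x ∈ S := by
    by_contra hxS
    rw [sdist, if_neg hxS] at hx
    linarith [Metric.infDist_nonneg (x := x) (s := S)]
  rw [sdist, if_pos hxS, neg_le_neg_iff] at hx
  intro y hy
  by_contra hyS
  exact (hx.trans (Metric.infDist_le_dist_of_mem hyS)).not_gt (Metric.mem_ball'.1 hy)

theorem closure_subset_closure_of_tendsto_sdist (hE : ∀ k, (E k).Nonempty) (hF' : F'.Nonempty)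
    (hsub : ∀ k, closure (E k) ⊆ closure (F k))
    (hEs : ∀ x, Tendsto (fun k => sdist (E k) x) atTop (𝓝 (sdist E' x)))
    (hFs : ∀ x, Tendsto (fun k => sdist (F k) x) atTop (𝓝 (sdist F' x))) :
    closure E' ⊆ closure F' := by
  intro x hx
  have hE₀ := (hEs x).max (tendsto_const_nhds (x := (0 : ℝ)))
  have hF₀ := (hFs x).max (tendsto_const_nhds (x := (0 : ℝ)))
  simp only [max_sdist_zero] at hE₀ hF₀
  have hle : Metric.infDist x F' ≤ Metric.infDist x E' :=
    le_of_tendsto_of_tendsto' hF₀ hE₀ fun k => by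
      rw [← Metric.infDist_closure (s := F k), ← Metric.infDist_closure (s := E k)]
      exact Metric.infDist_le_infDist_of_subset (hsub k) (hE k).closure
  rw [← Metric.infDist_closure (s := E'), Metric.infDist_zero_of_mem hx] at hle
  exact (Metric.mem_closure_iff_infDist_zero hF').2 (le_antisymm hle Metric.infDist_nonneg)

theorem frontier_inter_interior_eq_empty_of_tendsto_sdist
    (hE : ∀ k, (E k).Nonempty) (hEc : ∀ k, (E k)ᶜ.Nonempty) (hE' : E'.Nonempty)
    (hEc' : E'ᶜ.Nonempty) (hFc' : F'ᶜ.Nonempty)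
    (hdisj : ∀ k, frontier (E k) ∩ interior (F k) = ∅)
    (hEs : ∀ x, Tendsto (fun k => sdist (E k) x) atTop (𝓝 (sdist E' x)))
    (hFs : ∀ x, Tendsto (fun k => sdist (F k) x) atTop (𝓝 (sdist F' x))) :
    frontier E' ∩ interior F' = ∅ := by
  refine eq_empty_iff_forall_notMem.2 fun x ⟨hxE, hxF⟩ => ?_
  obtain ⟨r, hr, hxr⟩ : ∃ r > 0, sdist F' x < -r := by
    have hneg := sdist_neg_of_mem_interior hFc' hxF
    exact ⟨-sdist F' x / 2, by linarith, by linarith⟩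
  have hEx : |sdist E' x| < r := by rwa [abs_sdist hE' hEc', Metric.infDist_zero_of_mem hxE]
  obtain ⟨k, hkE, hkF⟩ := (((hEs x).abs.eventually (gt_mem_nhds hEx)).and
    ((hFs x).eventually (gt_mem_nhds hxr))).exists
  rw [abs_sdist (hE k) (hEc k), Metric.infDist_lt_iff
    (nonempty_frontier_iff.2 ⟨hE k, nonempty_compl.1 (hEc k)⟩)] at hkE
  obtain ⟨z, hz, hxz⟩ := hkE
  exact eq_empty_iff_forall_notMem.1 (hdisj k) z ⟨hz, interior_maximal
    (ball_subset_of_sdist_le_neg hr hkF.le) Metric.isOpen_ball (Metric.mem_ball'.2 hxz)⟩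

theorem mem_B1_of_tendsto_sdist {l L : ℝ} (hl : 0 < l) (hL : 0 < L)
    {A : ℕ → Set Plane × Set Plane} (hA : ∀ k, A k ∈ B1 l L) {g₁ g₀ : ℝ → ℝ} {K₁ K₀ : Set Plane}
    (hg₁ : IsAdmissiblePair l L g₁ K₁) (hg₀ : IsAdmissiblePair l L g₀ K₀)
    (h₁ : ∀ x, Tendsto (fun k => sdist (A k).1 x) atTop (𝓝 (sdist (region l L g₁ K₁) x)))
    (h₀ : ∀ x, Tendsto (fun k => sdist (A k).2 x) atTop (𝓝 (sdist (region l L g₀ K₀) x))) :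
    (region l L g₁ K₁, region l L g₀ K₀) ∈ B1 l L := by
  choose f₁ f₀ J₁ J₀ hp₁ hp₀ hAeq hle hdisj using hA
  obtain rfl : A = fun k => (region l L (f₁ k) (J₁ k), region l L (f₀ k) (J₀ k)) := funext hAeq
  refine ⟨g₁, g₀, K₁, K₀, hg₁, hg₀, rfl, ?_, ?_⟩
  · rw [← film_subset_film_iff hl hL hg₀.height.mapsTo, ← hg₀.closure_region hl hL,
      ← hg₁.closure_region hl hL]
    refine closure_subset_closure_of_tendsto_sdist (fun k => (hp₀ k).region_nonempty hl hL)
      (hg₁.region_nonempty hl hL) (fun k => ?_) h₀ h₁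
    rw [(hp₀ k).closure_region hl hL, (hp₁ k).closure_region hl hL,
      film_subset_film_iff hl hL (hp₀ k).height.mapsTo]
    exact hle k
  · exact frontier_inter_interior_eq_empty_of_tendsto_sdist
      (fun k => (hp₁ k).region_nonempty hl hL) (fun k => region_compl_nonempty l L _ _)
      (hg₁.region_nonempty hl hL) (region_compl_nonempty l L _ _) (region_compl_nonempty l L _ _)
      hdisj h₁ h₀

theorem exists_subseq_tauConverges {l L : ℝ} (hl : 0 < l) (hL : 0 < L) {m₁ m₀ : ℕ} {M : ℝ≥0∞}
    (hM : M < ⊤) {A : ℕ → Set Plane × Set Plane} (hA : ∀ k, A k ∈ B1m l L m₁ m₀)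
    (hlen₁ : ∀ k, H1 (frontier (A k).1) ≤ M) (hlen₀ : ∀ k, H1 (frontier (A k).2) ≤ M) :
    ∃ n : ℕ → ℕ, StrictMono n ∧ ∃ B ∈ B1m l L m₁ m₀, TauConverges l L (fun k => A (n k)) B := by
  choose h₁ h₀ K₁ K₀ hp₁ hp₀ hAeq _ _ using fun k => (hA k).1
  obtain rfl : A = fun k => (region l L (h₁ k) (K₁ k), region l L (h₀ k) (K₀ k)) := funext hAeq
  obtain ⟨n₁, hn₁, g₁, J₁, hg₁, hc₁, hlim₁⟩ := exists_layer_limit hl hL hM hp₁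
    (fun k => (hA k).2.1) hlen₁
  obtain ⟨n₀, hn₀, g₀, J₀, hg₀, hc₀, hlim₀⟩ := exists_layer_limit hl hL hM
    (fun k => hp₀ (n₁ k)) (fun k => (hA (n₁ k)).2.2) (fun k => hlen₀ (n₁ k))
  have hlim₁' : TendstoUniformly
      (fun k => sdist (region l L (h₁ (n₁ (n₀ k))) (K₁ (n₁ (n₀ k)))))
      (sdist (region l L g₁ J₁)) atTop := fun u hu => hn₀.tendsto_atTop.eventually (hlim₁ u hu)
  have hB := mem_B1_of_tendsto_sdist hl hL (fun k => (hA (n₁ (n₀ k))).1) hg₁ hg₀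
    hlim₁'.tendsto_at hlim₀.tendsto_at
  exact ⟨n₁ ∘ n₀, hn₁.comp hn₀, _, ⟨hB, hc₁, hc₀⟩, fun k => (hA _).1, hB,
    (iSup_le fun k => hlen₁ _).trans_lt hM, (iSup_le fun k => hlen₀ _).trans_lt hM,
    hlim₁'.tendstoLocallyUniformly, hlim₀.tendstoLocallyUniformly⟩

end PairCompactness

section WeakLimits

variable {X ι : Type*} [TopologicalSpace X] [T2Space X] [MeasurableSpace X] [BorelSpace X]
  {K : Set X}

theorem exists_weak_limit_of_isCompact (𝒰 : Ultrafilter ι) (hK : IsCompact K) {C : NNReal}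
    {μ : ι → Measure X} (hmass : ∀ i, μ i univ ≤ C) (hsupp : ∀ i, μ i Kᶜ = 0) :
    ∃ ν : Measure X, IsFiniteMeasure ν ∧ ∀ f : BoundedContinuousFunction X ℝ,
      Tendsto (fun i => ∫ x, f x ∂μ i) 𝒰 (𝓝 (∫ x, f x ∂ν)) := by
  let ρ (i : ι) : FiniteMeasure X := ⟨μ i, ⟨(hmass i).trans_lt ENNReal.coe_lt_top⟩⟩
  have hρ (i : ι) : (ρ i).mass ≤ C ∧ ρ i Kᶜ = 0 := by
    rw [← ENNReal.coe_le_coe, FiniteMeasure.ennreal_mass, FiniteMeasure.null_iff_toMeasure_null]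
    exact ⟨hmass i, hsupp i⟩
  obtain ⟨ν, -, hν⟩ := (isCompact_setOfPred_finiteMeasure_le_of_isCompact C hK).ultrafilter_le_nhds'
    (𝒰.map ρ) (Eventually.of_forall hρ : ∀ᶠ i in (𝒰 : Filter ι), _)
  exact ⟨ν, inferInstance, FiniteMeasure.tendsto_iff_forall_integral_tendsto.1 hν⟩

theorem exists_weak_limit_smul_restrict {vol : Measure X} (𝒰 : Ultrafilter ι) (hK : IsCompact K)
    {A : ι → Set X} (hA : ∀ i, MeasurableSet (A i)) (hAK : ∀ i, A i ⊆ K) {t : ι → ℝ}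
    (ht : ∀ i, 0 < t i) {C : ℝ} (hvol : ∀ i, vol (A i) ≤ ENNReal.ofReal (C * t i)) :
    ∃ ν : Measure X, IsFiniteMeasure ν ∧ ∀ f : BoundedContinuousFunction X ℝ,
      Tendsto (fun i => (t i)⁻¹ * ∫ x in A i, f x ∂vol) 𝒰 (𝓝 (∫ x, f x ∂ν)) := by
  have hmass (i : ι) : (ENNReal.ofReal (t i)⁻¹ • vol.restrict (A i)) univ ≤ C.toNNReal := by
    rw [Measure.smul_apply, Measure.restrict_apply_univ, smul_eq_mul]
    refine (mul_le_mul_right (hvol i) _).trans (le_of_eq ?_)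
    rw [← ENNReal.ofReal_mul (inv_nonneg.2 (ht i).le), mul_left_comm, inv_mul_cancel₀ (ht i).ne',
      mul_one, ENNReal.ofReal]
  have hsupp (i : ι) : (ENNReal.ofReal (t i)⁻¹ • vol.restrict (A i)) Kᶜ = 0 := by
    rw [Measure.smul_apply, Measure.restrict_apply' (hA i),
      (disjoint_compl_left_iff_subset.2 (hAK i)).inter_eq, measure_empty, smul_zero]
  obtain ⟨ν, hν, hlim⟩ := exists_weak_limit_of_isCompact 𝒰 hK hmass hsupp
  refine ⟨ν, hν, fun f => (hlim f).congr fun i => ?_⟩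
  rw [integral_smul_measure, ENNReal.toReal_ofReal (inv_nonneg.2 (ht i).le), smul_eq_mul]

end WeakLimits

section DirectionalDerivative

variable {V : Type*} [NormedAddCommGroup V] [MeasurableSpace V] [BorelSpace V] {vol : Measure V}
  {E : Set V}

theorem setIntegral_translate_sub [vol.IsAddRightInvariant] {f : V → ℝ} (hE : MeasurableSet E)
    (hf : Integrable f vol) (v : V) :
    ∫ x in E, (f (x + v) - f x) ∂vol =
      ∫ x in (fun x => x - v) ⁻¹' E \ E, f x ∂vol -
        ∫ x in E \ (fun x => x - v) ⁻¹' E, f x ∂vol := by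
  have hT : MeasurableSet ((fun x => x - v) ⁻¹' E) := hE.preimage (by fun_prop)
  have htranslate : ∫ x in E, f (x + v) ∂vol = ∫ x in (fun x => x - v) ⁻¹' E, f x ∂vol := by
    rw [← (measurePreserving_add_right vol v).setIntegral_preimage_emb
      (measurableEmbedding_addRight v) f ((fun x => x - v) ⁻¹' E), ← preimage_comp]
    simp only [Function.comp_def, add_sub_cancel_right, preimage_id']
  rw [integral_sub (hf.comp_add_right v).integrableOn hf.integrableOn, htranslate,
    ← integral_inter_add_sdiff (s := (fun x => x - v) ⁻¹' E) hE hf.integrableOn,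
    ← integral_inter_add_sdiff (s := E) hT hf.integrableOn, inter_comm E]
  ring

variable [NormedSpace ℝ V]

theorem tendsto_setIntegral_slope (hE : vol E ≠ ⊤) {f : V → ℝ} (hf : ContDiff ℝ 1 f)
    (hfc : HasCompactSupport f) (e : V) :
    Tendsto (fun t : ℝ => ∫ x in E, t⁻¹ * (f (x + t • e) - f x) ∂vol) (𝓝[≠] 0)
      (𝓝 (∫ x in E, fderiv ℝ f x e ∂vol)) := by
  obtain ⟨B, hB⟩ := hf.lipschitzWith_of_hasCompactSupport hfc one_ne_zero
  have := hf.continuous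
  refine tendsto_integral_filter_of_dominated_convergence (fun _ => B * ‖e‖)
    (Eventually.of_forall fun t => ?_) ?_ (integrableOn_const hE) (Eventually.of_forall fun x => ?_)
  · exact (by fun_prop : Continuous fun x => t⁻¹ * (f (x + t • e) - f x)).aestronglyMeasurable
  · filter_upwards [self_mem_nhdsWithin] with t (ht : t ≠ 0)
    refine Eventually.of_forall fun x => ?_
    rw [norm_mul, norm_inv, inv_mul_le_iff₀ (norm_pos_iff.2 ht), mul_left_comm, ← norm_smul]
    simpa only [dist_eq_norm, add_sub_cancel_left] using hB.dist_le_mul (x + t • e) x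
  · exact hasLineDerivAt_iff_tendsto_slope_zero.1
      ((hf.differentiable one_ne_zero x).hasFDerivAt.hasLineDerivAt e)

variable [FiniteDimensional ℝ V] [vol.IsAddHaarMeasure]

theorem exists_directional_derivative (hE : MeasurableSet E) (hb : Bornology.IsBounded E) (e : V)
    {C : ℝ} (hT : ∀ δ ∈ Ioc (0 : ℝ) 1,
      vol (E \ (fun x => x - δ • e) ⁻¹' E) ≤ ENNReal.ofReal (C * δ)) :
    ∃ μ ν : Measure V, IsFiniteMeasure μ ∧ IsFiniteMeasure ν ∧
      ∀ f : V → ℝ, ContDiff ℝ 1 f → HasCompactSupport f →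
        ∫ x in E, fderiv ℝ f x e ∂vol = ∫ x, f x ∂μ - ∫ x, f x ∂ν := by
  let δ (n : ℕ) : ℝ := 1 / ((n : ℝ) + 1)
  let T (n : ℕ) : Set V := (fun x => x - δ n • e) ⁻¹' E
  have hδ (n : ℕ) : δ n ∈ Ioc (0 : ℝ) 1 :=
    ⟨by positivity, div_le_one_of_le₀ (by linarith [n.cast_nonneg (α := ℝ)]) (by positivity)⟩
  have hTm (n : ℕ) : MeasurableSet (T n) := hE.preimage (by fun_prop)
  have hK : IsCompact (Metric.cthickening ‖e‖ E) :=
    Metric.isCompact_of_isClosed_isBounded Metric.isClosed_cthickening hb.cthickening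
  have hTK (n : ℕ) : T n ⊆ Metric.cthickening ‖e‖ E := fun x hx =>
    Metric.mem_cthickening_of_dist_le x _ _ E hx (by
      rw [dist_self_sub_right, norm_smul, Real.norm_of_nonneg (hδ n).1.le]
      exact mul_le_of_le_one_left (norm_nonneg e) (hδ n).2)
  have hvol (n : ℕ) : vol (T n \ E) ≤ ENNReal.ofReal (C * δ n) := by
    rw [measure_sdiff_symm (hTm n).nullMeasurableSet hE.nullMeasurableSet
      ((measurePreserving_sub_right vol _).measure_preimage hE.nullMeasurableSet)
      ((measure_mono inter_subset_right).trans_lt hb.measure_lt_top).ne]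
    exact hT _ (hδ n)
  obtain ⟨μ, hμ, hμlim⟩ := exists_weak_limit_smul_restrict (hyperfilter ℕ) hK
    (fun n => (hTm n).diff hE) (fun n => sdiff_subset.trans (hTK n)) (fun n => (hδ n).1) hvol
  obtain ⟨ν, hν, hνlim⟩ := exists_weak_limit_smul_restrict (hyperfilter ℕ) hK
    (fun n => hE.diff (hTm n)) (fun n => sdiff_subset.trans (Metric.self_subset_cthickening E))
    (fun n => (hδ n).1) fun n => hT _ (hδ n)
  refine ⟨μ, ν, hμ, hν, fun f hf hfc => ?_⟩
  obtain ⟨B, hB⟩ := hfc.exists_bound_of_continuous hf.continuous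
  let F := BoundedContinuousFunction.ofNormedAddCommGroup f hf.continuous B hB
  have hδlim : Tendsto δ (hyperfilter ℕ) (𝓝[≠] 0) :=
    (tendsto_nhdsWithin_iff.2 ⟨tendsto_one_div_add_atTop_nhds_zero_nat,
      Eventually.of_forall fun n => (hδ n).1.ne'⟩).mono_left Nat.hyperfilter_le_atTop
  refine tendsto_nhds_unique ((tendsto_setIntegral_slope hb.measure_lt_top.ne hf hfc e).comp hδlim)
    (((hμlim F).sub (hνlim F)).congr fun n => ?_)
  rw [Function.comp_apply, integral_const_mul, setIntegral_translate_sub hE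
    (hf.continuous.integrable_of_hasCompactSupport hfc), mul_sub]
  rfl

end DirectionalDerivative

section FinitePerimeter

theorem exists_polar_decomposition {α V : Type*} [MeasurableSpace α] [NormedAddCommGroup V]
    [InnerProductSpace ℝ V] [MeasurableSpace V] [BorelSpace V] [SecondCountableTopology V]
    {M : Measure α} {G : α → V} (hGm : Measurable G) (hG : Integrable G M) :
    ∃ (P : Measure α) (σ : α → V), IsFiniteMeasure P ∧ Measurable σ ∧ (∀ᵐ x ∂P, ‖σ x‖ = 1) ∧
      ∀ X : α → V, ∫ x, inner ℝ (X x) (σ x) ∂P = ∫ x, inner ℝ (X x) (G x) ∂M := by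
  refine ⟨M.withDensity fun x => ‖G x‖ₑ, fun x => ‖G x‖⁻¹ • G x,
    isFiniteMeasure_withDensity hG.2.ne, hGm.norm.inv.smul hGm, ?_, fun X => ?_⟩
  · rw [ae_withDensity_iff hGm.enorm]
    refine Eventually.of_forall fun x hx => ?_
    rw [norm_smul, norm_inv, norm_norm, inv_mul_cancel₀ (by simpa using hx)]
  · rw [integral_withDensity_eq_integral_toReal_smul hGm.enorm
      (Eventually.of_forall fun x => enorm_lt_top)]
    refine integral_congr_ae (Eventually.of_forall fun x => ?_)
    rcases eq_or_ne (G x) 0 with h0 | h0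
    · simp only [h0, norm_zero, enorm_zero, ENNReal.toReal_zero, smul_zero, inner_zero_right]
    · simp only [toReal_enorm, inner_smul_right, smul_eq_mul,
        mul_inv_cancel_left₀ (norm_ne_zero_iff.2 h0)]

theorem exists_common_density {α ι : Type*} [MeasurableSpace α] [Fintype ι] (μ ν : ι → Measure α)
    [∀ i, IsFiniteMeasure (μ i)] [∀ i, IsFiniteMeasure (ν i)] :
    ∃ (M : Measure α) (G : α → EuclideanSpace ℝ ι), IsFiniteMeasure M ∧ Measurable G ∧
      Integrable G M ∧ ∀ (i : ι) (f : α → ℝ) (B : ℝ), Measurable f → (∀ x, |f x| ≤ B) →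
        Integrable (fun x => f x * G x i) M ∧
          ∫ x, f x * G x i ∂M = ∫ x, f x ∂μ i - ∫ x, f x ∂ν i := by
  let M : Measure α := ∑ i, (μ i + ν i)
  have hle (i : ι) : μ i + ν i ≤ M :=
    Finset.single_le_sum (f := fun i => μ i + ν i) (fun _ _ => Measure.zero_le _)
      (Finset.mem_univ i)
  have hμ (i : ι) : μ i ≪ M := ((Measure.le_add_right le_rfl).trans (hle i)).absolutelyContinuous
  have hν (i : ι) : ν i ≪ M := ((Measure.le_add_left le_rfl).trans (hle i)).absolutelyContinuous
  let g (i : ι) (x : α) : ℝ := ((μ i).rnDeriv M x).toReal - ((ν i).rnDeriv M x).toReal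
  have hg (i : ι) : Integrable (g i) M :=
    Measure.integrable_toReal_rnDeriv.sub Measure.integrable_toReal_rnDeriv
  have hgm (i : ι) : Measurable (g i) := by fun_prop
  refine ⟨M, fun x => WithLp.toLp 2 fun i => g i x, inferInstance,
    (WithLp.measurable_toLp 2 _).comp (measurable_pi_lambda _ hgm), .of_eval_piLp hg,
    fun i f B hf hB => ?_⟩
  have hfB (ρ : Measure α) : ∀ᵐ x ∂ρ, ‖f x‖ ≤ B := Eventually.of_forall hB
  have hμi := Measure.integrable_toReal_rnDeriv (μ := μ i) (ν := M)
  have hνi := Measure.integrable_toReal_rnDeriv (μ := ν i) (ν := M)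
  refine ⟨(hg i).bdd_mul hf.aestronglyMeasurable (hfB M), ?_⟩
  simp only [g, mul_sub]
  rw [integral_sub (hμi.bdd_mul hf.aestronglyMeasurable (hfB M))
    (hνi.bdd_mul hf.aestronglyMeasurable (hfB M))]
  simp only [mul_comm (f _), ← smul_eq_mul]
  rw [integral_rnDeriv_smul (hμ i), integral_rnDeriv_smul (hν i)]

theorem divergence_eq_sum_fderiv {X : Plane → Plane} {x : Plane} (hX : DifferentiableAt ℝ X x) :
    divergence X x =
      ∑ i : Fin 2, fderiv ℝ (fun y => X y i) x (EuclideanSpace.single i 1) := by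
  refine Finset.sum_congr rfl fun i _ => ?_
  have hcomp : HasFDerivAt (fun y => X y i) ((EuclideanSpace.proj (𝕜 := ℝ) i).comp (fderiv ℝ X x))
      x := (EuclideanSpace.proj (𝕜 := ℝ) i).hasFDerivAt.comp x hX.hasFDerivAt
  rw [hcomp.fderiv]
  rfl

theorem setIntegral_divergence {E : Set Plane} (hb : Bornology.IsBounded E) {X : Plane → Plane}
    (hX : ContDiff ℝ 1 X) :
    ∫ x in E, divergence X x =
      ∑ i : Fin 2, ∫ x in E, fderiv ℝ (fun y => X y i) x (EuclideanSpace.single i 1) := by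
  simp_rw [fun x => divergence_eq_sum_fderiv (hX.differentiable one_ne_zero x)]
  refine integral_finsetSum _ fun i _ => ?_
  have hXi : ContDiff ℝ 1 fun x => X x i :=
    (EuclideanSpace.proj (𝕜 := ℝ) i : Plane →L[ℝ] ℝ).contDiff.comp hX
  have hcont : Continuous fun x => fderiv ℝ (fun y => X y i) x (EuclideanSpace.single i 1) :=
    (hXi.continuous_fderiv one_ne_zero).clm_apply continuous_const
  obtain ⟨R, hR⟩ := hb.subset_closedBall 0
  exact (hcont.continuousOn.integrableOn_compact (isCompact_closedBall 0 R)).mono_set hR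

theorem exists_isPolarOfDeriv {E : Set Plane} (hE : MeasurableSet E) (hb : Bornology.IsBounded E)
    {C : ℝ} (hT : ∀ i : Fin 2, ∀ δ ∈ Ioc (0 : ℝ) 1,
      volume (E \ (fun x => x - δ • EuclideanSpace.single i (1 : ℝ)) ⁻¹' E) ≤
        ENNReal.ofReal (C * δ)) :
    ∃ (P : Measure Plane) (σ : Plane → Plane), IsPolarOfDeriv E P σ := by
  choose μ ν hμ hν hder using fun i => exists_directional_derivative hE hb _ (hT i)
  obtain ⟨M, G, _, hGm, hG, hMG⟩ := exists_common_density μ ν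
  obtain ⟨P, σ, hP, hσ, hσ1, hPσ⟩ := exists_polar_decomposition hGm hG
  refine ⟨P, σ, hP, hσ, hσ1, fun X hX hXc => ?_⟩
  have hXi (i : Fin 2) : ContDiff ℝ ∞ fun x => X x i :=
    (EuclideanSpace.proj (𝕜 := ℝ) i : Plane →L[ℝ] ℝ).contDiff.comp hX
  have hXic (i : Fin 2) : HasCompactSupport fun x => X x i :=
    hXc.comp_left (g := fun p : Plane => p i) rfl
  choose B hB using fun i => (hXic i).exists_bound_of_continuous (hXi i).continuous
  have hXG (i : Fin 2) := hMG i (fun x => X x i) (B i) (hXi i).continuous.measurable (hB i)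
  have hinner (x : Plane) : inner ℝ (X x) (G x) = ∑ i, X x i * G x i := by
    simp only [PiLp.inner_apply, RCLike.inner_apply, conj_trivial, mul_comm]
  rw [hPσ, setIntegral_divergence hb (hX.of_le (by simp))]
  simp_rw [hinner]
  rw [integral_finsetSum _ fun i _ => (hXG i).1]
  exact Finset.sum_congr rfl fun i _ =>
    (hder i _ ((hXi i).of_le (by simp)) (hXic i)).trans (hXG i).2.symm

end FinitePerimeter

section ReducedBoundary

theorem tendsto_average_closedBall {X V : Type*} [PseudoMetricSpace X] [MeasurableSpace X]
    [OpensMeasurableSpace X] [NormedAddCommGroup V] [NormedSpace ℝ V] {P : Measure X} {f : X → V}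
    {x : X} {r : ℝ} {s : ℕ → ℝ} (hs : Monotone s) (hsr : ∀ n, s n < r)
    (hlim : Tendsto s atTop (𝓝 r)) (hf : IntegrableOn f (Metric.ball x r) P)
    (hP : P (Metric.ball x r) ≠ 0) (hP' : P (Metric.ball x r) ≠ ⊤) :
    Tendsto (fun n => ⨍ y in Metric.closedBall x (s n), f y ∂P) atTop
      (𝓝 (⨍ y in Metric.ball x r, f y ∂P)) := by
  have hU : ⋃ n, Metric.closedBall x (s n) = Metric.ball x r := by
    refine Subset.antisymm (iUnion_subset fun n => Metric.closedBall_subset_ball (hsr n)) ?_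
    intro y hy
    obtain ⟨n, hn⟩ := (hlim.eventually (lt_mem_nhds (Metric.mem_ball.1 hy))).exists
    exact mem_iUnion.2 ⟨n, hn.le⟩
  have hmono : Monotone fun n => Metric.closedBall x (s n) := fun n m hnm =>
    Metric.closedBall_subset_closedBall (hs hnm)
  rw [← hU] at hf hP hP' ⊢
  simp_rw [setAverage_eq]
  refine Tendsto.smul (Tendsto.inv₀ ?_ ?_) (tendsto_setIntegral_of_monotone
    (fun n => Metric.isClosed_closedBall.measurableSet) hmono hf)
  · exact (ENNReal.tendsto_toReal hP').comp (tendsto_measure_iUnion_atTop hmono)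
  · exact (ENNReal.toReal_pos hP hP').ne'

theorem IsPolarOfDeriv.ae_mem_reducedBoundary {E : Set Plane} {P : Measure Plane}
    {σ : Plane → Plane} (h : IsPolarOfDeriv E P σ) : ∀ᵐ x ∂P, x ∈ reducedBoundary E := by
  have := h.finite
  have hσ : Integrable σ P := .of_bound h.measurable.aestronglyMeasurable 1
    (h.norm_eq_one.mono fun x hx => hx.le)
  filter_upwards [h.norm_eq_one,
    (Besicovitch.vitaliFamily P).ae_tendsto_average hσ.locallyIntegrable,
    (Besicovitch.vitaliFamily P).ae_eventually_measure_pos] with x hx1 havg hposx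
  replace havg := havg.comp (Besicovitch.tendsto_filterAt P x)
  have hpos (r : ℝ) (hr : 0 < r) : 0 < P (Metric.ball x r) := by
    obtain ⟨s, hs, hsr⟩ := (((Besicovitch.tendsto_filterAt P x).eventually hposx).and
      (Ioo_mem_nhdsGT hr)).exists
    exact hs.trans_le (measure_mono (Metric.closedBall_subset_ball hsr.2))
  refine ⟨σ x, hx1, P, σ, h, hpos, Metric.tendsto_nhds.2 fun ε hε => ?_⟩
  obtain ⟨r₀, hr₀, hsub⟩ := mem_nhdsGT_iff_exists_Ioo_subset.1
    ((Metric.tendsto_nhds.1 havg) (ε / 2) (by positivity))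
  filter_upwards [Ioo_mem_nhdsGT hr₀] with r hr
  obtain ⟨s, hs, hsr, hlim⟩ := exists_seq_strictMono_tendsto' hr.1
  refine lt_of_le_of_lt (le_of_tendsto ((tendsto_average_closedBall hs.monotone
    (fun n => (hsr n).2) hlim hσ.integrableOn (hpos r hr.1).ne' (measure_ne_top _ _)).dist
    tendsto_const_nhds) (Eventually.of_forall fun n => ?_)) (half_lt_self hε)
  exact le_of_lt (hsub ⟨(hsr n).1, (hsr n).2.trans hr.2⟩)

end ReducedBoundary

section Poincare

theorem setLIntegral_comp_add_right_le {G : Type*} [MeasurableSpace G] [AddGroup G]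
    [MeasurableAdd G] {μ : Measure G} [μ.IsAddRightInvariant] (g : G → ℝ≥0∞) {A B : Set G}
    (hA : MeasurableSet A) (hB : MeasurableSet B) {w : G} (hAB : ∀ a ∈ A, a + w ∈ B) :
    ∫⁻ a in A, g (a + w) ∂μ ≤ ∫⁻ b in B, g b ∂μ := by
  rw [← lintegral_indicator hA, ← lintegral_indicator hB,
    ← lintegral_add_right_eq_self (B.indicator g) w]
  refine lintegral_mono fun a => indicator_apply_le' (fun ha => ?_) fun _ => zero_le
  rw [indicator_of_mem (hAB a ha)]

variable {V F : Type*} [NormedAddCommGroup V] [NormedSpace ℝ V] [NormedAddCommGroup F]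
  [NormedSpace ℝ F] [CompleteSpace F] {f : V → F}

theorem enorm_add_sub_le_lintegral_fderiv (hf : ContDiff ℝ 1 f) (a v : V) :
    ‖f (a + v) - f a‖ₑ ≤ ∫⁻ t in Ioc (0 : ℝ) 1, ‖v‖ₑ * ‖fderiv ℝ f (a + t • v)‖ₑ := by
  have hderiv (t : ℝ) :
      HasDerivAt (fun t : ℝ => f (a + t • v)) (fderiv ℝ f (a + t • v) v) t := by
    have hline : HasDerivAt (fun t : ℝ => a + t • v) v t := by
      simpa only [id, one_smul] using ((hasDerivAt_id t).smul_const v).const_add a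
    exact (hf.differentiable one_ne_zero _).hasFDerivAt.comp_hasDerivAt t hline
  have hcont : Continuous fun t : ℝ => fderiv ℝ f (a + t • v) v :=
    ((hf.continuous_fderiv one_ne_zero).comp (by fun_prop)).clm_apply continuous_const
  have hftc := intervalIntegral.integral_eq_sub_of_hasDerivAt (a := 0) (b := 1)
    (fun t _ => hderiv t) (hcont.intervalIntegrable _ _)
  rw [one_smul, zero_smul, add_zero, intervalIntegral.integral_of_le zero_le_one] at hftc
  rw [← hftc]
  refine (enorm_integral_le_lintegral_enorm _).trans (lintegral_mono fun t => ?_)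
  rw [mul_comm]
  exact ContinuousLinearMap.le_opENorm _ _

variable [MeasurableSpace V] [BorelSpace V] [FiniteDimensional ℝ V] {μ : Measure V}
  [μ.IsAddHaarMeasure]

theorem lintegral_enorm_add_sub_le (hf : ContDiff ℝ 1 f) (x v : V) (r : ℝ) :
    ∫⁻ a in Metric.ball x r, ‖f (a + v) - f a‖ₑ ∂μ ≤
      ‖v‖ₑ * ∫⁻ a in Metric.ball x (r + ‖v‖), ‖fderiv ℝ f a‖ₑ ∂μ := by
  have hcont := hf.continuous_fderiv one_ne_zero
  calc ∫⁻ a in Metric.ball x r, ‖f (a + v) - f a‖ₑ ∂μ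
      ≤ ∫⁻ a in Metric.ball x r, (∫⁻ t in Ioc (0 : ℝ) 1,
          ‖v‖ₑ * ‖fderiv ℝ f (a + t • v)‖ₑ) ∂μ :=
        lintegral_mono fun a => enorm_add_sub_le_lintegral_fderiv hf a v
    _ = ∫⁻ t in Ioc (0 : ℝ) 1, ∫⁻ a in Metric.ball x r, ‖v‖ₑ * ‖fderiv ℝ f (a + t • v)‖ₑ ∂μ :=
        lintegral_lintegral_swap (by
          unfold Function.uncurry
          exact (hcont.comp (by fun_prop : Continuous fun p : V × ℝ => p.1 + p.2 • v)).enorm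
            |>.measurable.const_mul _ |>.aemeasurable)
    _ ≤ ∫⁻ _ in Ioc (0 : ℝ) 1, ‖v‖ₑ * ∫⁻ a in Metric.ball x (r + ‖v‖), ‖fderiv ℝ f a‖ₑ ∂μ := by
        refine setLIntegral_mono' measurableSet_Ioc fun t ht => ?_
        rw [lintegral_const_mul' _ _ enorm_ne_top]
        refine mul_le_mul_right ?_ _
        refine setLIntegral_comp_add_right_le (fun a => ‖fderiv ℝ f a‖ₑ) measurableSet_ball
          measurableSet_ball fun a ha => ?_
        have htv : ‖t • v‖ ≤ ‖v‖ := by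
          rw [norm_smul, Real.norm_of_nonneg ht.1.le]
          exact mul_le_of_le_one_left (norm_nonneg _) ht.2
        have htri := dist_triangle (a + t • v) a x
        rw [dist_self_add_left] at htri
        rw [Metric.mem_ball] at ha ⊢
        linarith
    _ = _ := by simp only [lintegral_const, Measure.restrict_apply_univ, Real.volume_Ioc, sub_zero,
          ENNReal.ofReal_one, mul_one]

theorem lintegral_lintegral_enorm_sub_le (hf : ContDiff ℝ 1 f) (x : V) (r : ℝ) :
    ∫⁻ a in Metric.ball x r, ∫⁻ b in Metric.ball x r, ‖f b - f a‖ₑ ∂μ ∂μ ≤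
      ENNReal.ofReal (2 * r) * (∫⁻ a in Metric.ball x (3 * r), ‖fderiv ℝ f a‖ₑ ∂μ) *
        μ (Metric.ball 0 (2 * r)) := by
  have hcont := hf.continuous
  calc ∫⁻ a in Metric.ball x r, ∫⁻ b in Metric.ball x r, ‖f b - f a‖ₑ ∂μ ∂μ
      = ∫⁻ a in Metric.ball x r, ∫⁻ b in Metric.ball x r, ‖f (a + (b + -a)) - f a‖ₑ ∂μ ∂μ := by
        simp only [add_neg_cancel_comm_assoc]
    _ ≤ ∫⁻ a in Metric.ball x r, ∫⁻ v in Metric.ball 0 (2 * r), ‖f (a + v) - f a‖ₑ ∂μ ∂μ := by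
        refine setLIntegral_mono' measurableSet_ball fun a ha =>
          setLIntegral_comp_add_right_le (fun v => ‖f (a + v) - f a‖ₑ) measurableSet_ball
            measurableSet_ball fun b hb => ?_
        rw [mem_ball_zero_iff, ← sub_eq_add_neg, ← dist_eq_norm]
        rw [Metric.mem_ball] at ha hb
        linarith [dist_triangle_right b a x]
    _ = ∫⁻ v in Metric.ball 0 (2 * r), ∫⁻ a in Metric.ball x r, ‖f (a + v) - f a‖ₑ ∂μ ∂μ :=
        lintegral_lintegral_swap (by
          unfold Function.uncurry
          exact (by fun_prop : Continuous fun p : V × V =>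
            f (p.1 + p.2) - f p.1).enorm.measurable.aemeasurable)
    _ ≤ ∫⁻ _ in Metric.ball (0 : V) (2 * r),
          ENNReal.ofReal (2 * r) * ∫⁻ a in Metric.ball x (3 * r), ‖fderiv ℝ f a‖ₑ ∂μ ∂μ := by
        refine setLIntegral_mono' measurableSet_ball fun v hv => ?_
        rw [mem_ball_zero_iff] at hv
        refine (lintegral_enorm_add_sub_le hf x v r).trans (mul_le_mul' ?_ (lintegral_mono_set
          (Metric.ball_subset_ball (by linarith))))
        rw [← ofReal_norm]
        exact ENNReal.ofReal_le_ofReal hv.le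
    _ = _ := setLIntegral_const _ _

end Poincare

section Mollification

variable {V : Type*} [NormedAddCommGroup V] [NormedSpace ℝ V] [FiniteDimensional ℝ V]
  [MeasurableSpace V] [BorelSpace V] (μ : Measure V) [μ.IsAddHaarMeasure]
  (φ : ContDiffBump (0 : V))

/-- The mollification `φ * 1_E` of the set `E`, the bump `φ` being normalized to have integral one
for `μ`. -/
noncomputable def mollify (E : Set V) : V → ℝ :=
  convolution (φ.normed μ) (E.indicator fun _ => (1 : ℝ)) (ContinuousLinearMap.lsmul ℝ ℝ) μ

/-- The density `φ * P` of the mollification of the measure `P`. With `P = |D 1_E|` it dominates the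
gradient of `mollify μ φ E`. -/
noncomputable def mollifyMeasure (P : Measure V) (a : V) : ℝ≥0∞ :=
  ∫⁻ b, ENNReal.ofReal (φ.normed μ (a - b)) ∂P

theorem contDiff_mollify {E : Set V} (hE : MeasurableSet E) : ContDiff ℝ 1 (mollify μ φ E) :=
  φ.hasCompactSupport_normed.contDiff_convolution_left _ φ.contDiff_normed
    ((locallyIntegrable_const 1).indicator hE)

theorem fderiv_mollify_apply {E : Set V} (hE : MeasurableSet E) (a v : V) :
    fderiv ℝ (mollify μ φ E) a v = ∫ b in E, fderiv ℝ (φ.normed μ) (a - b) v ∂μ := by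
  have hsupp : HasCompactSupport (φ.normed μ) := φ.hasCompactSupport_normed
  have hsmooth : ContDiff ℝ 1 (φ.normed μ) := φ.contDiff_normed
  have hint := (locallyIntegrable_const (μ := μ) (1 : ℝ)).indicator hE
  have hconv := (hsupp.fderiv (𝕜 := ℝ)).convolutionExists_left
    (ContinuousLinearMap.precompL V (ContinuousLinearMap.lsmul ℝ ℝ))
    (hsmooth.continuous_fderiv one_ne_zero) hint a
  rw [mollify, (hsupp.hasFDerivAt_convolution_left _ hsmooth hint a).fderiv, convolution_eq_swap,
    ContinuousLinearMap.integral_apply hconv.integrable_swap, ← integral_indicator hE]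
  refine integral_congr_ae (Eventually.of_forall fun b => ?_)
  by_cases hb : b ∈ E <;> simp [ContinuousLinearMap.precompL_apply, hb]

theorem lintegral_mollifyMeasure_ball_le (P : Measure V) [SFinite P] (x : V) (R : ℝ) :
    ∫⁻ a in Metric.ball x R, mollifyMeasure μ φ P a ∂μ ≤
      P (Metric.closedBall x (R + φ.rOut)) := by
  have hcont : Continuous (φ.normed μ) := φ.continuous_normed
  have hmass (b : V) : ∫⁻ a, ENNReal.ofReal (φ.normed μ (a - b)) ∂μ = 1 := by
    rw [lintegral_sub_right_eq_self (fun a => ENNReal.ofReal (φ.normed μ a)) b,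
      ← ofReal_integral_eq_lintegral_ofReal φ.integrable_normed
        (Eventually.of_forall φ.nonneg_normed), φ.integral_normed, ENNReal.ofReal_one]
  have hvanish {a b : V} (ha : a ∈ Metric.ball x R)
      (hb : b ∉ Metric.closedBall x (R + φ.rOut)) : φ.normed μ (a - b) = 0 := by
    rw [← Function.notMem_support, φ.support_normed_eq, mem_ball_zero_iff, not_lt, ← dist_eq_norm]
    rw [Metric.mem_closedBall, not_le] at hb
    rw [Metric.mem_ball] at ha
    linarith [dist_triangle_left b x a]
  calc ∫⁻ a in Metric.ball x R, mollifyMeasure μ φ P a ∂μ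
      = ∫⁻ b, (∫⁻ a in Metric.ball x R, ENNReal.ofReal (φ.normed μ (a - b)) ∂μ) ∂P :=
        lintegral_lintegral_swap (by
          unfold Function.uncurry
          fun_prop)
    _ ≤ ∫⁻ b, (Metric.closedBall x (R + φ.rOut)).indicator 1 b ∂P := by
        refine lintegral_mono fun b => le_indicator_apply
          (fun _ => (setLIntegral_le_lintegral _ _).trans (hmass b).le) fun hb => ?_
        refine le_of_eq ((setLIntegral_congr_fun measurableSet_ball fun a ha => ?_).trans
          lintegral_zero)
        rw [hvanish ha hb, ENNReal.ofReal_zero]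
    _ = P (Metric.closedBall x (R + φ.rOut)) :=
        lintegral_indicator_one Metric.isClosed_closedBall.measurableSet

theorem exists_ae_tendsto_mollify {E : Set V} (hE : MeasurableSet E) {r : ℝ} (hr : 0 < r) :
    ∃ φ : ℕ → ContDiffBump (0 : V), (∀ n, (φ n).rOut ≤ r) ∧
      ∀ᵐ a ∂μ, Tendsto (fun n => mollify μ (φ n) E a) atTop
        (𝓝 (E.indicator (fun _ => (1 : ℝ)) a)) := by
  let φ (n : ℕ) : ContDiffBump (0 : V) :=
    ⟨r / (n + 2) / 2, r / (n + 2), by positivity, half_lt_self (by positivity)⟩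
  have hlim : Tendsto (fun n => (φ n).rOut) atTop (𝓝 0) :=
    (tendsto_natCast_atTop_atTop.atTop_add tendsto_const_nhds).const_div_atTop r
  exact ⟨φ, fun n => div_le_self hr.le (by linarith [n.cast_nonneg (α := ℝ)]),
    ContDiffBump.ae_convolution_tendsto_right_of_locallyIntegrable (K := 2) hlim
      (Eventually.of_forall fun n => (mul_div_cancel₀ (r / (n + 2)) two_ne_zero).ge)
      ((locallyIntegrable_const 1).indicator hE)⟩

end Mollification

section RelativeIsoperimetric

theorem divergence_smul_const {f : Plane → ℝ} {x : Plane} (hf : DifferentiableAt ℝ f x)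
    (v : Plane) : divergence (fun y => f y • v) x = fderiv ℝ f x v := by
  conv_rhs => rw [← (EuclideanSpace.basisFun (Fin 2) ℝ).sum_repr v]
  simp only [divergence, (hf.hasFDerivAt.smul_const v).fderiv, map_sum, map_smul,
    ContinuousLinearMap.smulRight_apply, PiLp.smul_apply, smul_eq_mul,
    EuclideanSpace.basisFun_repr, EuclideanSpace.basisFun_apply, mul_comm]

theorem divergence_comp_const_sub_smul {f : Plane → ℝ} (hf : Differentiable ℝ f) (a v b : Plane) :
    divergence (fun y => f (a - y) • v) b = -fderiv ℝ f (a - b) v := by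
  have hsub : HasFDerivAt (fun y => f (a - y))
      ((fderiv ℝ f (a - b)).comp (-ContinuousLinearMap.id ℝ Plane)) b :=
    (hf (a - b)).hasFDerivAt.comp b ((hasFDerivAt_id b).const_sub a)
  rw [divergence_smul_const hsub.differentiableAt, hsub.fderiv, ContinuousLinearMap.comp_apply,
    neg_apply, ContinuousLinearMap.id_apply, map_neg]

variable {E : Set Plane} {P : Measure Plane} {σ : Plane → Plane}

theorem IsPolarOfDeriv.enorm_fderiv_mollify_le (h : IsPolarOfDeriv E P σ) (hE : MeasurableSet E)
    (φ : ContDiffBump (0 : Plane)) (a : Plane) :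
    ‖fderiv ℝ (mollify volume φ E) a‖ₑ ≤ mollifyMeasure volume φ P a := by
  have hsmooth : ContDiff ℝ ∞ (φ.normed (volume : Measure Plane)) := φ.contDiff_normed
  refine ContinuousLinearMap.opENorm_le_bound _ fun v => ?_
  have hX : ContDiff ℝ ∞ fun b => φ.normed volume (a - b) • v :=
    (hsmooth.comp (contDiff_const.sub contDiff_id)).smul contDiff_const
  have hXc : HasCompactSupport fun b => φ.normed volume (a - b) • v :=
    (φ.hasCompactSupport_normed.comp_homeomorph (Homeomorph.subLeft a)).smul_right
  have hdiv := h.integral_div _ hX hXc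
  simp_rw [divergence_comp_const_sub_smul (hsmooth.differentiable (by simp)) a v] at hdiv
  rw [integral_neg, ← fderiv_mollify_apply volume φ hE] at hdiv
  rw [← enorm_neg, hdiv, mul_comm, mollifyMeasure, ← lintegral_const_mul' _ _ enorm_ne_top]
  refine (enorm_integral_le_lintegral_enorm _).trans (lintegral_mono_ae ?_)
  filter_upwards [h.norm_eq_one] with b hb
  rw [inner_smul_left, enorm_mul, mul_comm ‖v‖ₑ]
  refine mul_le_mul' (Real.enorm_of_nonneg (φ.nonneg_normed _)).le ?_
  rw [← ofReal_norm, ← ofReal_norm]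
  refine ENNReal.ofReal_le_ofReal ((norm_inner_le_norm _ _).trans ?_)
  rw [hb, mul_one]

theorem IsPolarOfDeriv.lintegral_lintegral_mollify_le (h : IsPolarOfDeriv E P σ)
    (hE : MeasurableSet E) {φ : ContDiffBump (0 : Plane)} {r : ℝ} (hφ : φ.rOut ≤ r) (x : Plane) :
    ∫⁻ a in Metric.ball x r, ∫⁻ b in Metric.ball x r,
        ‖mollify volume φ E b - mollify volume φ E a‖ₑ ≤
      ENNReal.ofReal (2 * r) * P (Metric.closedBall x (4 * r)) *
        volume (Metric.ball (0 : Plane) (2 * r)) := by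
  have := h.finite
  refine (lintegral_lintegral_enorm_sub_le (contDiff_mollify volume φ hE) x r).trans ?_
  gcongr
  calc ∫⁻ a in Metric.ball x (3 * r), ‖fderiv ℝ (mollify volume φ E) a‖ₑ
      ≤ ∫⁻ a in Metric.ball x (3 * r), mollifyMeasure volume φ P a :=
        lintegral_mono fun a => h.enorm_fderiv_mollify_le hE φ a
    _ ≤ P (Metric.closedBall x (3 * r + φ.rOut)) := lintegral_mollifyMeasure_ball_le _ φ P x _
    _ ≤ P (Metric.closedBall x (4 * r)) :=
        measure_mono (Metric.closedBall_subset_closedBall (by linarith))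

theorem lintegral_lintegral_enorm_sub_le_liminf {α F : Type*} [MeasurableSpace α]
    [NormedAddCommGroup F] [MeasurableSpace F] [OpensMeasurableSpace F] [MeasurableSub₂ F]
    {μ : Measure α} [SFinite μ] {f : ℕ → α → F} {g : α → F} (hf : ∀ n, Measurable (f n))
    (hlim : ∀ᵐ a ∂μ, Tendsto (fun n => f n a) atTop (𝓝 (g a))) :
    ∫⁻ a, ∫⁻ b, ‖g b - g a‖ₑ ∂μ ∂μ ≤
      liminf (fun n => ∫⁻ a, ∫⁻ b, ‖f n b - f n a‖ₑ ∂μ ∂μ) atTop := by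
  have hmeas (n : ℕ) : Measurable fun p : α × α => ‖f n p.2 - f n p.1‖ₑ :=
    (((hf n).comp measurable_snd).sub ((hf n).comp measurable_fst)).enorm
  refine (lintegral_mono_ae (hlim.mono fun a ha => ?_)).trans
    (lintegral_liminf_le fun n => (hmeas n).lintegral_prod_right')
  refine (lintegral_congr_ae (hlim.mono fun b hb => ?_)).trans_le
    (lintegral_liminf_le fun n => (hmeas n).comp measurable_prodMk_left)
  exact ((hb.sub ha).enorm.liminf_eq).symm

theorem measure_mul_measure_le_lintegral_indicator {α : Type*} [MeasurableSpace α]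
    {μ : Measure α} {E B : Set α} (hE : MeasurableSet E) (hB : MeasurableSet B) :
    μ (E ∩ B) * μ (B \ E) ≤
      ∫⁻ a in B, ∫⁻ b in B, ‖E.indicator (fun _ => (1 : ℝ)) b -
        E.indicator (fun _ => (1 : ℝ)) a‖ₑ ∂μ ∂μ :=
  calc μ (E ∩ B) * μ (B \ E) = ∫⁻ _ in E ∩ B, ∫⁻ _ in B \ E, 1 ∂μ ∂μ := by
        rw [setLIntegral_one, setLIntegral_const, mul_comm]
    _ ≤ ∫⁻ a in E ∩ B, ∫⁻ b in B, ‖E.indicator (fun _ => (1 : ℝ)) b -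
          E.indicator (fun _ => (1 : ℝ)) a‖ₑ ∂μ ∂μ := by
        refine setLIntegral_mono' (hE.inter hB) fun a ha => le_trans
          (setLIntegral_mono' (hB.diff hE) fun b hb => ?_) (lintegral_mono_set sdiff_subset)
        rw [indicator_of_mem ha.1, indicator_of_notMem hb.2, zero_sub, enorm_neg, enorm_one]
    _ ≤ _ := lintegral_mono_set inter_subset_right

theorem IsPolarOfDeriv.volume_inter_mul_volume_sdiff_le (h : IsPolarOfDeriv E P σ)
    (hE : MeasurableSet E) (x : Plane) {r : ℝ} (hr : 0 < r) :
    volume (E ∩ Metric.ball x r) * volume (Metric.ball x r \ E) ≤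
      ENNReal.ofReal (2 * r) * P (Metric.closedBall x (4 * r)) *
        volume (Metric.ball (0 : Plane) (2 * r)) := by
  obtain ⟨φ, hφ, hlim⟩ := exists_ae_tendsto_mollify volume hE hr
  refine (measure_mul_measure_le_lintegral_indicator hE measurableSet_ball).trans
    ((lintegral_lintegral_enorm_sub_le_liminf
      (fun n => (contDiff_mollify volume (φ n) hE).continuous.measurable)
      (ae_restrict_of_ae hlim)).trans ?_)
  exact (liminf_le_liminf (Eventually.of_forall fun n =>
    h.lintegral_lintegral_mollify_le hE (hφ n) x)).trans_eq (liminf_const _)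

end RelativeIsoperimetric

section Federer

theorem tendsto_zero_or_one_of_tendsto_mul_one_sub {d : ℝ → ℝ} (hd : ContinuousOn d (Ioi 0))
    (hlim : Tendsto (fun r => d r * (1 - d r)) (𝓝[>] 0) (𝓝 0)) :
    Tendsto d (𝓝[>] 0) (𝓝 0) ∨ Tendsto d (𝓝[>] 0) (𝓝 1) := by
  obtain ⟨r₀, hr₀, hne⟩ := mem_nhdsGT_iff_exists_Ioo_subset.1
    (hlim.eventually (gt_mem_nhds (by norm_num : (0 : ℝ) < 1 / 4)))
  have hnear : ∀ᶠ r in 𝓝[>] (0 : ℝ), r ∈ Ioo 0 r₀ := Ioo_mem_nhdsGT hr₀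
  -- On `(0, r₀)` the continuous function `d` avoids the value `1 / 2`.
  have hside : (∀ r ∈ Ioo 0 r₀, d r ≤ 1 / 2) ∨ ∀ r ∈ Ioo 0 r₀, 1 / 2 ≤ d r := by
    by_contra! hcross
    obtain ⟨⟨a, ha, hda⟩, b, hb, hdb⟩ := hcross
    obtain ⟨c, hc, hdc⟩ := isPreconnected_Ioo.intermediate_value hb ha
      (hd.mono Ioo_subset_Ioi_self) ⟨hdb.le, hda.le⟩
    have hlt : d c * (1 - d c) < 1 / 4 := hne hc
    norm_num [hdc] at hlt
  have hbound : Tendsto (fun r => 2 * |d r * (1 - d r)|) (𝓝[>] 0) (𝓝 0) := by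
    simpa only [abs_zero, mul_zero] using hlim.abs.const_mul 2
  refine hside.imp (fun hle => squeeze_zero_norm' ?_ hbound) fun hge =>
    tendsto_sub_nhds_zero_iff.1 (squeeze_zero_norm' ?_ hbound)
  · filter_upwards [hnear] with r hr
    rw [Real.norm_eq_abs, abs_mul, abs_of_nonneg (by linarith [hle r hr] : 0 ≤ 1 - d r)]
    nlinarith [hle r hr, abs_nonneg (d r)]
  · filter_upwards [hnear] with r hr
    rw [Real.norm_eq_abs, abs_mul, abs_of_nonneg (by linarith [hge r hr] : 0 ≤ d r), abs_sub_comm]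
    nlinarith [hge r hr, abs_nonneg (1 - d r)]

theorem abs_measureReal_inter_sub_le {α : Type*} [MeasurableSpace α] {μ : Measure α}
    (E : Set α) {A B : Set α} (hAB : A ⊆ B) (hA : MeasurableSet A) (hB : μ B ≠ ⊤) :
    |μ.real (E ∩ B) - μ.real (E ∩ A)| ≤ μ.real B - μ.real A := by
  have hmono : μ.real (E ∩ A) ≤ μ.real (E ∩ B) :=
    measureReal_mono (inter_subset_inter_right _ hAB)
      (measure_ne_top_of_subset inter_subset_right hB)
  rw [abs_of_nonneg (sub_nonneg.2 hmono), ← measureReal_sdiff hAB hA hB, sub_le_iff_le_add',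
    ← measureReal_inter_add_sdiff hA (measure_ne_top_of_subset inter_subset_right hB),
    inter_assoc, inter_eq_right.2 hAB]
  exact (add_le_add_iff_left _).2 (measureReal_mono (sdiff_subset_sdiff_left inter_subset_right)
    (measure_ne_top_of_subset sdiff_subset hB))

section MeasureBalls

theorem measureReal_ball_pos {X : Type*} [PseudoMetricSpace X] [ProperSpace X]
    [MeasurableSpace X] (μ : Measure X) [IsFiniteMeasureOnCompacts μ] [μ.IsOpenPosMeasure] (x : X)
    {r : ℝ} (hr : 0 < r) : 0 < μ.real (Metric.ball x r) :=
  ENNReal.toReal_pos (Metric.measure_ball_pos μ x hr).ne' measure_ball_lt_top.ne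

variable {V : Type*} [NormedAddCommGroup V] [NormedSpace ℝ V] [FiniteDimensional ℝ V]
  [MeasurableSpace V] [BorelSpace V] (μ : Measure V) [μ.IsAddHaarMeasure]

theorem measureReal_ball_eq_pow_mul (x : V) {r : ℝ} (hr : 0 < r) :
    μ.real (Metric.ball x r) = r ^ Module.finrank ℝ V * μ.real (Metric.ball 0 1) := by
  rw [measureReal_def, Measure.addHaar_ball_of_pos μ x hr, ENNReal.toReal_mul,
    ENNReal.toReal_ofReal (by positivity), measureReal_def]

theorem continuousOn_measureReal_inter_ball (E : Set V) (x : V) :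
    ContinuousOn (fun r => μ.real (E ∩ Metric.ball x r)) (Ioi 0) := by
  have hcont : ContinuousOn (fun r => μ.real (Metric.ball x r)) (Ioi 0) :=
    ContinuousOn.congr (by fun_prop) fun r hr => measureReal_ball_eq_pow_mul μ x hr
  intro r hr
  refine tendsto_sub_nhds_zero_iff.1 (squeeze_zero_norm'
    (a := fun s => |μ.real (Metric.ball x s) - μ.real (Metric.ball x r)|) ?_ ?_)
  · refine Eventually.of_forall fun s => ?_
    rcases le_total r s with hrs | hsr
    · exact (abs_measureReal_inter_sub_le E (Metric.ball_subset_ball hrs) measurableSet_ball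
        measure_ball_lt_top.ne).trans (le_abs_self _)
    · rw [Real.norm_eq_abs, abs_sub_comm, abs_sub_comm (μ.real (Metric.ball x s))]
      exact (abs_measureReal_inter_sub_le E (Metric.ball_subset_ball hsr) measurableSet_ball
        measure_ball_lt_top.ne).trans (le_abs_self _)
  · simpa only [sub_self, abs_zero] using
      ((hcont r hr).sub_const (μ.real (Metric.ball x r))).abs

end MeasureBalls

theorem mem_densityPoints_of_tendsto {E : Set Plane} {x : Plane} {θ : ℝ}
    (h : Tendsto (fun r : ℝ => volume.real (E ∩ Metric.ball x r) / volume.real (Metric.ball x r))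
      (𝓝[>] 0) (𝓝 θ)) : x ∈ densityPoints E (ENNReal.ofReal θ) := by
  refine (ENNReal.tendsto_ofReal h).congr' ?_
  filter_upwards [self_mem_nhdsWithin] with r hr
  have hfin : volume (Metric.ball x r) ≠ ⊤ := measure_ball_lt_top.ne
  rw [ENNReal.ofReal_div_of_pos (measureReal_ball_pos volume x hr), ofReal_measureReal
    (measure_ne_top_of_subset inter_subset_right hfin), ofReal_measureReal hfin]

variable {E : Set Plane} {P : Measure Plane} {σ : Plane → Plane}

theorem IsPolarOfDeriv.density_mul_one_sub_le (h : IsPolarOfDeriv E P σ) (hE : MeasurableSet E)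
    (x : Plane) {r t : ℝ} (hr : 0 < r)
    (ht : 0 ≤ t) (hP : P (Metric.closedBall x (4 * r)) ≤ ENNReal.ofReal (t * (4 * r))) :
    volume.real (E ∩ Metric.ball x r) / volume.real (Metric.ball x r) *
        (1 - volume.real (E ∩ Metric.ball x r) / volume.real (Metric.ball x r)) ≤
      32 * t / volume.real (Metric.ball (0 : Plane) 1) := by
  have hfin : volume (Metric.ball x r) ≠ ⊤ := measure_ball_lt_top.ne
  have hκ := measureReal_ball_pos volume (0 : Plane) one_pos
  have hsplit : volume.real (Metric.ball x r \ E) =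
      volume.real (Metric.ball x r) - volume.real (E ∩ Metric.ball x r) := by
    rw [inter_comm, ← measureReal_inter_add_sdiff hE hfin, add_sub_cancel_left]
  have hprod : volume.real (E ∩ Metric.ball x r) * volume.real (Metric.ball x r \ E) ≤
      2 * r * (t * (4 * r)) * volume.real (Metric.ball (0 : Plane) (2 * r)) := by
    have hle : volume (E ∩ Metric.ball x r) * volume (Metric.ball x r \ E) ≤
        ENNReal.ofReal (2 * r * (t * (4 * r))) * volume (Metric.ball (0 : Plane) (2 * r)) := by
      rw [ENNReal.ofReal_mul (by positivity)]
      exact (h.volume_inter_mul_volume_sdiff_le hE x hr).trans (by gcongr)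
    have hreal := ENNReal.toReal_mono
      (ENNReal.mul_ne_top ENNReal.ofReal_ne_top measure_ball_lt_top.ne) hle
    rwa [ENNReal.toReal_mul, ENNReal.toReal_mul, ENNReal.toReal_ofReal (by positivity)] at hreal
  have hball (y : Plane) {s : ℝ} (hs : 0 < s) :
      volume.real (Metric.ball y s) = s ^ 2 * volume.real (Metric.ball (0 : Plane) 1) := by
    rw [measureReal_ball_eq_pow_mul volume y hs, finrank_euclideanSpace_fin]
  rw [hsplit, hball 0 (by positivity), hball x hr] at hprod
  rw [hball x hr, one_sub_div (by positivity), div_mul_div_comm,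
    div_le_div_iff₀ (by positivity) hκ]
  calc _ ≤ 2 * r * (t * (4 * r)) * ((2 * r) ^ 2 * volume.real (Metric.ball (0 : Plane) 1)) *
        volume.real (Metric.ball (0 : Plane) 1) := mul_le_mul_of_nonneg_right hprod hκ.le
    _ = _ := by ring

theorem IsPolarOfDeriv.mem_densityPoints_zero_or_one (h : IsPolarOfDeriv E P σ)
    (hE : MeasurableSet E) {x : Plane}
    (hx : ∀ t > 0, ∀ᶠ r in 𝓝[>] (0 : ℝ), P (Metric.closedBall x r) ≤ ENNReal.ofReal (t * r)) :
    x ∈ densityPoints E 0 ∨ x ∈ densityPoints E 1 := by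
  have hκ := measureReal_ball_pos volume (0 : Plane) one_pos
  let d (r : ℝ) : ℝ := volume.real (E ∩ Metric.ball x r) / volume.real (Metric.ball x r)
  have hd0 (r : ℝ) : 0 ≤ d r := div_nonneg measureReal_nonneg measureReal_nonneg
  have hd1 (r : ℝ) : d r ≤ 1 := div_le_one_of_le₀
    (measureReal_mono inter_subset_right measure_ball_lt_top.ne) measureReal_nonneg
  have hcont : ContinuousOn d (Ioi 0) :=
    (continuousOn_measureReal_inter_ball volume E x).div
      (by simpa only [univ_inter] using continuousOn_measureReal_inter_ball volume univ x)
      fun r hr => (measureReal_ball_pos volume x hr).ne'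
  have hlim : Tendsto (fun r => d r * (1 - d r)) (𝓝[>] 0) (𝓝 0) := by
    refine Metric.tendsto_nhds.2 fun ε hε => ?_
    filter_upwards [eventually_nhdsGT_zero_mul_left four_pos
      (hx (ε * volume.real (Metric.ball (0 : Plane) 1) / 64) (by positivity)),
      self_mem_nhdsWithin] with r hr hr0
    rw [Real.dist_0_eq_abs, abs_of_nonneg (mul_nonneg (hd0 r) (sub_nonneg.2 (hd1 r)))]
    refine (h.density_mul_one_sub_le hE x hr0 (by positivity) hr).trans_lt ?_
    rw [div_lt_iff₀ hκ]
    nlinarith [mul_pos hε hκ]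
  rcases tendsto_zero_or_one_of_tendsto_mul_one_sub hcont hlim with h0 | h1
  · exact Or.inl (ENNReal.ofReal_zero ▸ mem_densityPoints_of_tendsto h0)
  · exact Or.inr (ENNReal.ofReal_one ▸ mem_densityPoints_of_tendsto h1)

theorem IsPolarOfDeriv.ae_mem_reducedBoundary_or_densityPoints (h : IsPolarOfDeriv E P σ)
    (hE : MeasurableSet E) :
    ∀ᵐ x ∂H1, x ∈ reducedBoundary E ∨ x ∈ densityPoints E 0 ∨ x ∈ densityPoints E 1 := by
  have := h.finite
  filter_upwards [ae_density_eq_zero_of_null h.ae_mem_reducedBoundary] with x hx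
  by_cases hxr : x ∈ reducedBoundary E
  · exact Or.inl hxr
  · exact Or.inr (h.mem_densityPoints_zero_or_one hE (hx hxr))

end Federer

section FilmPerimeter

theorem volume_le_lintegral_section {A : Set Plane} (hA : MeasurableSet A) {f : ℝ → ℝ≥0∞}
    (hf : ∀ x : ℝ, volume {y : ℝ | !₂[x, y] ∈ A} ≤ f x) : volume A ≤ ∫⁻ x, f x := by
  have hcoord : MeasurePreserving (fun q : ℝ × ℝ => (!₂[q.1, q.2] : Plane)) volume volume :=
    (PiLp.volume_preserving_toLp (Fin 2)).comp (volume_preserving_finTwoArrow ℝ).symm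
  rw [← hcoord.measure_preimage hA.nullMeasurableSet, Measure.volume_eq_prod,
    Measure.prod_apply (hcoord.measurable hA)]
  exact lintegral_mono hf

theorem integral_sub_translate_le {W : ℝ → ℝ} (hW : Monotone W) {a b δ : ℝ} (hδ : δ ∈ Ioc 0 1) :
    ∫ x in a..b, (W x - W (x - δ)) ≤ δ * (W b - W (a - 1)) := by
  have hint (c d : ℝ) : IntervalIntegrable W volume c d := hW.intervalIntegrable
  have hWδ : Monotone fun x => W (x - δ) := fun x y hxy => hW (by linarith)
  have hright : ∫ x in b - δ..b, W x ≤ ∫ _ in b - δ..b, W b :=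
    intervalIntegral.integral_mono_on (by linarith [hδ.1]) (hint _ _) intervalIntegrable_const
      fun x hx => hW hx.2
  have hleft : ∫ _ in a - δ..a, W (a - 1) ≤ ∫ x in a - δ..a, W x :=
    intervalIntegral.integral_mono_on (by linarith [hδ.1]) intervalIntegrable_const (hint _ _)
      fun x hx => hW (by linarith [hx.1, hδ.2])
  rw [intervalIntegral.integral_const, sub_sub_cancel, smul_eq_mul] at hright hleft
  rw [intervalIntegral.integral_sub (hint _ _) hWδ.intervalIntegrable,
    intervalIntegral.integral_comp_sub_right (fun x => W x) δ,
    intervalIntegral.integral_interval_sub_interval_comm' (hint _ _) (hint _ _) (hint _ _)]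
  linarith

theorem lintegral_ofReal_sub_translate_le {W : ℝ → ℝ} (hW : Monotone W) {a b δ : ℝ} (hab : a ≤ b)
    (hδ : δ ∈ Ioc 0 1) : ∫⁻ x in Icc a b, ENNReal.ofReal (W x - W (x - δ)) ≤
      ENNReal.ofReal (δ * (W b - W (a - 1))) := by
  have hWδ : Monotone fun x => W (x - δ) := fun x y hxy => hW (by linarith)
  have hint : IntervalIntegrable (fun x => W x - W (x - δ)) volume a b :=
    hW.intervalIntegrable.sub hWδ.intervalIntegrable
  have hnonneg (x : ℝ) : 0 ≤ W x - W (x - δ) := sub_nonneg.2 (hW (by linarith [hδ.1]))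
  rw [← restrict_Ioc_eq_restrict_Icc,
    ← ofReal_integral_eq_lintegral_ofReal hint.1 (Eventually.of_forall hnonneg),
    ← intervalIntegral.integral_of_le hab]
  exact ENNReal.ofReal_le_ofReal (integral_sub_translate_le hW hδ)

variable {l L : ℝ} {h : ℝ → ℝ} {K : Set Plane}

theorem exists_monotone_increments (hl : 0 < l) (hh : IsAdmissibleHeight l L h) :
    ∃ W : ℝ → ℝ, Monotone W ∧
      (∀ x ∈ Icc (-l) l, ∀ y ∈ Icc (-l) l, y ≤ x → h x - h y ≤ W x - W y) ∧
      ∀ x ∈ Icc (-l) l, ∀ y < -l, h x + L ≤ W x - W y := by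
  have hbv : BoundedVariationOn (h ∘ fun x => max (-l) (min l x)) univ := by
    refine ne_top_of_le_ne_top hh.variation (eVariationOn.comp_le_of_monotoneOn _ _ ?_ ?_)
    · exact fun x _ y _ hxy => max_le_max le_rfl (min_le_min le_rfl hxy)
    · exact fun x _ => ⟨le_max_left _ _, max_le (by linarith) (min_le_left _ _)⟩
  obtain ⟨p, q, hp, hq, hpq⟩ := hbv.locallyBoundedVariationOn.exists_monotoneOn_sub_monotoneOn
  rw [monotoneOn_univ] at hp hq
  have hh_eq (x : ℝ) (hx : x ∈ Icc (-l) l) : h x = p x - q x := by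
    simpa [hx.1, hx.2] using congrFun hpq x
  -- The jump at `-l` accounts for the left side of the film.
  refine ⟨fun x => p x + if -l ≤ x then 2 * L else 0, fun x y hxy => ?_, fun x hx y hy hyx => ?_,
    fun x hx y hy => ?_⟩
  · have hL : 0 ≤ L := nonempty_Icc.1 ⟨_, hh.mapsTo (left_mem_Icc.2 (by linarith : -l ≤ l))⟩
    refine add_le_add (hp hxy) ?_
    split_ifs <;> linarith
  · simp only [hx.1, hy.1, if_true]
    rw [hh_eq x hx, hh_eq y hy]
    linarith [hq hyx]
  · simp only [hx.1, if_true, not_le.2 hy, if_false]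
    linarith [hp (hy.le.trans hx.1), (hh.mapsTo hx).2]

theorem volume_film_sdiff_preimage_sub_le (hl : 0 < l) (husc : UpperSemicontinuousOn h (Icc (-l) l))
    (v : Plane) {f : ℝ → ℝ≥0∞}
    (hf : ∀ x ∈ Icc (-l) l, volume {y : ℝ | y ∈ Icc (-L) (h x) ∧
      (x - v 0 ∈ Icc (-l) l → y - v 1 ∉ Icc (-L) (h (x - v 0)))} ≤ f x) :
    volume (film l L h \ (fun p => p - v) ⁻¹' film l L h) ≤ ∫⁻ x in Icc (-l) l, f x := by
  have hfilm : MeasurableSet (film l L h) := (isClosed_film husc).measurableSet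
  rw [← lintegral_indicator measurableSet_Icc]
  refine volume_le_lintegral_section (hfilm.diff (measurable_sub_const v hfilm)) fun x => ?_
  by_cases hx : x ∈ Icc (-l) l
  · rw [indicator_of_mem hx]
    refine (measure_mono fun y hy => ?_).trans (hf x hx)
    simpa [mem_film hl, hx.1, hx.2] using hy
  · rw [indicator_of_notMem hx, nonpos_iff_eq_zero]
    refine measure_mono_null (fun y hy => hx ?_) measure_empty
    simpa using ((mem_film hl).1 hy.1).1

theorem volume_film_sdiff_horizontal_le (hl : 0 < l) (hh : IsAdmissibleHeight l L h) :
    ∃ C : ℝ, 0 ≤ C ∧ ∀ δ ∈ Ioc (0 : ℝ) 1,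
      volume (film l L h \
          (fun p => p - δ • EuclideanSpace.single 0 (1 : ℝ)) ⁻¹' film l L h) ≤
        ENNReal.ofReal (C * δ) := by
  obtain ⟨W, hW, hWin, hWout⟩ := exists_monotone_increments hl hh
  refine ⟨W l - W (-l - 1), sub_nonneg.2 (hW (by linarith)), fun δ hδ => ?_⟩
  rw [mul_comm]
  refine (volume_film_sdiff_preimage_sub_le hl hh.usc _ fun x hx => ?_).trans
    (lintegral_ofReal_sub_translate_le hW (by linarith) hδ)
  rcases lt_or_ge (x - δ) (-l) with hlt | hge
  · refine (measure_mono (t := Icc (-L) (h x)) fun y hy => hy.1).trans ?_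
    rw [Real.volume_Icc]
    exact ENNReal.ofReal_le_ofReal (by linarith [hWout x hx _ hlt])
  · have hxδ : x - δ ∈ Icc (-l) l := ⟨hge, by linarith [hδ.1, hx.2]⟩
    refine (measure_mono (t := Icc (h (x - δ)) (h x)) ?_).trans ?_
    · rintro y ⟨hy, hyδ⟩
      simp only [PiLp.smul_apply, PiLp.single_apply, if_true, one_ne_zero, if_false,
        smul_eq_mul, mul_one, mul_zero, sub_zero, mem_Icc, not_and, not_le] at hyδ
      exact ⟨(hyδ hxδ hy.1).le, hy.2⟩
    · rw [Real.volume_Icc]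
      exact ENNReal.ofReal_le_ofReal (hWin x hx _ hxδ (by linarith [hδ.1]))

theorem volume_film_sdiff_vertical_le (hl : 0 < l) (husc : UpperSemicontinuousOn h (Icc (-l) l))
    {δ : ℝ} (hδ : 0 < δ) :
    volume (film l L h \ (fun p => p - δ • EuclideanSpace.single 1 (1 : ℝ)) ⁻¹' film l L h) ≤
      ENNReal.ofReal (2 * l * δ) := by
  have hsection : ∫⁻ _ in Icc (-l) l, ENNReal.ofReal δ = ENNReal.ofReal (2 * l * δ) := by
    rw [setLIntegral_const, Real.volume_Icc, ← ENNReal.ofReal_mul hδ.le]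
    congr 1
    ring
  rw [← hsection]
  refine volume_film_sdiff_preimage_sub_le hl husc _ fun x hx => ?_
  refine (measure_mono (t := Icc (-L) (-L + δ)) ?_).trans ?_
  · rintro y ⟨hy, hyδ⟩
    simp only [PiLp.smul_apply, PiLp.single_apply, if_true, zero_ne_one, if_false,
      smul_eq_mul, mul_one, mul_zero, sub_zero, mem_Icc, not_and, not_le] at hyδ
    refine ⟨hy.1, ?_⟩
    by_contra! hlt
    linarith [hyδ hx (by linarith), hy.2]
  · rw [Real.volume_Icc, add_sub_cancel_left]

theorem IsAdmissiblePair.measurableSet_region (hp : IsAdmissiblePair l L h K) :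
    MeasurableSet (region l L h K) := by
  rw [region_eq_film_sdiff]
  exact (isClosed_film hp.height.usc).measurableSet.diff hp.crack.closed.measurableSet

theorem IsAdmissiblePair.volume_region_sdiff_preimage_sub_le (hp : IsAdmissiblePair l L h K)
    (v : Plane) : volume (region l L h K \ (fun p => p - v) ⁻¹' region l L h K) ≤
      volume (film l L h \ (fun p => p - v) ⁻¹' film l L h) := by
  have hK : volume K = 0 :=
    addHaar_eq_zero_of_hausdorffMeasure_lt_top volume
      (by rw [finrank_euclideanSpace_fin]; norm_num) hp.crack.rectifiable.1
  have hKv : volume ((fun p => p - v) ⁻¹' K) = 0 := by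
    rw [(measurePreserving_sub_right volume v).measure_preimage
      hp.crack.closed.measurableSet.nullMeasurableSet, hK]
  rw [region_eq_film_sdiff, ← measure_sdiff_null hKv]
  refine measure_mono ?_
  rintro x ⟨⟨hx, hxv⟩, hxK⟩
  exact ⟨hx.1, fun hxv' => hxv ⟨hxv', hxK⟩⟩

theorem IsAdmissiblePair.exists_isPolarOfDeriv (hl : 0 < l) (hp : IsAdmissiblePair l L h K) :
    ∃ (P : Measure Plane) (σ : Plane → Plane), IsPolarOfDeriv (region l L h K) P σ := by
  have hbdd : Bornology.IsBounded (region l L h K) := by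
    rw [region_eq_film_sdiff]
    exact (isCompact_box l L).isBounded.subset
      (sdiff_subset.trans (film_subset_box hl hp.height.mapsTo))
  obtain ⟨C, hC, hhor⟩ := volume_film_sdiff_horizontal_le hl hp.height
  refine FilmLayers.exists_isPolarOfDeriv hp.measurableSet_region hbdd (C := C + 2 * l)
    fun i δ hδ => (hp.volume_region_sdiff_preimage_sub_le _).trans ?_
  fin_cases i
  · exact (hhor δ hδ).trans (ENNReal.ofReal_le_ofReal (by nlinarith [hδ.1]))
  · exact (volume_film_sdiff_vertical_le hl hp.height.usc hδ.1).trans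
      (ENNReal.ofReal_le_ofReal (by nlinarith [hδ.1]))

theorem IsAdmissiblePair.ae_mem_reducedBoundary_or_densityPoints (hl : 0 < l)
    (hp : IsAdmissiblePair l L h K) :
    ∀ᵐ x ∂H1, x ∈ reducedBoundary (region l L h K) ∨ x ∈ densityPoints (region l L h K) 0 ∨
      x ∈ densityPoints (region l L h K) 1 := by
  obtain ⟨P, σ, hP⟩ := hp.exists_isPolarOfDeriv hl
  exact hP.ae_mem_reducedBoundary_or_densityPoints hp.measurableSet_region

end FilmPerimeter

section LengthBound

theorem norm_unitNormal (E : Set Plane) (x : Plane) : ‖unitNormal E x‖ = 1 := by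
  unfold unitNormal
  split_ifs with houter happrox
  · exact houter.choose_spec.1
  · exact happrox.choose_spec.1
  · simp

theorem mem_densityPoints_one_of_mem_interior {E : Set Plane} {x : Plane} (hx : x ∈ interior E) :
    x ∈ densityPoints E 1 := by
  obtain ⟨ε, hε, hsub⟩ := Metric.isOpen_iff.1 isOpen_interior x hx
  refine tendsto_const_nhds.congr' ?_
  filter_upwards [Ioo_mem_nhdsGT hε] with r hr
  rw [inter_eq_self_of_subset_right
    ((Metric.ball_subset_ball hr.2.le).trans (hsub.trans interior_subset)),
    ENNReal.div_self (Metric.measure_ball_pos _ _ hr.1).ne' measure_ball_lt_top.ne]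

theorem mem_densityPoints_zero_of_notMem_closure {E : Set Plane} {x : Plane}
    (hx : x ∉ closure E) : x ∈ densityPoints E 0 := by
  obtain ⟨ε, hε, hsub⟩ := Metric.isOpen_iff.1 isClosed_closure.isOpen_compl x hx
  refine tendsto_const_nhds.congr' ?_
  filter_upwards [Ioo_mem_nhdsGT hε] with r hr
  have hdisj : Disjoint E (Metric.ball x r) :=
    disjoint_compl_right.mono subset_closure ((Metric.ball_subset_ball hr.2.le).trans hsub)
  rw [hdisj.inter_eq, measure_empty, ENNReal.zero_div]

section Density

variable {S₁ S₀ : Set Plane} {x : Plane}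

theorem mem_densityPoints_zero_or_mem_frontier (hInt : frontier S₁ ∩ interior S₀ = ∅)
    (hx : x ∈ frontier S₁) : x ∈ densityPoints S₀ 0 ∨ x ∈ frontier S₀ := by
  by_cases hcl : x ∈ closure S₀
  · exact Or.inr ⟨hcl, fun hint => eq_empty_iff_forall_notMem.1 hInt x ⟨hx, hint⟩⟩
  · exact Or.inl (mem_densityPoints_zero_of_notMem_closure hcl)

theorem mem_densityPoints_one_of_mem_frontier_sdiff (hcl : closure S₀ ⊆ closure S₁)
    (hx : x ∈ frontier S₀ \ frontier S₁) : x ∈ densityPoints S₁ 1 := by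
  refine mem_densityPoints_one_of_mem_interior ?_
  by_contra hint
  exact hx.2 ⟨hcl hx.1.1, hint⟩

theorem le_density {l L c : ℝ} {φ₀ φ₁ φ₀₁ : Plane → Plane → ℝ} (hc : 0 ≤ c)
    (hφ : ∀ ν, ‖ν‖ = 1 → c ≤ φ₁ x ν ∧ c ≤ φ₀ x ν ∧ c ≤ φ₀₁ x ν)
    (hInt : frontier S₁ ∩ interior S₀ = ∅) (hcl : closure S₀ ⊆ closure S₁)
    (hxΩ : x ∈ Omega l L) (hx : x ∈ frontier S₀ ∪ frontier S₁)
    (ht₁ : x ∈ reducedBoundary S₁ ∨ x ∈ densityPoints S₁ 0 ∨ x ∈ densityPoints S₁ 1)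
    (ht₀ : x ∈ reducedBoundary S₀ ∨ x ∈ densityPoints S₀ 0 ∨ x ∈ densityPoints S₀ 1) :
    c ≤ density l L φ₀ φ₁ φ₀₁ S₁ S₀ x := by
  obtain ⟨hfilm₁, hfilm₀, hfilm₀₁⟩ := hφ (unitNormal S₁ x) (norm_unitNormal S₁ x)
  obtain ⟨-, -, hsubstrate⟩ := hφ (unitNormal S₀ x) (norm_unitNormal S₀ x)
  have hregimeOne : c ≤ regimeOne φ₀ φ₁ φ₀₁ x (unitNormal S₁ x) := le_min hfilm₀ (by linarith)
  have hregimeTwo : c ≤ regimeTwo φ₀ φ₁ x (unitNormal S₁ x) := le_min hfilm₁ hfilm₀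
  have hfrontier₁ (h : x ∈ frontier S₁) := mem_densityPoints_zero_or_mem_frontier hInt h
  have hfrontier₀ (h₀ : x ∈ frontier S₀) (h₁ : x ∉ frontier S₁) :=
    mem_densityPoints_one_of_mem_frontier_sdiff hcl ⟨h₀, h₁⟩
  unfold density
  split_ifs with k₁ k₂ k₃ k₄ k₅ k₆ k₇ k₈
  case neg => -- The eight portions exhaust the frontiers, by the trichotomies at `x`.
    simp only [mem_inter_iff, Set.mem_sdiff, mem_union] at k₁ k₂ k₃ k₄ k₅ k₆ k₇ k₈ hx
    grind only
  all_goals linarith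

end Density

theorem mul_H1_inter_Omega_le_surfaceEnergy {l L c : ℝ} (hl : 0 < l) (hL : 0 < L) (hc : 0 ≤ c)
    {φ₀ φ₁ φ₀₁ : Plane → Plane → ℝ}
    (hφ : ∀ x ∈ Omega l L, ∀ ν, ‖ν‖ = 1 → c ≤ φ₁ x ν ∧ c ≤ φ₀ x ν ∧ c ≤ φ₀₁ x ν)
    {A : Set Plane × Set Plane} (hA : A ∈ B1 l L) :
    ENNReal.ofReal c * H1 ((frontier A.2 ∪ frontier A.1) ∩ Omega l L) ≤
      surfaceEnergy l L φ₀ φ₁ φ₀₁ A := by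
  obtain ⟨h₁, h₀, K₁, K₀, hp₁, hp₀, rfl, hle, hInt⟩ := hA
  have hcl : closure (region l L h₀ K₀) ⊆ closure (region l L h₁ K₁) := by
    rw [hp₁.closure_region hl hL, hp₀.closure_region hl hL]
    exact (film_subset_film_iff hl hL hp₀.height.mapsTo).2 hle
  refine le_trans ?_ (lintegral_mono_set (inter_subset_left (t := Omega l L)))
  rw [← setLIntegral_const]
  refine setLIntegral_mono_ae' ((isClosed_frontier.measurableSet.union
    isClosed_frontier.measurableSet).inter (isOpen_Omega l L).measurableSet) ?_
  filter_upwards [hp₁.ae_mem_reducedBoundary_or_densityPoints hl,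
    hp₀.ae_mem_reducedBoundary_or_densityPoints hl] with x ht₁ ht₀ hx
  exact ENNReal.ofReal_le_ofReal (le_density hc (hφ x hx.2) hInt hcl hx.2 hx.1 ht₁ ht₀)

theorem H1_coord_segment_lt_top {i j : Fin 2} (hij : i ≠ j) (c a b : ℝ) :
    H1 {p : Plane | p i = c ∧ p j ∈ Icc a b} < ⊤ := by
  have hiso : Isometry fun t : ℝ =>
      (EuclideanSpace.single i c + EuclideanSpace.single j t : Plane) :=
    Isometry.of_dist_eq fun s t => by rw [dist_add_left, PiLp.dist_single_same]
  have himage : {p : Plane | p i = c ∧ p j ∈ Icc a b} ⊆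
      (fun t => EuclideanSpace.single i c + EuclideanSpace.single j t) '' Icc a b := by
    rintro p ⟨rfl, hp⟩
    refine ⟨p j, hp, ?_⟩
    ext k
    obtain rfl | rfl : k = i ∨ k = j := by omega
    · simp [hij]
    · simp [hij.symm]
  refine (measure_mono himage).trans_lt ?_
  rw [hiso.hausdorffMeasure_image (Or.inl zero_le_one), hausdorffMeasure_real]
  exact isCompact_Icc.measure_lt_top

theorem H1_box_sdiff_Omega_lt_top (l L : ℝ) :
    H1 ({p : Plane | p 0 ∈ Icc (-l) l ∧ p 1 ∈ Icc (-L) L} \ Omega l L) < ⊤ := by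
  have hsub : {p : Plane | p 0 ∈ Icc (-l) l ∧ p 1 ∈ Icc (-L) L} \ Omega l L ⊆
      ({p : Plane | p 0 = -l ∧ p 1 ∈ Icc (-L) L} ∪ {p : Plane | p 0 = l ∧ p 1 ∈ Icc (-L) L}) ∪
        {p : Plane | p 1 = -L ∧ p 0 ∈ Icc (-l) l} := by
    rintro p ⟨⟨h0, h1⟩, hΩ⟩
    by_contra hcon
    simp only [mem_union, mem_ofPred_eq, not_or, not_and] at hcon
    exact hΩ ⟨⟨lt_of_le_of_ne' h0.1 fun h => hcon.1.1 h h1,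
      lt_of_le_of_ne h0.2 fun h => hcon.1.2 h h1⟩, lt_of_le_of_ne' h1.1 fun h => hcon.2 h h0⟩
  exact (measure_mono hsub).trans_lt (measure_union_lt_top
    (measure_union_lt_top (H1_coord_segment_lt_top zero_ne_one _ _ _)
      (H1_coord_segment_lt_top zero_ne_one _ _ _)) (H1_coord_segment_lt_top one_ne_zero _ _ _))

theorem exists_length_bound {l L c : ℝ} (hl : 0 < l) (hL : 0 < L) (hc : 0 < c)
    {φ₀ φ₁ φ₀₁ : Plane → Plane → ℝ}
    (hφ : ∀ x ∈ Omega l L, ∀ ν, ‖ν‖ = 1 → c ≤ φ₁ x ν ∧ c ≤ φ₀ x ν ∧ c ≤ φ₀₁ x ν)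
    {T : ℝ≥0∞} (hT : T < ⊤) :
    ∃ M : ℝ≥0∞, M < ⊤ ∧ ∀ A ∈ B1 l L, surfaceEnergy l L φ₀ φ₁ φ₀₁ A ≤ T →
      H1 (frontier A.2 ∪ frontier A.1) ≤ M := by
  have hc0 : ENNReal.ofReal c ≠ 0 := (ENNReal.ofReal_pos.2 hc).ne'
  refine ⟨T / ENNReal.ofReal c +
    H1 ({p : Plane | p 0 ∈ Icc (-l) l ∧ p 1 ∈ Icc (-L) L} \ Omega l L),
    ENNReal.add_lt_top.2 ⟨ENNReal.div_lt_top hT.ne hc0, H1_box_sdiff_Omega_lt_top l L⟩,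
    fun A hA hAT => ?_⟩
  rw [← measure_inter_add_sdiff _ (isOpen_Omega l L).measurableSet]
  refine add_le_add ?_ (measure_mono (sdiff_subset_sdiff_left ?_))
  · rw [ENNReal.le_div_iff_mul_le (Or.inl hc0) (Or.inl ENNReal.ofReal_ne_top), mul_comm]
    exact (mul_H1_inter_Omega_le_surfaceEnergy hl hL hc.le hφ hA).trans hAT
  · obtain ⟨h₁, h₀, K₁, K₀, hp₁, hp₀, rfl, -, -⟩ := hA
    exact union_subset
      ((hp₀.frontier_region_subset_film hl hL).trans (film_subset_box hl hp₀.height.mapsTo))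
      ((hp₁.frontier_region_subset_film hl hL).trans (film_subset_box hl hp₁.height.mapsTo))

theorem AdmissibleTensions.exists_forall_le {l L : ℝ} {φ₀ φ₁ φ₀₁ : Plane → Plane → ℝ}
    (hφ : AdmissibleTensions l L φ₀ φ₁ φ₀₁) : ∃ c > 0, ∀ x ∈ Omega l L, ∀ ν, ‖ν‖ = 1 →
      c ≤ φ₁ x ν ∧ c ≤ φ₀ x ν ∧ c ≤ φ₀₁ x ν := by
  obtain ⟨c, _, hc, -, hfilm, hregimeOne, hinterface⟩ := hφ.bounds
  refine ⟨c, hc, fun x hx ν hν => ?_⟩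
  have hle {φ : Plane → Plane → ℝ} {C : ℝ} (hcomp : IsComparable l L c C φ) : c ≤ φ x ν := by
    simpa [hν] using (hcomp x (subset_closure hx) ν).1
  exact ⟨hle hfilm, (hle hregimeOne).trans (min_le_left _ _), hle hinterface⟩

end LengthBound

end FilmLayers

theorem mainTheorem8_general {l L : ℝ} (hl : 0 < l) (hL : 0 < L)
    {φ₀ φ₁ φ₀₁ : FilmLayers.Plane → FilmLayers.Plane → ℝ} {c : ℝ} (hc : 0 < c)
    (hφ : ∀ x ∈ FilmLayers.Omega l L, ∀ ν, ‖ν‖ = 1 → c ≤ φ₁ x ν ∧ c ≤ φ₀ x ν ∧ c ≤ φ₀₁ x ν)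
    {m₁ m₀ : ℕ} {A : ℕ → Set FilmLayers.Plane × Set FilmLayers.Plane}
    (hA : ∀ k, A k ∈ FilmLayers.B1m l L m₁ m₀)
    (hbound : (⨆ k, FilmLayers.surfaceEnergy l L φ₀ φ₁ φ₀₁ (A k)) < ⊤) :
    ∃ n : ℕ → ℕ, StrictMono n ∧
      ∃ B ∈ FilmLayers.B1m l L m₁ m₀,
        FilmLayers.TauConverges l L (fun k => A (n k)) B := by
  obtain ⟨M, hM, hlength⟩ := FilmLayers.exists_length_bound hl hL hc hφ hbound
  have hA_length (k : ℕ) : FilmLayers.H1 (frontier (A k).2 ∪ frontier (A k).1) ≤ M :=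
    hlength (A k) (hA k).1 (le_iSup (fun k => FilmLayers.surfaceEnergy l L φ₀ φ₁ φ₀₁ (A k)) k)
  exact FilmLayers.exists_subseq_tauConverges hl hL hM hA
    (fun k => (measure_mono subset_union_right).trans (hA_length k))
    (fun k => (measure_mono subset_union_left).trans (hA_length k))

theorem mainTheorem8 (l L : ℝ) (hl : 0 < l) (hL : 0 < L)
    (φ₀ φ₁ φ₀₁ : FilmLayers.Plane → FilmLayers.Plane → ℝ)
    (hφ : FilmLayers.AdmissibleTensions l L φ₀ φ₁ φ₀₁)
    (m₁ m₀ : ℕ) (A : ℕ → Set FilmLayers.Plane × Set FilmLayers.Plane)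
    (hA : ∀ k, A k ∈ FilmLayers.B1m l L m₁ m₀)
    (hbound : (⨆ k, (FilmLayers.surfaceEnergy l L φ₀ φ₁ φ₀₁ (A k) + volume (A k).1)) < ⊤) :
    ∃ n : ℕ → ℕ, StrictMono n ∧
      ∃ B ∈ FilmLayers.B1m l L m₁ m₀,
        FilmLayers.TauConverges l L (fun k => A (n k)) B := by
  obtain ⟨c, hc, hφ_ge⟩ := hφ.exists_forall_le
  exact mainTheorem8_general hl hL hc hφ_ge hA
    ((iSup_mono fun k => le_self_add).trans_lt hbound)
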